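/- Let $\Gamma$ be a group with identity element $e$ and let $R=\bigoplus_{\gamma\in\Gamma}R_\gamma$ be a $\Gamma$-graded ring (associative with $1$). **Graded and almost graded division rings.** A ring $E$ is $\Gamma$-almost graded if it has additive subgroups $E_\gamma$ ($\gamma\in\Gamma$) with $1\in E_e$, $E_\gamma E_\delta\subseteq E_{\gamma\delta}$ and $E=\sum_\gamma E_\gamma$; a homomorphism $f$ of $\Gamma$-(almost) graded rings $E\to E'$ is a ring homomorphism with $f(E_\gamma)\subseteq E'_\gamma$ for all $\gamma$. A $\Gamma$-almost graded division ring is a nonzero $\Gamma$-almost graded ring in which every nonzero $x\in E_\gamma$ is invertible with $x^{-1}\in E_{\gamma^{-1}}$. A $\Gamma$-graded division ring is a nonzero $\Gamma$-graded ring in which every nonzero homogeneous element is invertible. A $\Gamma$-graded epic $R$-division ring is a pair $(K,\varphi)$ where $K$ is a $\Gamma$-graded division ring, $\varphi\colon R\to K$ is a homomorphism of $\Gamma$-graded rings, and $K$ is generated by the image of $\varphi$ as a $\Gamma$-graded division ring (the smallest subring of $K$ that contains $\varphi(R)$ and is closed under inverses of nonzero homogeneous elements is $K$). **Homogeneous matrices.**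 For $\alpha\in\Gamma^m$, $\beta\in\Gamma^n$ let $M_{m\times n}(R)[\alpha][\beta]$ be the set of $m\times n$ matrices whose $(i,j)$-entry lies in $R_{\alpha_i\beta_j^{-1}}$, and write $M_n(R)[\alpha][\beta]$ if $m=n$. Let $\mathfrak M(R)$ be the union of all $M_n(R)[\alpha][\beta]$ with $n\ge1$, $\alpha,\beta\in\Gamma^n$. A matrix $A\in\mathfrak M(R)$ of size $n$ is not gr-full if $A=PQ$ with $P\in M_{n\times r}(R)[\alpha][\varepsilon]$, $Q\in M_{r\times n}(R)[\varepsilon][\beta]$ for some $r<n$ and some $\alpha,\beta\in\Gamma^n$, $\varepsilon\in\Gamma^r$. Let $\mathcal N\subseteq\mathfrak M(R)$ be the set of matrices that are not gr-full, and $\mathfrak I$ the set of identity matrices $I_n$, $n\geq 1$. Write $A\oplus B=\begin{pmatrix}A&0\\0&B\end{pmatrix}$. If $A,B\in M_n(R)[\alpha][\beta]$ for some common $\alpha,\beta$ and $A,B$ differ at most in the $i$-th column (resp. row), the determinantal sum $A\nabla B$ with respect to that column (row) is obtained from $A$ by replacing its $i$-th column (row) by the sum of the $i$-th columns (rows) of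 $A$ and $B$. A matrix is a determinantal sum of elements of $\mathcal W\subseteq\mathfrak M(R)$ if it equals $A_1\nabla\cdots\nabla A_m$ for some $m\ge1$, $A_1,\dots,A_m\in\mathcal W$ and some choice of parentheses for which all the sums are defined. **Gr-matrix ideals.** A gr-matrix ideal is a subset $\mathcal I\subseteq\mathfrak M(R)$ such that: (I1) $\mathcal N\subseteq\mathcal I$; (I2) $A\nabla B\in\mathcal I$ whenever $A,B\in\mathcal I$ and $A\nabla B$ is defined; (I3) $A\oplus B\in\mathcal I$ for $A\in\mathcal I$, $B\in\mathfrak M(R)$; (I4) $EAF\in\mathcal I$ for $A\in\mathcal I$ and permutation matrices $E,F$ of the size of $A$; (I5) if $A\in\mathfrak M(R)$ and $A\oplus(1)\in\mathcal I$, then $A\in\mathcal I$. It is proper if $\mathcal I\ne\mathfrak M(R)$. For $\mathcal X\subseteq\mathfrak M(R)$ let $\mathcal D(\mathcal X)$ be the set of matrices $E(X\oplus A)F\in\mathfrak M(R)$ with $X\in\mathcal X$, $A\in\mathfrak M(R)$ or $A$ the empty matrix, and $E,F$ permutation matrices, and let $\mathcal A(\mathcal X)$ be the set of determinantal sums of elements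 of $\mathcal N\cup\mathcal D(\mathcal X)$. Put $\mathcal A(\mathcal N)/\mathfrak I=\{A\in\mathfrak M(R): A\oplus P\in\mathcal A(\mathcal N)\text{ for some }P\in\mathfrak I\}$. The gr-matrix nilradical of $R$ is $$\mathfrak N=\sqrt{\mathcal A(\mathcal N)/\mathfrak I}=\{A\in\mathfrak M(R): A\oplus\cdots\oplus A\ (r\text{ copies})\in\mathcal A(\mathcal N)/\mathfrak I\text{ for some }r\ge1\}.$$ **Theorem.** The following assertions are equivalent. 1. There exists a $\Gamma$-graded epic $R$-division ring $(K,\varphi)$. 2. There exists a homomorphism of $\Gamma$-almost graded rings from $R$ to a $\Gamma$-almost graded division ring. 3. The gr-matrix nilradical $\mathfrak N$ is a proper gr-matrix ideal. 4. No identity matrix $I_n$, $n\ge1$, can be expressed as a determinantal sum of elements of $\mathcal N$. -/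

import Mathlib

universe u v w

namespace GrDiv

section Gradings

variable {Γ : Type v} [Group Γ] {R : Type u} [Ring R]

/-- The additive subgroups `𝒜 γ` turn `R` into a `Γ`-almost graded ring:
`1 ∈ R_e`, `R_γ R_δ ⊆ R_{γδ}` and `R = ∑ R_γ` (the sum need not be direct). -/
structure IsAlmostGradedRing (𝒜 : Γ → AddSubgroup R) : Prop where
  one_mem : (1 : R) ∈ 𝒜 1
  mul_mem : ∀ {γ δ : Γ} {x y : R}, x ∈ 𝒜 γ → y ∈ 𝒜 δ → x * y ∈ 𝒜 (γ * δ)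
  iSup_eq_top : ⨆ γ, 𝒜 γ = ⊤

open scoped Classical in
/-- The additive subgroups `𝒜 γ` turn `R` into a `Γ`-graded ring:
`R = ⨁ R_γ` and `R_γ R_δ ⊆ R_{γδ}` (and hence `1 ∈ R_e`). -/
structure IsGradedRing (𝒜 : Γ → AddSubgroup R) : Prop where
  one_mem : (1 : R) ∈ 𝒜 1
  mul_mem : ∀ {γ δ : Γ} {x y : R}, x ∈ 𝒜 γ → y ∈ 𝒜 δ → x * y ∈ 𝒜 (γ * δ)
  isInternal : DirectSum.IsInternal 𝒜

/-- `Γ`-graded division ring: a nonzero `Γ`-graded ring in which every nonzero homogeneous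
element is invertible. -/
structure IsGradedDivisionRing (𝒜 : Γ → AddSubgroup R) : Prop extends IsGradedRing 𝒜 where
  nontrivial : Nontrivial R
  isUnit : ∀ {γ : Γ} {x : R}, x ∈ 𝒜 γ → x ≠ 0 → IsUnit x

/-- `Γ`-almost graded division ring: a nonzero `Γ`-almost graded ring in which every nonzero
`x ∈ R_γ` is invertible with inverse in `R_{γ⁻¹}`. -/
structure IsAlmostGradedDivisionRing (𝒜 : Γ → AddSubgroup R) : Prop
    extends IsAlmostGradedRing 𝒜 where
  nontrivial : Nontrivial R
  exists_inv : ∀ {γ : Γ} {x : R}, x ∈ 𝒜 γ → x ≠ 0 → ∃ y ∈ 𝒜 γ⁻¹, x * y = 1 ∧ y * x = 1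

/-- Homomorphism of `Γ`-(almost) graded rings: `φ (R_γ) ⊆ S_γ` for all `γ`. -/
def IsGradedHom {S : Type w} [Ring S] (𝒜 : Γ → AddSubgroup R) (ℬ : Γ → AddSubgroup S)
    (φ : R →+* S) : Prop :=
  ∀ (γ : Γ) (x : R), x ∈ 𝒜 γ → φ x ∈ ℬ γ

/-- `DivClosureMem 𝒜 f γ x` says that `x` lies in the component `DC(f)_γ` of the (almost graded)
division closure of a ring homomorphism `f : R → S`. These components are the smallest additive
subgroups of `S` with `f (R_γ) ⊆ DC(f)_γ`, with `DC(f)_γ DC(f)_δ ⊆ DC(f)_{γδ}`, and such that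
`x ∈ DC(f)_γ` invertible in `S` implies `x⁻¹ ∈ DC(f)_{γ⁻¹}`. -/
inductive DivClosureMem {S : Type w} [Ring S] (𝒜 : Γ → AddSubgroup R) (f : R →+* S) :
    Γ → S → Prop
  | map {γ : Γ} {r : R} (hr : r ∈ 𝒜 γ) : DivClosureMem 𝒜 f γ (f r)
  | add {γ : Γ} {x y : S} (hx : DivClosureMem 𝒜 f γ x) (hy : DivClosureMem 𝒜 f γ y) :
      DivClosureMem 𝒜 f γ (x + y)
  | neg {γ : Γ} {x : S} (hx : DivClosureMem 𝒜 f γ x) : DivClosureMem 𝒜 f γ (-x)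
  | mul {γ δ : Γ} {x y : S} (hx : DivClosureMem 𝒜 f γ x) (hy : DivClosureMem 𝒜 f δ y) :
      DivClosureMem 𝒜 f (γ * δ) (x * y)
  | inv {γ : Γ} {x y : S} (hx : DivClosureMem 𝒜 f γ x) (hxy : x * y = 1) (hyx : y * x = 1) :
      DivClosureMem 𝒜 f γ⁻¹ y

/-- The (almost graded) division closure `DC(f) = ∑ DC(f)_γ`. -/
def divClosure {S : Type w} [Ring S] (𝒜 : Γ → AddSubgroup R) (f : R →+* S) : AddSubgroup S :=
  AddSubgroup.closure {x | ∃ γ, DivClosureMem 𝒜 f γ x}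

/-- `(K, φ)`, with the grading `ℬ` of `K`, is a `Γ`-graded epic `R`-division ring: `K` is a
`Γ`-graded division ring, `φ : R → K` is a homomorphism of `Γ`-graded rings, and `K = DC(φ)`. -/
structure IsGradedEpicDivisionRing {K : Type w} [Ring K] (𝒜 : Γ → AddSubgroup R)
    (ℬ : Γ → AddSubgroup K) (φ : R →+* K) : Prop where
  isGradedDivisionRing : IsGradedDivisionRing ℬ
  isGradedHom : IsGradedHom 𝒜 ℬ φ
  divClosure_eq_top : divClosure 𝒜 φ = ⊤

end Gradings

section Matrices

/-- Square matrices over `R`, of any size. -/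
abbrev SqMat (R : Type u) : Type u := Σ n : ℕ, Matrix (Fin n) (Fin n) R

/-- The diagonal sum `A ⊕ B`. -/
def diagSum {R : Type u} [Ring R] (A B : SqMat R) : SqMat R :=
  ⟨A.1 + B.1,
    Matrix.reindex finSumFinEquiv finSumFinEquiv (Matrix.fromBlocks A.2 0 0 B.2)⟩

/-- `diagPow A r` is the diagonal sum of `r + 1` copies of `A`. -/
def diagPow {R : Type u} [Ring R] (A : SqMat R) : ℕ → SqMat R
  | 0 => A
  | r + 1 => diagSum (diagPow A r) A

/-- The set of all identity matrices, of size `n ≥ 1`. -/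
def identityMatrices (R : Type u) [Ring R] : Set (SqMat R) :=
  {M | ∃ n : ℕ, 1 ≤ n ∧ M = ⟨n, 1⟩}

variable {Γ : Type v} [Group Γ] {R : Type u} [Ring R] (𝒜 : Γ → AddSubgroup R)

/-- `A ∈ M_{m×n}(R)[α][β]`: the `(i,j)`-entry of `A` lies in `R_{α_i β_j⁻¹}`. -/
def HasDegrees {m n : ℕ} (α : Fin m → Γ) (β : Fin n → Γ) (A : Matrix (Fin m) (Fin n) R) : Prop :=
  ∀ i j, A i j ∈ 𝒜 (α i * (β j)⁻¹)

/-- The set `𝔐(R)` of all homogeneous square matrices (of size `n ≥ 1`). -/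
def homMatrices : Set (SqMat R) :=
  {M | 1 ≤ M.1 ∧ ∃ α β : Fin M.1 → Γ, HasDegrees 𝒜 α β M.2}

/-- `A` is not gr-full: for some degree sequences `α, β, ε` and some `r < n` there is a
factorization `A = P Q` with `P ∈ M_{n×r}(R)[α][ε]` and `Q ∈ M_{r×n}(R)[ε][β]`. -/
def NotGrFull {n : ℕ} (A : Matrix (Fin n) (Fin n) R) : Prop :=
  ∃ (r : ℕ) (α β : Fin n → Γ) (ε : Fin r → Γ)
    (P : Matrix (Fin n) (Fin r) R) (Q : Matrix (Fin r) (Fin n) R),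
    r < n ∧ HasDegrees 𝒜 α ε P ∧ HasDegrees 𝒜 ε β Q ∧ A = P * Q

/-- The set `𝒩` of the homogeneous square matrices that are not gr-full. -/
def nonGrFull : Set (SqMat R) :=
  {M | M ∈ homMatrices 𝒜 ∧ NotGrFull 𝒜 M.2}

/-- `C = A ∇ B`, with respect to some column or some row: `A` and `B` lie in a common
`M_n(R)[α][β]`, they differ at most in the `i`-th column (row), and `C` is obtained from `A` by
replacing its `i`-th column (row) by the sum of the `i`-th columns (rows) of `A` and `B`. -/
def IsNabla {n : ℕ} (A B C : Matrix (Fin n) (Fin n) R) : Prop :=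
  (∃ α β : Fin n → Γ, HasDegrees 𝒜 α β A ∧ HasDegrees 𝒜 α β B) ∧
    ((∃ i, (∀ k j, j ≠ i → A k j = B k j) ∧ C = A.updateCol i (fun k => A k i + B k i)) ∨
      (∃ i, (∀ j k, j ≠ i → A j k = B j k) ∧ C = A.updateRow i (fun k => A i k + B i k)))

/-- `C` is a determinantal sum of elements of `𝒲`: `C = A₁ ∇ ⋯ ∇ A_m` for some `m ≥ 1`,
some `A₁, …, A_m ∈ 𝒲` and some choice of parentheses. -/
inductive IsDetSum (𝒲 : Set (SqMat R)) : SqMat R → Prop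
  | of {M : SqMat R} (hM : M ∈ 𝒲) : IsDetSum 𝒲 M
  | nabla {n : ℕ} {A B C : Matrix (Fin n) (Fin n) R} (hA : IsDetSum 𝒲 ⟨n, A⟩)
      (hB : IsDetSum 𝒲 ⟨n, B⟩) (hC : IsNabla 𝒜 A B C) : IsDetSum 𝒲 ⟨n, C⟩

/-- Gr-matrix ideals of `R`. -/
structure IsGrMatrixIdeal (I : Set (SqMat R)) : Prop where
  subset_homMatrices : I ⊆ homMatrices 𝒜
  nonGrFull_subset : nonGrFull 𝒜 ⊆ I
  nabla_mem : ∀ {n : ℕ} {A B C : Matrix (Fin n) (Fin n) R},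
    (⟨n, A⟩ : SqMat R) ∈ I → (⟨n, B⟩ : SqMat R) ∈ I → IsNabla 𝒜 A B C → (⟨n, C⟩ : SqMat R) ∈ I
  diagSum_mem : ∀ {A B : SqMat R}, A ∈ I → B ∈ homMatrices 𝒜 → diagSum A B ∈ I
  perm_mem : ∀ {n : ℕ} {A : Matrix (Fin n) (Fin n) R} (σ τ : Equiv.Perm (Fin n)),
    (⟨n, A⟩ : SqMat R) ∈ I → (⟨n, σ.permMatrix R * A * τ.permMatrix R⟩ : SqMat R) ∈ I
  of_diagSum_one : ∀ {A : SqMat R}, A ∈ homMatrices 𝒜 → diagSum A ⟨1, 1⟩ ∈ I → A ∈ I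

/-- A proper gr-matrix ideal: a gr-matrix ideal different from `𝔐(R)`. -/
structure IsProperGrMatrixIdeal (I : Set (SqMat R)) : Prop extends IsGrMatrixIdeal 𝒜 I where
  ne_homMatrices : I ≠ homMatrices 𝒜

/-- `𝒟(𝒳)`: the homogeneous matrices of the form `E (X ⊕ A) F`, where `X ∈ 𝒳`, where `A` is a
homogeneous square matrix or the empty matrix, and where `E, F` are permutation matrices. -/
def permDiagSums (𝒳 : Set (SqMat R)) : Set (SqMat R) :=
  {M | M ∈ homMatrices 𝒜 ∧ ∃ X ∈ 𝒳, ∃ A : SqMat R, (A ∈ homMatrices 𝒜 ∨ A.1 = 0) ∧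
    ∃ σ τ : Equiv.Perm (Fin (diagSum X A).1),
      M = ⟨(diagSum X A).1, σ.permMatrix R * (diagSum X A).2 * τ.permMatrix R⟩}

/-- `𝒜(𝒳)`: the homogeneous matrices that are determinantal sums of elements of `𝒩 ∪ 𝒟(𝒳)`
(the gr-matrix pre-ideal generated by `𝒳`). -/
def preidealGen (𝒳 : Set (SqMat R)) : Set (SqMat R) :=
  {M | M ∈ homMatrices 𝒜 ∧ IsDetSum 𝒜 (nonGrFull 𝒜 ∪ permDiagSums 𝒜 𝒳) M}

/-- `I / S = {A ∈ 𝔐(R) : A ⊕ P ∈ I for some P ∈ S}`. -/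
def quotientBy (I S : Set (SqMat R)) : Set (SqMat R) :=
  {M | M ∈ homMatrices 𝒜 ∧ ∃ P ∈ S, diagSum M P ∈ I}

/-- The radical `√I = {A ∈ 𝔐(R) : ⊕^r A ∈ I for some r ≥ 1}`. -/
def grRadical (I : Set (SqMat R)) : Set (SqMat R) :=
  {M | M ∈ homMatrices 𝒜 ∧ ∃ r : ℕ, diagPow M r ∈ I}

/-- The gr-matrix nilradical of `R`: the radical of the least gr-matrix ideal `𝒜(𝒩)/𝔍`, where `𝔍`
is the set of identity matrices. -/
def grMatrixNilradical : Set (SqMat R) :=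
  grRadical 𝒜 (quotientBy 𝒜 (preidealGen 𝒜 (nonGrFull 𝒜)) (identityMatrices R))

end Matrices

end GrDiv

set_option linter.unusedSectionVars false

/-! The proof is the cycle 1 → 2 → 4 → 3 → 1.

1 → 2 holds because, in a graded division ring, the inverse of a nonzero element of degree γ is
homogeneous of degree γ⁻¹.

2 → 4 is linear algebra. Over an almost graded division ring, a homogeneous matrix with more columns
than rows has a nonzero kernel vector, so matrices that are not gr-full become singular.
Determinantal sums of singular homogeneous matrices stay singular: two kernel vectors can be
normalised in the distinguished coordinate and glued (`not_isUnit_updateCol`); the row case follows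
in the opposite ring. Identity matrices remain invertible.

4 → 3 is the calculus of matrix ideals. Here 𝒜(𝒩) is just the set of determinantal sums of elements
of 𝒩. Quotienting by identity summands and taking the radical give a gr-matrix ideal; were it
improper, it would contain the matrix (1), and some identity matrix would be a determinantal sum
from 𝒩.

3 → 1: by Zorn there is a maximal proper gr-matrix ideal P, and it is prime. P should become the set
of matrices singular over K, whose homogeneous elements should be the fractions f A⁻¹ x with A ∉ P.
Instead of defining ring operations on classes of fractions, the proof first builds the left
R-module M that K ought to be. It is generated by the unknowns of all systems A v = x with A ∉ P,
modulo the linear forms h whose bordered matrix [[C, y], [h, 0]] lies in P, where C v = y collects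
finitely many of the systems. Matrices outside P act bijectively on columns over M
(`eq_zero_of_sum_smul_eq_zero`, `exists_sum_smul_eq`), so they become invertible over End_ℤ(M), and
K is the division closure of R there. The homogeneous elements of K are fractions
(`DivClosureMem.isFrac`). A nonzero fraction is a unit because its bordered matrix is outside P and
hence invertible (`IsFrac.isUnit`). The components are independent because the relations of M are
graded, as seen by applying fractions to the class of 1 (`eq_zero_of_sum_isFrac`). -/

namespace GrDiv

/-! ### Degree bookkeeping for homogeneous matrices. -/

section Degrees

variable {Γ : Type v} [Group Γ] {R : Type u} [Ring R]

/-- The multiplicative part of an (almost) graded ring structure. -/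
structure IsGradedMul (𝒜 : Γ → AddSubgroup R) : Prop where
  one_mem : (1 : R) ∈ 𝒜 1
  mul_mem : ∀ {γ δ : Γ} {x y : R}, x ∈ 𝒜 γ → y ∈ 𝒜 δ → x * y ∈ 𝒜 (γ * δ)

theorem IsGradedRing.isGradedMul {𝒜 : Γ → AddSubgroup R} (h : IsGradedRing 𝒜) :
    IsGradedMul 𝒜 :=
  ⟨h.one_mem, h.mul_mem⟩

theorem IsAlmostGradedRing.isGradedMul {𝒜 : Γ → AddSubgroup R} (h : IsAlmostGradedRing 𝒜) :
    IsGradedMul 𝒜 :=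
  ⟨h.one_mem, h.mul_mem⟩

/-- Homogeneous matrices with arbitrary index types: the `(i,j)`-entry lies in `R_{α_i β_j⁻¹}`. -/
def HomDeg {ι κ : Type*} (𝒜 : Γ → AddSubgroup R) (α : ι → Γ) (β : κ → Γ) (A : Matrix ι κ R) :
    Prop :=
  ∀ i j, A i j ∈ 𝒜 (α i * (β j)⁻¹)

namespace HomDeg

variable {𝒜 : Γ → AddSubgroup R} {ι κ μ ν ι' κ' : Type*}
  {α : ι → Γ} {β : κ → Γ} {γ : μ → Γ} {δ : ν → Γ}

theorem zero : HomDeg 𝒜 α β (0 : Matrix ι κ R) := fun _ _ => zero_mem _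

theorem neg {A : Matrix ι κ R} (hA : HomDeg 𝒜 α β A) : HomDeg 𝒜 α β (-A) :=
  fun i j => neg_mem (hA i j)

theorem sub {A B : Matrix ι κ R} (hA : HomDeg 𝒜 α β A) (hB : HomDeg 𝒜 α β B) :
    HomDeg 𝒜 α β (A - B) := fun i j => sub_mem (hA i j) (hB i j)

theorem mul [Fintype κ] (h : IsGradedMul 𝒜) {A : Matrix ι κ R} {B : Matrix κ μ R}
    (hA : HomDeg 𝒜 α β A) (hB : HomDeg 𝒜 β γ B) : HomDeg 𝒜 α γ (A * B) := fun i j => by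
  rw [Matrix.mul_apply]
  refine sum_mem fun k _ => ?_
  have := h.mul_mem (hA i k) (hB k j)
  rwa [mul_assoc, inv_mul_cancel_left] at this

theorem one [DecidableEq ι] (h : IsGradedMul 𝒜) : HomDeg 𝒜 α α (1 : Matrix ι ι R) :=
  fun i j => by
    rcases eq_or_ne i j with rfl | hij
    · rw [Matrix.one_apply_eq, mul_inv_cancel]; exact h.one_mem
    · rw [Matrix.one_apply_ne hij]; exact zero_mem _

theorem fromBlocks {A : Matrix ι κ R} {B : Matrix ι ν R} {C : Matrix μ κ R} {D : Matrix μ ν R}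
    (hA : HomDeg 𝒜 α β A) (hB : HomDeg 𝒜 α δ B) (hC : HomDeg 𝒜 γ β C) (hD : HomDeg 𝒜 γ δ D) :
    HomDeg 𝒜 (Sum.elim α γ) (Sum.elim β δ) (Matrix.fromBlocks A B C D) := by
  rintro (i | i) (j | j)
  exacts [hA i j, hB i j, hC i j, hD i j]

theorem submatrix {A : Matrix ι κ R} (hA : HomDeg 𝒜 α β A) (f : ι' → ι) (g : κ' → κ) :
    HomDeg 𝒜 (α ∘ f) (β ∘ g) (A.submatrix f g) := fun i j => hA (f i) (g j)

/-- Only the quotients α_i β_j⁻¹ matter. This freedom lets blocks with unrelated degree sequences be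
glued into one homogeneous matrix. -/
theorem shift {A : Matrix ι κ R} (hA : HomDeg 𝒜 α β A) (δ : Γ) :
    HomDeg 𝒜 (fun i => α i * δ) (fun j => β j * δ) A := fun i j => by
  have := hA i j
  simpa [mul_assoc] using this

end HomDeg

end Degrees


/-! ### Membership up to numbering of rows and columns. -/

section Mem

variable {Γ : Type v} [Group Γ] {R : Type u} [Ring R] {𝒜 : Γ → AddSubgroup R}
  {I : Set (SqMat R)}

/-- The properties of gr-matrix ideals other than cancellation of identity summands. -/
structure IsPreideal (𝒜 : Γ → AddSubgroup R) (I : Set (SqMat R)) : Prop where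
  subset_homMatrices : I ⊆ homMatrices 𝒜
  nonGrFull_subset : nonGrFull 𝒜 ⊆ I
  nabla_mem : ∀ {n : ℕ} {A B C : Matrix (Fin n) (Fin n) R},
    (⟨n, A⟩ : SqMat R) ∈ I → (⟨n, B⟩ : SqMat R) ∈ I → IsNabla 𝒜 A B C → (⟨n, C⟩ : SqMat R) ∈ I
  diagSum_mem : ∀ {A B : SqMat R}, A ∈ I → B ∈ homMatrices 𝒜 → diagSum A B ∈ I
  perm_mem : ∀ {n : ℕ} {A : Matrix (Fin n) (Fin n) R} (σ τ : Equiv.Perm (Fin n)),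
    (⟨n, A⟩ : SqMat R) ∈ I → (⟨n, σ.permMatrix R * A * τ.permMatrix R⟩ : SqMat R) ∈ I

theorem IsGrMatrixIdeal.isPreideal (h : IsGrMatrixIdeal 𝒜 I) : IsPreideal 𝒜 I :=
  ⟨h.subset_homMatrices, h.nonGrFull_subset, h.nabla_mem, h.diagSum_mem, h.perm_mem⟩

/-- Membership in a set of square matrices, for matrices whose rows and columns are indexed by
arbitrary types of the same finite cardinality, up to numbering the rows and columns. -/
def Mem {ι κ : Type*} (I : Set (SqMat R)) (A : Matrix ι κ R) : Prop :=
  ∃ (n : ℕ) (e : Fin n ≃ ι) (e' : Fin n ≃ κ), (⟨n, A.submatrix e e'⟩ : SqMat R) ∈ I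

theorem Mem.submatrix {ι κ ι' κ' : Type*} {A : Matrix ι κ R} (hA : Mem I A) (e : ι' ≃ ι)
    (e' : κ' ≃ κ) : Mem I (A.submatrix e e') := by
  obtain ⟨n, f, f', h⟩ := hA
  refine ⟨n, f.trans e.symm, f'.trans e'.symm, ?_⟩
  convert h using 2
  ext i j
  simp

theorem mem_submatrix_iff {ι κ ι' κ' : Type*} {A : Matrix ι κ R} (e : ι' ≃ ι)
    (e' : κ' ≃ κ) : Mem I (A.submatrix e e') ↔ Mem I A := by
  refine ⟨fun h => ?_, fun h => h.submatrix e e'⟩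
  have := h.submatrix e.symm e'.symm
  simpa using this

theorem mem_of_mem {n : ℕ} {A : Matrix (Fin n) (Fin n) R} (h : (⟨n, A⟩ : SqMat R) ∈ I) :
    Mem I A :=
  ⟨n, Equiv.refl _, Equiv.refl _, h⟩

theorem permMatrix_mul_mul_permMatrix {n : ℕ} (A : Matrix (Fin n) (Fin n) R)
    (σ τ : Equiv.Perm (Fin n)) :
    σ.permMatrix R * A * τ.permMatrix R = A.submatrix σ τ.symm := by
  rw [PEquiv.toMatrix_toPEquiv_mul, PEquiv.mul_toMatrix_toPEquiv, Matrix.submatrix_submatrix]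
  rfl

namespace IsPreideal

theorem mem_iff (hI : IsPreideal 𝒜 I) {n : ℕ} {A : Matrix (Fin n) (Fin n) R} :
    Mem I A ↔ (⟨n, A⟩ : SqMat R) ∈ I := by
  refine ⟨?_, mem_of_mem⟩
  rintro ⟨m, e, e', h⟩
  obtain rfl : m = n := by simpa using Fintype.card_congr e
  have := hI.perm_mem e.symm e' h
  rw [permMatrix_mul_mul_permMatrix] at this
  convert this using 2
  ext i j
  simp

theorem mem_of_equiv (hI : IsPreideal 𝒜 I) {ι κ : Type*} {A : Matrix ι κ R} (h : Mem I A) {n : ℕ} (e : Fin n ≃ ι)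
    (e' : Fin n ≃ κ) : (⟨n, A.submatrix e e'⟩ : SqMat R) ∈ I :=
  hI.mem_iff.1 (h.submatrix e e')

end IsPreideal

end Mem

end GrDiv

namespace GrDiv

/-! ### Block matrices in preideals. -/

section MemCalculus

variable {Γ : Type v} [Group Γ] {R : Type u} [Ring R] {𝒜 : Γ → AddSubgroup R}
  {I : Set (SqMat R)} {ι κ μ ν ρ : Type*} {α : ι → Γ} {β : κ → Γ} {γ : μ → Γ} {δ : ν → Γ}

theorem notGrFull_of_submatrix {n : ℕ} {ρ : Type*} [Fintype ρ] {ι κ : Type*} {α : ι → Γ}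
    {β : κ → Γ} {ε : ρ → Γ} {P : Matrix ι ρ R} {Q : Matrix ρ κ R} (hP : HomDeg 𝒜 α ε P)
    (hQ : HomDeg 𝒜 ε β Q) (hρ : Fintype.card ρ < n) (e : Fin n → ι) (e' : Fin n → κ) :
    NotGrFull 𝒜 ((P * Q).submatrix e e') := by
  let f := (Fintype.equivFin ρ).symm
  refine ⟨Fintype.card ρ, α ∘ e, β ∘ e', ε ∘ f, P.submatrix e f, Q.submatrix f e', hρ,
    hP.submatrix e f, hQ.submatrix f e', ?_⟩
  rw [Matrix.submatrix_mul_equiv]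

theorem IsPreideal.mem_mul [Fintype ι] [Fintype κ] [Fintype ρ] (hI : IsPreideal 𝒜 I)
    (h𝒜 : IsGradedMul 𝒜) {ε : ρ → Γ} {P : Matrix ι ρ R} {Q : Matrix ρ κ R}
    (hP : HomDeg 𝒜 α ε P) (hQ : HomDeg 𝒜 ε β Q) (hρ : Fintype.card ρ < Fintype.card ι)
    (hικ : Fintype.card ι = Fintype.card κ) : Mem I (P * Q) := by
  let e := (Fintype.equivFin ι).symm
  let e' := (Fintype.equivFinOfCardEq hικ.symm).symm
  refine ⟨Fintype.card ι, e, e', hI.nonGrFull_subset ⟨⟨?_, α ∘ e, β ∘ e', ?_⟩, ?_⟩⟩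
  · change 1 ≤ Fintype.card ι
    omega
  · exact (hP.mul h𝒜 hQ).submatrix e e'
  · exact notGrFull_of_submatrix hP hQ hρ e e'

theorem Mem.card_eq [Fintype ι] [Fintype κ] {A : Matrix ι κ R} (h : Mem I A) :
    Fintype.card ι = Fintype.card κ := by
  obtain ⟨n, e, e', -⟩ := h
  exact Fintype.card_congr (e.symm.trans e')

/-- Row form of the closure under determinantal sums. -/
theorem IsPreideal.mem_add_row (hI : IsPreideal 𝒜 I) {A B C : Matrix ι κ R}
    (hA : HomDeg 𝒜 α β A) (hB : HomDeg 𝒜 α β B) (i : ι) (hAB : ∀ k, k ≠ i → A k = B k)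
    (hAC : ∀ k, k ≠ i → C k = A k) (hC : C i = A i + B i) (mA : Mem I A) (mB : Mem I B) :
    Mem I C := by
  obtain ⟨n, e, e', h⟩ := mA
  refine ⟨n, e, e', hI.nabla_mem h (hI.mem_of_equiv mB e e')
    ⟨⟨α ∘ e, β ∘ e', hA.submatrix e e', hB.submatrix e e'⟩, Or.inr ⟨e.symm i, ?_, ?_⟩⟩⟩
  · intro j k hj
    have : e j ≠ i := fun h => hj (by simp [← h])
    simp [hAB _ this]
  · ext j k
    rcases eq_or_ne j (e.symm i) with rfl | hj
    · simp [hC]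
    · have : e j ≠ i := fun h => hj (by simp [← h])
      simp [Matrix.updateRow_ne hj, hAC _ this]

/-- Column form of the closure under determinantal sums. -/
theorem IsPreideal.mem_add_col (hI : IsPreideal 𝒜 I) {A B C : Matrix ι κ R}
    (hA : HomDeg 𝒜 α β A) (hB : HomDeg 𝒜 α β B) (j : κ)
    (hAB : ∀ i k, k ≠ j → A i k = B i k)
    (hAC : ∀ i k, k ≠ j → C i k = A i k) (hC : ∀ i, C i j = A i j + B i j) (mA : Mem I A)
    (mB : Mem I B) : Mem I C := by
  obtain ⟨n, e, e', h⟩ := mA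
  refine ⟨n, e, e', hI.nabla_mem h (hI.mem_of_equiv mB e e')
    ⟨⟨α ∘ e, β ∘ e', hA.submatrix e e', hB.submatrix e e'⟩, Or.inl ⟨e'.symm j, ?_, ?_⟩⟩⟩
  · intro i k hk
    have : e' k ≠ j := fun h => hk (by simp [← h])
    simp [hAB _ _ this]
  · ext i k
    rcases eq_or_ne k (e'.symm j) with rfl | hk
    · simp [hC]
    · have : e' k ≠ j := fun h => hk (by simp [← h])
      simp [Matrix.updateCol_ne hk, hAC _ _ this]

/-- Adding `X` to `Y` in the rows in `S` stays in the ideal if all matrices with a row in `S`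
equal to that of `X` and with the rows outside `S` equal to those of `Y` lie in it. -/
theorem IsPreideal.mem_add_rows (hI : IsPreideal 𝒜 I) {X Y : Matrix ι κ R}
    (hX : HomDeg 𝒜 α β X) (hY : HomDeg 𝒜 α β Y) (S : Finset ι) (hXS : ∀ k ∉ S, X k = 0)
    (h : ∀ i ∈ S, ∀ Z : Matrix ι κ R, HomDeg 𝒜 α β Z → (∀ k ∉ S, Z k = Y k) → Z i = X i →
      Mem I Z) (mY : Mem I Y) : Mem I (X + Y) := by
  classical
  -- The rows are changed one at a time. Passing from T to T ∪ {i} is one determinantal sum in row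
  -- i, whose summands have row i equal to that of X and to that of Y; `h` covers the first and the
  -- induction hypothesis the second.
  have key : ∀ T : Finset ι, T ⊆ S →
      Mem I (fun k => if k ∈ T then X k + Y k else Y k : Matrix ι κ R) := by
    intro T
    induction T using Finset.induction_on with
    | empty => intro _; simpa using mY
    | insert i T hi ih =>
      intro hT
      have hiS : i ∈ S := hT (Finset.mem_insert_self _ _)
      have hTS : T ⊆ S := fun k hk => hT (Finset.mem_insert_of_mem hk)
      have hdeg : HomDeg 𝒜 α β (fun k => if k ∈ T then X k + Y k else Y k : Matrix ι κ R) := by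
        intro k l
        by_cases hk : k ∈ T
        · simpa [hk] using add_mem (hX k l) (hY k l)
        · simpa [hk] using hY k l
      have hdeg' : HomDeg 𝒜 α β
          (fun k => if k = i then X k else if k ∈ T then X k + Y k else Y k :
            Matrix ι κ R) := by
        intro k l
        by_cases hk : k = i
        · simpa [hk] using hX i l
        · simpa [hk] using hdeg k l
      refine hI.mem_add_row hdeg' hdeg i ?_ ?_ ?_ (h i hiS _ hdeg' ?_ ?_) (ih hTS)
      · intro k hk; simp [hk]
      · intro k hk; simp [hk]
      · simp [hi]
      · intro k hk
        have h1 : k ≠ i := fun h => hk (h ▸ hiS)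
        have h2 : k ∉ T := fun h => hk (hTS h)
        simp [h1, h2]
      · simp
  have hXY : X + Y = (fun k => if k ∈ S then X k + Y k else Y k : Matrix ι κ R) := by
    ext k l
    by_cases hk : k ∈ S
    · simp [hk]
    · simp [hk, hXS k hk]
  rw [hXY]
  exact key S subset_rfl

/-- Column version of `IsPreideal.mem_add_rows`. -/
theorem IsPreideal.mem_add_cols (hI : IsPreideal 𝒜 I) {X Y : Matrix ι κ R}
    (hX : HomDeg 𝒜 α β X) (hY : HomDeg 𝒜 α β Y) (S : Finset κ) (hXS : ∀ i, ∀ k ∉ S, X i k = 0)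
    (h : ∀ j ∈ S, ∀ Z : Matrix ι κ R, HomDeg 𝒜 α β Z → (∀ i, ∀ k ∉ S, Z i k = Y i k) →
      (∀ i, Z i j = X i j) → Mem I Z) (mY : Mem I Y) : Mem I (X + Y) := by
  classical
  have key : ∀ T : Finset κ, T ⊆ S →
      Mem I (fun i k => if k ∈ T then X i k + Y i k else Y i k : Matrix ι κ R) := by
    intro T
    induction T using Finset.induction_on with
    | empty => intro _; simpa using mY
    | insert j T hj ih =>
      intro hT
      have hjS : j ∈ S := hT (Finset.mem_insert_self _ _)
      have hTS : T ⊆ S := fun k hk => hT (Finset.mem_insert_of_mem hk)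
      have hdeg : HomDeg 𝒜 α β
          (fun i k => if k ∈ T then X i k + Y i k else Y i k : Matrix ι κ R) := by
        intro i k
        by_cases hk : k ∈ T
        · simpa [hk] using add_mem (hX i k) (hY i k)
        · simpa [hk] using hY i k
      have hdeg' : HomDeg 𝒜 α β
          (fun i k => if k = j then X i k else if k ∈ T then X i k + Y i k else Y i k :
            Matrix ι κ R) := by
        intro i k
        by_cases hk : k = j
        · simpa [hk] using hX i j
        · simpa [hk] using hdeg i k
      refine hI.mem_add_col hdeg' hdeg j ?_ ?_ ?_ (h j hjS _ hdeg' ?_ ?_) (ih hTS)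
      · intro i k hk; simp [hk]
      · intro i k hk; simp [hk]
      · intro i; simp [hj]
      · intro i k hk
        have h1 : k ≠ j := fun h => hk (h ▸ hjS)
        have h2 : k ∉ T := fun h => hk (hTS h)
        simp [h1, h2]
      · intro i; simp
  have hXY : X + Y = (fun i k => if k ∈ S then X i k + Y i k else Y i k : Matrix ι κ R) := by
    ext i k
    by_cases hk : k ∈ S
    · simp [hk]
    · simp [hk, hXS i k hk]
  rw [hXY]
  exact key S subset_rfl

variable [Fintype ι] [Fintype κ] [Fintype μ] [Fintype ν]

/-- The matrix factors as [[A, 0], [0, 1]] · [[1, 0], [C, D]] through the index type κ ⊕ μ, which is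
smaller than ι ⊕ μ, so it is not gr-full. -/
theorem IsPreideal.mem_fromBlocks_hollow (hI : IsPreideal 𝒜 I) (h𝒜 : IsGradedMul 𝒜)
    {A : Matrix ι κ R} {C : Matrix μ κ R} {D : Matrix μ ν R} (hA : HomDeg 𝒜 α β A)
    (hC : HomDeg 𝒜 γ β C) (hD : HomDeg 𝒜 γ δ D) (hcard : Fintype.card κ < Fintype.card ι)
    (hsq : Fintype.card (ι ⊕ μ) = Fintype.card (κ ⊕ ν)) :
    Mem I (Matrix.fromBlocks A 0 C D) := by
  classical
  have := hI.mem_mul h𝒜 (hA.fromBlocks .zero .zero (.one h𝒜))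
    ((HomDeg.one h𝒜).fromBlocks .zero hC hD)
    (by simpa using hcard) hsq
  simpa [Matrix.fromBlocks_multiply] using this

/-- After a reordering this is the block case: more rows are selected by `a` than there are columns
in which they can be nonzero. -/
theorem IsPreideal.mem_hollow {ι₁ κ₁ : Type*} [Fintype ι₁] [Fintype κ₁] (hI : IsPreideal 𝒜 I)
    (h𝒜 : IsGradedMul 𝒜) {A : Matrix ι κ R} (hA : HomDeg 𝒜 α β A) {a : ι₁ → ι} {b : κ₁ → κ}
    (ha : a.Injective) (hb : b.Injective) (hcard : Fintype.card κ₁ < Fintype.card ι₁)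
    (hsq : Fintype.card ι = Fintype.card κ) (h0 : ∀ i j, j ∉ Set.range b → A (a i) j = 0) :
    Mem I A := by
  classical
  let e : ι₁ ⊕ ((Set.range a)ᶜ : Set ι) ≃ ι :=
    (Equiv.sumCongr (Equiv.ofInjective a ha) (Equiv.refl _)).trans (Equiv.Set.sumCompl _)
  let f : κ₁ ⊕ ((Set.range b)ᶜ : Set κ) ≃ κ :=
    (Equiv.sumCongr (Equiv.ofInjective b hb) (Equiv.refl _)).trans (Equiv.Set.sumCompl _)
  rw [← mem_submatrix_iff e f]
  have hdeg := hA.submatrix e f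
  have : A.submatrix e f = Matrix.fromBlocks (A.submatrix e f).toBlocks₁₁ 0
      (A.submatrix e f).toBlocks₂₁ (A.submatrix e f).toBlocks₂₂ := by
    conv_lhs => rw [← Matrix.fromBlocks_toBlocks (A.submatrix e f)]
    congr 1
    ext i j
    exact h0 i _ j.2
  rw [this]
  refine hI.mem_fromBlocks_hollow (α := α ∘ e ∘ Sum.inl) (β := β ∘ f ∘ Sum.inl)
    (γ := α ∘ e ∘ Sum.inr) (δ := β ∘ f ∘ Sum.inr) h𝒜 ?_ ?_ ?_ hcard ?_
  · exact fun i j => hdeg _ _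
  · exact fun i j => hdeg _ _
  · exact fun i j => hdeg _ _
  · rw [Fintype.card_congr e, Fintype.card_congr f, hsq]

theorem IsPreideal.mem_fromBlocks_diag (hI : IsPreideal 𝒜 I)
    {A : Matrix ι κ R} {B : Matrix μ ν R} (hA : Mem I A) (hB : HomDeg 𝒜 γ δ B)
    (hcard : Fintype.card μ = Fintype.card ν) : Mem I (Matrix.fromBlocks A 0 0 B) := by
  obtain ⟨n, e, e', h⟩ := hA
  rcases isEmpty_or_nonempty μ with hμ | hμ
  · have : IsEmpty ν := by
      rw [← Fintype.card_eq_zero_iff, ← hcard, Fintype.card_eq_zero_iff]; exact hμ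
    refine ⟨n, e.trans (Equiv.sumEmpty ι μ).symm, e'.trans (Equiv.sumEmpty κ ν).symm, ?_⟩
    convert h using 2
    ext i j
    simp
  · let f := (Fintype.equivFin μ).symm
    let f' := (Fintype.equivFinOfCardEq hcard.symm).symm
    have h2 : (⟨Fintype.card μ, B.submatrix f f'⟩ : SqMat R) ∈ homMatrices 𝒜 :=
      ⟨Fintype.card_pos, γ ∘ f, δ ∘ f', hB.submatrix f f'⟩
    refine ⟨_, finSumFinEquiv.symm.trans (Equiv.sumCongr e f),
      finSumFinEquiv.symm.trans (Equiv.sumCongr e' f'), ?_⟩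
    convert hI.diagSum_mem h h2 using 1
    simp only [diagSum]
    congr 1
    ext i j
    obtain ⟨i, rfl⟩ := finSumFinEquiv.surjective i
    obtain ⟨j, rfl⟩ := finSumFinEquiv.surjective j
    rcases i with i | i <;> rcases j with j | j <;> simp

/-- The off-diagonal block of a block triangular matrix can be changed. -/
theorem IsPreideal.mem_fromBlocks_lower (hI : IsPreideal 𝒜 I) (h𝒜 : IsGradedMul 𝒜)
    {A : Matrix ι κ R} {C C' : Matrix μ κ R} {D : Matrix μ ν R} (hA : HomDeg 𝒜 α β A)
    (hC : HomDeg 𝒜 γ β C) (hC' : HomDeg 𝒜 γ β C') (hD : HomDeg 𝒜 γ δ D)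
    (hcard : Fintype.card ι = Fintype.card κ) (h : Mem I (Matrix.fromBlocks A 0 C D)) :
    Mem I (Matrix.fromBlocks A 0 C' D) := by
  classical
  have := hI.mem_add_rows (X := Matrix.fromBlocks 0 0 (C' - C) 0) (α := Sum.elim α γ)
    (β := Sum.elim β δ) (HomDeg.zero.fromBlocks .zero (hC'.sub hC) .zero)
    (hA.fromBlocks .zero hC hD) (Finset.univ.image Sum.inr) ?_ ?_ h
  · simpa [Matrix.fromBlocks_add] using this
  · rintro (k | k) hk
    · ext (l | l) <;> rfl
    · simp at hk
  · rintro i hi Z hZ hZ1 hZ2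
    obtain ⟨i, -, rfl⟩ := Finset.mem_image.1 hi
    -- The rows of A together with row i of C' - C are supported in the columns κ: this is |κ| + 1
    -- rows in |κ| columns.
    refine hI.mem_hollow h𝒜 hZ (ι₁ := ι ⊕ Unit) (κ₁ := κ) (a := Sum.elim Sum.inl fun _ => Sum.inr i)
      (b := Sum.inl) ?_ Sum.inl_injective (by simp [hcard]) h.card_eq ?_
    · rintro (a | a) (b | b) hab <;> simp_all
    · rintro (a | a) (j | j) hj
      · simp at hj
      · rw [Sum.elim_inl, hZ1 _ (by simp)]; rfl
      · simp at hj
      · rw [Sum.elim_inr, hZ2]; rfl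

theorem IsPreideal.mem_fromBlocks_of_left (hI : IsPreideal 𝒜 I) (h𝒜 : IsGradedMul 𝒜)
    {A : Matrix ι κ R} {C : Matrix μ κ R} {D : Matrix μ ν R} (hA : HomDeg 𝒜 α β A)
    (hC : HomDeg 𝒜 γ β C) (hD : HomDeg 𝒜 γ δ D)
    (hcard : Fintype.card μ = Fintype.card ν) (h : Mem I A) :
    Mem I (Matrix.fromBlocks A 0 C D) :=
  hI.mem_fromBlocks_lower h𝒜 hA .zero hC hD h.card_eq (hI.mem_fromBlocks_diag h hD hcard)

/-- The rows selected by `a` vanish outside the columns selected by `b`, so a reordering makes the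
matrix block lower triangular with the given submatrix as its first diagonal block. -/
theorem IsPreideal.mem_of_submatrix {ι₁ κ₁ : Type*} [Fintype ι₁] [Fintype κ₁]
    (hI : IsPreideal 𝒜 I)
    (h𝒜 : IsGradedMul 𝒜) {A : Matrix ι κ R} (hA : HomDeg 𝒜 α β A) {a : ι₁ → ι} {b : κ₁ → κ}
    (ha : a.Injective) (hb : b.Injective) (h : Mem I (A.submatrix a b))
    (hsq : Fintype.card ι = Fintype.card κ) (h0 : ∀ i j, j ∉ Set.range b → A (a i) j = 0) :
    Mem I A := by
  classical
  let e : ι₁ ⊕ ((Set.range a)ᶜ : Set ι) ≃ ι :=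
    (Equiv.sumCongr (Equiv.ofInjective a ha) (Equiv.refl _)).trans (Equiv.Set.sumCompl _)
  let f : κ₁ ⊕ ((Set.range b)ᶜ : Set κ) ≃ κ :=
    (Equiv.sumCongr (Equiv.ofInjective b hb) (Equiv.refl _)).trans (Equiv.Set.sumCompl _)
  rw [← mem_submatrix_iff e f]
  have hdeg := hA.submatrix e f
  have : A.submatrix e f = Matrix.fromBlocks (A.submatrix a b) 0
      (A.submatrix e f).toBlocks₂₁ (A.submatrix e f).toBlocks₂₂ := by
    conv_lhs => rw [← Matrix.fromBlocks_toBlocks (A.submatrix e f)]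
    congr 1
    ext i j
    exact h0 i _ j.2
  rw [this]
  refine hI.mem_fromBlocks_of_left (α := α ∘ a) (β := β ∘ b)
    (γ := α ∘ e ∘ Sum.inr) (δ := β ∘ f ∘ Sum.inr) h𝒜 ?_ ?_ ?_ ?_ h
  · exact fun i j => hA _ _
  · exact fun i j => hdeg (Sum.inr i) (Sum.inl j)
  · exact fun i j => hdeg _ _
  · have h1 := Fintype.card_congr e
    have h2 := Fintype.card_congr f
    have h3 := h.card_eq
    rw [Fintype.card_sum] at h1 h2
    omega

end MemCalculus

end GrDiv

namespace GrDiv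

/-! ### Elementary row and column operations. -/

section ElementaryOperations

variable {Γ : Type v} [Group Γ] {R : Type u} [Ring R] {𝒜 : Γ → AddSubgroup R}
  {I : Set (SqMat R)} {ι κ μ ν ρ : Type*} {α : ι → Γ} {β : κ → Γ} {γ : μ → Γ} {δ : ν → Γ}
  [Fintype ι] [Fintype κ] [Fintype μ] [Fintype ν]

theorem Fintype.card_ne_lt {ι : Type*} [Fintype ι] [DecidableEq ι] (i : ι) :
    Fintype.card {k // k ≠ i} < Fintype.card ι :=
  Fintype.card_subtype_lt (x := i) (by simp)

/-- A row depending on the others makes the matrix factor through those others, one fewer than its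
size; `hci` keeps row i out of its own expression. -/
theorem IsPreideal.mem_of_row_eq_sum (hI : IsPreideal 𝒜 I) (h𝒜 : IsGradedMul 𝒜)
    {Z : Matrix ι κ R} (hZ : HomDeg 𝒜 α β Z) (hcard : Fintype.card ι = Fintype.card κ) (i : ι)
    (c : ι → R) (hc : ∀ k, c k ∈ 𝒜 (α i * (α k)⁻¹)) (hci : c i = 0)
    (h : ∀ l, Z i l = ∑ k, c k * Z k l) : Mem I Z := by
  classical
  let P : Matrix ι {k // k ≠ i} R :=
    Matrix.of fun a b => if a = i then c b else if b.1 = a then 1 else 0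
  let Q : Matrix {k // k ≠ i} κ R := Z.submatrix Subtype.val id
  have hQ : HomDeg 𝒜 (α ∘ Subtype.val) β Q := hZ.submatrix _ _
  have hP : HomDeg 𝒜 α (α ∘ Subtype.val) P := by
    intro a b
    by_cases hai : a = i
    · subst hai; simpa [P] using hc b
    · by_cases hab : b.1 = a
      · subst hab; simpa [P, hai] using h𝒜.one_mem
      · simp [P, hai, hab]
  have hPQ : Z = P * Q := by
    ext a l
    rw [Matrix.mul_apply]
    by_cases hai : a = i
    · subst hai
      simp only [P, Q, Matrix.of_apply, if_true, Matrix.submatrix_apply, id]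
      rw [h, ← Finset.sum_erase_add _ _ (Finset.mem_univ a), hci, zero_mul, add_zero]
      exact (Finset.sum_subtype _ (by simp) _)
    · rw [Finset.sum_eq_single ⟨a, hai⟩]
      · simp [P, Q, hai]
      · rintro ⟨b, hb⟩ - hne
        have : b ≠ a := fun h => hne (Subtype.ext h)
        simp [P, hai, this]
      · simp
  rw [hPQ]
  exact hI.mem_mul h𝒜 hP hQ (Fintype.card_ne_lt i) hcard

theorem IsPreideal.mem_of_col_eq_sum (hI : IsPreideal 𝒜 I) (h𝒜 : IsGradedMul 𝒜)
    {Z : Matrix ι κ R} (hZ : HomDeg 𝒜 α β Z) (hcard : Fintype.card ι = Fintype.card κ) (j : κ)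
    (c : κ → R) (hc : ∀ k, c k ∈ 𝒜 (β k * (β j)⁻¹)) (hcj : c j = 0)
    (h : ∀ i, Z i j = ∑ k, Z i k * c k) : Mem I Z := by
  classical
  let P : Matrix {k // k ≠ j} κ R :=
    Matrix.of fun b a => if a = j then c b else if b.1 = a then 1 else 0
  let Q : Matrix ι {k // k ≠ j} R := Z.submatrix id Subtype.val
  have hQ : HomDeg 𝒜 α (β ∘ Subtype.val) Q := hZ.submatrix _ _
  have hP : HomDeg 𝒜 (β ∘ Subtype.val) β P := by
    intro b a
    by_cases haj : a = j
    · subst haj; simpa [P] using hc b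
    · by_cases hab : b.1 = a
      · subst hab; simpa [P, haj] using h𝒜.one_mem
      · simp [P, haj, hab]
  have hPQ : Z = Q * P := by
    ext i a
    rw [Matrix.mul_apply]
    by_cases haj : a = j
    · subst haj
      simp only [P, Q, Matrix.of_apply, if_true, Matrix.submatrix_apply, id]
      rw [h, ← Finset.sum_erase_add _ _ (Finset.mem_univ a), hcj, mul_zero, add_zero]
      exact (Finset.sum_subtype _ (by simp) _)
    · rw [Finset.sum_eq_single ⟨a, haj⟩]
      · simp [P, Q, haj]
      · rintro ⟨b, hb⟩ - hne
        have : b ≠ a := fun h => hne (Subtype.ext h)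
        simp [P, haj, this]
      · simp
  rw [hPQ]
  exact hI.mem_mul h𝒜 hQ hP (hcard ▸ Fintype.card_ne_lt j) hcard

/-- The matrix is built up by determinantal sums from the given one and from matrices having a row
of C * A at the bottom. Each of the latter has a row depending on the rows of A, so it is not
gr-full. -/
theorem IsPreideal.mem_fromRows_add (hI : IsPreideal 𝒜 I) (h𝒜 : IsGradedMul 𝒜)
    {A : Matrix ι κ R} {B : Matrix μ κ R} {C : Matrix μ ι R}
    (hA : HomDeg 𝒜 α β A) (hB : HomDeg 𝒜 γ β B) (hC : HomDeg 𝒜 γ α C)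
    (h : Mem I (Matrix.fromRows A B)) : Mem I (Matrix.fromRows A (B + C * A)) := by
  classical
  have hrows : ∀ {B : Matrix μ κ R}, HomDeg 𝒜 γ β B →
      HomDeg 𝒜 (Sum.elim α γ) β (Matrix.fromRows A B) := by
    rintro B hB (i | i) j
    exacts [hA i j, hB i j]
  have := hI.mem_add_rows (X := Matrix.fromRows 0 (C * A)) (α := Sum.elim α γ)
    (β := β) ?_ (hrows hB) (Finset.univ.image Sum.inr) ?_ ?_ h
  · convert this using 1
    ext (i | i) j <;> simp [add_comm]
  · rintro (i | i) j
    exacts [zero_mem _, (hC.mul h𝒜 hA) i j]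
  · rintro (k | k) hk
    · rfl
    · simp at hk
  · rintro i hi Z hZ hZ1 hZ2
    obtain ⟨i, -, rfl⟩ := Finset.mem_image.1 hi
    refine hI.mem_of_row_eq_sum h𝒜 hZ h.card_eq (Sum.inr i) (Sum.elim (C i) fun _ => 0) ?_ rfl ?_
    · rintro (k | k)
      exacts [hC i k, zero_mem _]
    · intro l
      have h1 : ∀ k, Z (Sum.inl k) l = A k l := fun k => congrFun (hZ1 (Sum.inl k) (by simp)) l
      simp [hZ2, h1, Matrix.mul_apply]

theorem IsPreideal.mem_fromCols_add (hI : IsPreideal 𝒜 I) (h𝒜 : IsGradedMul 𝒜)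
    {A : Matrix ι κ R} {B : Matrix ι ν R} {C : Matrix κ ν R}
    (hA : HomDeg 𝒜 α β A) (hB : HomDeg 𝒜 α δ B) (hC : HomDeg 𝒜 β δ C)
    (h : Mem I (Matrix.fromCols A B)) : Mem I (Matrix.fromCols A (B + A * C)) := by
  classical
  have hcols : ∀ {B : Matrix ι ν R}, HomDeg 𝒜 α δ B →
      HomDeg 𝒜 α (Sum.elim β δ) (Matrix.fromCols A B) := by
    rintro B hB i (j | j)
    exacts [hA i j, hB i j]
  have := hI.mem_add_cols (X := Matrix.fromCols 0 (A * C)) (α := α)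
    (β := Sum.elim β δ) ?_ (hcols hB) (Finset.univ.image Sum.inr) ?_ ?_ h
  · convert this using 1
    ext i (j | j) <;> simp [add_comm]
  · rintro i (j | j)
    exacts [zero_mem _, (hA.mul h𝒜 hC) i j]
  · rintro i (k | k) hk
    · rfl
    · simp at hk
  · rintro i hi Z hZ hZ1 hZ2
    obtain ⟨i, -, rfl⟩ := Finset.mem_image.1 hi
    refine hI.mem_of_col_eq_sum h𝒜 hZ h.card_eq (Sum.inr i) (Sum.elim (fun k => C k i) fun _ => 0)
      ?_ rfl ?_
    · rintro (k | k)
      exacts [hC k i, zero_mem _]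
    · intro l
      have h1 : ∀ k, Z l (Sum.inl k) = A l k := fun k => hZ1 l (Sum.inl k) (by simp)
      simp [hZ2, h1, Matrix.mul_apply]

end ElementaryOperations

/-! ### Gr-matrix ideals absorb products. -/

section GrMatrixIdeal

variable {Γ : Type v} [Group Γ] {R : Type u} [Ring R] {𝒜 : Γ → AddSubgroup R}
  {I : Set (SqMat R)} {ι κ μ ν ρ : Type*} {α : ι → Γ} {β : κ → Γ} {γ : μ → Γ} {δ : ν → Γ}

theorem mem_diagSum_of_mem {m n : ℕ} {A : Matrix (Fin m) (Fin m) R}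
    {B : Matrix (Fin n) (Fin n) R} (h : diagSum ⟨m, A⟩ ⟨n, B⟩ ∈ I) :
    Mem I (Matrix.fromBlocks A 0 0 B) := by
  refine ⟨_, finSumFinEquiv.symm, finSumFinEquiv.symm, ?_⟩
  exact h

theorem IsPreideal.mem_diagSum_iff (hI : IsPreideal 𝒜 I) {A B : SqMat R} :
    diagSum A B ∈ I ↔ Mem I (Matrix.fromBlocks A.2 0 0 B.2) :=
  ⟨mem_diagSum_of_mem, fun h => hI.mem_of_equiv h finSumFinEquiv.symm finSumFinEquiv.symm⟩

variable [Fintype ι] [Fintype κ] [Fintype μ] [Fintype ν]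

/-- Cancellation of (1) is repeated once per diagonal entry of the identity block. The row index
type must be nonempty because the empty matrix is not in 𝔐(R). -/
theorem IsGrMatrixIdeal.mem_of_fromBlocks_one [Fintype ρ] [DecidableEq ρ]
    (hI : IsGrMatrixIdeal 𝒜 I) (h𝒜 : IsGradedMul 𝒜)
    [Nonempty ι] {A : Matrix ι κ R} (hA : HomDeg 𝒜 α β A)
    (hcard : Fintype.card ι = Fintype.card κ)
    (h : Mem I (Matrix.fromBlocks A 0 0 (1 : Matrix ρ ρ R))) : Mem I A := by
  let e := (Fintype.equivFin ι).symm
  let e' := (Fintype.equivFinOfCardEq hcard.symm).symm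
  rw [← mem_submatrix_iff e e', hI.isPreideal.mem_iff]
  have hdeg := hA.submatrix e e'
  have hpos : 1 ≤ Fintype.card ι := Fintype.card_pos
  have key : ∀ k : ℕ, Mem I (Matrix.fromBlocks (A.submatrix e e') 0 0
      (1 : Matrix (Fin k) (Fin k) R)) → (⟨_, A.submatrix e e'⟩ : SqMat R) ∈ I := by
    intro k
    induction k with
    | zero =>
      intro hk
      rw [← hI.isPreideal.mem_iff]
      have := hk.submatrix (Equiv.sumEmpty _ (Fin 0)).symm (Equiv.sumEmpty _ (Fin 0)).symm
      convert this using 1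
      ext i j
      simp
    | succ k ih =>
      intro hk
      refine ih ?_
      let f : Fin (Fintype.card ι + k) ≃ Fin (Fintype.card ι) ⊕ Fin k := finSumFinEquiv.symm
      let B := (Matrix.fromBlocks (A.submatrix e e') 0 0
        (1 : Matrix (Fin k) (Fin k) R)).submatrix f f
      rw [← mem_submatrix_iff f f, hI.isPreideal.mem_iff]
      refine hI.of_diagSum_one ⟨?_, (Sum.elim (α ∘ e) (fun _ => 1)) ∘ f,
        (Sum.elim (β ∘ e') (fun _ => 1)) ∘ f, ?_⟩ ?_
      · change 1 ≤ Fintype.card ι + k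
        omega
      · refine HomDeg.submatrix (hdeg.fromBlocks .zero .zero (.one h𝒜)) _ _
      · rw [hI.isPreideal.mem_diagSum_iff]
        let g : Fin (Fintype.card ι + k) ⊕ Fin 1 ≃ Fin (Fintype.card ι) ⊕ Fin (k + 1) :=
          (Equiv.sumCongr f (Equiv.refl _)).trans <| (Equiv.sumAssoc _ _ _).trans <|
            Equiv.sumCongr (Equiv.refl _) finSumFinEquiv
        convert hk.submatrix g g using 1
        ext i j
        rcases i with i | i
        · obtain ⟨i, rfl⟩ := f.symm.surjective i
          rcases j with j | j
          · obtain ⟨j, rfl⟩ := f.symm.surjective j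
            rcases i with i | i <;> rcases j with j | j <;> simp [g, Matrix.one_apply]
          · rcases i with i | i <;> simp [g, Matrix.one_apply]
            simp [Fin.ext_iff]
            omega
        · rcases j with j | j
          · obtain ⟨j, rfl⟩ := f.symm.surjective j
            rcases j with j | j <;> simp [g, Matrix.one_apply]
            simp [Fin.ext_iff]
            omega
          · simp [g, Matrix.one_apply]
  refine key (Fintype.card ρ) ?_
  let f := (Fintype.equivFin ρ).symm
  convert h.submatrix (Equiv.sumCongr e f) (Equiv.sumCongr e' f) using 1
  ext (i | i) (j | j) <;> simp [Matrix.one_apply]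

/-- Start from [[A, 0], [1, -B]], which is in I because A is. A column operation gives [[A, AB], [1,
0]]; exchanging the rows and subtracting A times the row (1, 0) leaves 1 ⊕ AB, and the identity
summand cancels. -/
theorem IsGrMatrixIdeal.mem_mul_right (hI : IsGrMatrixIdeal 𝒜 I) (h𝒜 : IsGradedMul 𝒜)
    {A : Matrix ι κ R} {B : Matrix κ μ R} (hA : HomDeg 𝒜 α β A) (hB : HomDeg 𝒜 β γ B)
    (hcard : Fintype.card κ = Fintype.card μ) (h : Mem I A) : Mem I (A * B) := by
  classical
  have hI' := hI.isPreideal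
  have : Nonempty ι := by
    obtain ⟨n, e, e', hn⟩ := h
    exact ⟨e ⟨0, (hI.subset_homMatrices hn).1⟩⟩
  have h1 : Mem I (Matrix.fromBlocks A 0 (1 : Matrix κ κ R) (-B)) :=
    hI'.mem_fromBlocks_of_left h𝒜 hA (.one h𝒜) hB.neg hcard h
  rw [← Matrix.fromCols_fromRows_eq_fromBlocks] at h1
  have h2 := hI'.mem_fromCols_add h𝒜 (α := Sum.elim α β) (β := β) (δ := γ) (C := B)
    (by rintro (i | i) j; exacts [hA i j, HomDeg.one h𝒜 i j])
    (by rintro (i | i) j; exacts [HomDeg.zero i j, hB.neg i j]) hB h1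
  have h3 : Mem I (Matrix.fromRows (Matrix.fromCols (1 : Matrix κ κ R) 0)
      (Matrix.fromCols A (A * B))) := by
    convert h2.submatrix (Equiv.sumComm _ _) (Equiv.refl _) using 1
    ext (i | i) (j | j) <;> simp [Matrix.fromRows_mul]
  have h4 := hI'.mem_fromRows_add h𝒜 (α := β) (β := Sum.elim β γ) (γ := α) (C := -A)
    (by rintro i (j | j); exacts [HomDeg.one h𝒜 i j, HomDeg.zero i j])
    (by rintro i (j | j); exacts [hA i j, hA.mul h𝒜 hB i j]) hA.neg h3
  refine hI.mem_of_fromBlocks_one (ρ := κ) h𝒜 (hA.mul h𝒜 hB) (h.card_eq.trans hcard) ?_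
  convert h4.submatrix (Equiv.sumComm _ _) (Equiv.sumComm _ _) using 1
  ext (i | i) (j | j) <;> simp [Matrix.mul_fromCols]

/-- Start from [[-B, 0], [1, A]] and exchange the rows. The row operation by B gives [[1, A], [0,
BA]], the column operation by -A gives 1 ⊕ BA, and the identity summand cancels. -/
theorem IsGrMatrixIdeal.mem_mul_left (hI : IsGrMatrixIdeal 𝒜 I) (h𝒜 : IsGradedMul 𝒜)
    {A : Matrix ι κ R} {B : Matrix μ ι R} (hA : HomDeg 𝒜 α β A) (hB : HomDeg 𝒜 γ α B)
    (hcard : Fintype.card μ = Fintype.card ι) (h : Mem I A) : Mem I (B * A) := by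
  classical
  have hI' := hI.isPreideal
  have : Nonempty μ := by
    rw [← Fintype.card_pos_iff, hcard, Fintype.card_pos_iff]
    obtain ⟨n, e, e', hn⟩ := h
    exact ⟨e ⟨0, (hI.subset_homMatrices hn).1⟩⟩
  have h1 : Mem I (Matrix.fromBlocks (-B) 0 (1 : Matrix ι ι R) A) := by
    have := hI'.mem_fromBlocks_diag h hB.neg hcard
    have := this.submatrix (Equiv.sumComm _ _) (Equiv.sumComm _ _)
    simp only [Equiv.sumComm_apply, Matrix.fromBlocks_submatrix_sum_swap_sum_swap] at this
    exact hI'.mem_fromBlocks_lower h𝒜 hB.neg .zero (.one h𝒜) hA hcard this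
  have h1' : Mem I (Matrix.fromRows (Matrix.fromCols (1 : Matrix ι ι R) A)
      (Matrix.fromCols (-B) (0 : Matrix μ κ R))) := by
    convert h1.submatrix (Equiv.sumComm _ _) (Equiv.refl _) using 1
    ext (i | i) (j | j) <;> simp
  have h2 := hI'.mem_fromRows_add h𝒜 (α := α) (β := Sum.elim α β) (γ := γ) (C := B)
    (by rintro i (j | j); exacts [HomDeg.one h𝒜 i j, hA i j])
    (by rintro i (j | j); exacts [hB.neg i j, HomDeg.zero i j]) hB h1'
  have h3 : Mem I (Matrix.fromCols (Matrix.fromRows (1 : Matrix ι ι R) (0 : Matrix μ ι R))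
      (Matrix.fromRows A (B * A))) := by
    convert h2 using 1
    ext (i | i) (j | j) <;> simp [Matrix.mul_fromCols]
  have h4 := hI'.mem_fromCols_add h𝒜 (α := Sum.elim α γ) (β := α) (δ := β) (C := -A)
    (by rintro (i | i) j; exacts [HomDeg.one h𝒜 i j, HomDeg.zero i j])
    (by rintro (i | i) j; exacts [hA i j, hB.mul h𝒜 hA i j]) hA.neg h3
  refine hI.mem_of_fromBlocks_one (ρ := ι) h𝒜 (hB.mul h𝒜 hA) (hcard.trans h.card_eq) ?_
  convert h4.submatrix (Equiv.sumComm _ _) (Equiv.sumComm _ _) using 1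
  ext (i | i) (j | j) <;> simp [Matrix.fromRows_mul]

end GrMatrixIdeal

end GrDiv

namespace GrDiv

/-! ### Determinantal sums of matrices that are not gr-full. -/

section DetSums

variable {Γ : Type v} [Group Γ] {R : Type u} [Ring R] {𝒜 : Γ → AddSubgroup R}

theorem IsNabla.homDeg {n : ℕ} {A B C : Matrix (Fin n) (Fin n) R} (h : IsNabla 𝒜 A B C)
    {α β : Fin n → Γ} (hA : HomDeg 𝒜 α β A) (hB : HomDeg 𝒜 α β B) : HomDeg 𝒜 α β C := by
  rcases h.2 with ⟨i, -, rfl⟩ | ⟨i, -, rfl⟩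
  · intro k j
    by_cases hj : j = i
    · subst hj; simpa using add_mem (hA k j) (hB k j)
    · simpa [Matrix.updateCol_ne hj] using hA k j
  · intro j k
    by_cases hj : j = i
    · subst hj; simpa using add_mem (hA j k) (hB j k)
    · simpa [Matrix.updateRow_ne hj] using hA j k

theorem IsNabla.submatrix {m n : ℕ} {A B C : Matrix (Fin n) (Fin n) R} (h : IsNabla 𝒜 A B C)
    (e e' : Fin m ≃ Fin n) :
    IsNabla 𝒜 (A.submatrix e e') (B.submatrix e e') (C.submatrix e e') := by
  obtain ⟨⟨α, β, hA, hB⟩, h⟩ := h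
  refine ⟨⟨α ∘ e, β ∘ e', fun i j => hA _ _, fun i j => hB _ _⟩, ?_⟩
  rcases h with ⟨i, h1, rfl⟩ | ⟨i, h1, rfl⟩
  · refine Or.inl ⟨e'.symm i, fun k j hj => h1 _ _ fun h => hj (by simp [← h]), ?_⟩
    ext k j
    by_cases hj : j = e'.symm i
    · subst hj; simp
    · have : e' j ≠ i := fun h => hj (by simp [← h])
      simp [Matrix.updateCol_ne, hj, this]
  · refine Or.inr ⟨e.symm i, fun j k hj => h1 _ _ fun h => hj (by simp [← h]), ?_⟩
    ext j k
    by_cases hj : j = e.symm i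
    · subst hj; simp
    · have : e j ≠ i := fun h => hj (by simp [← h])
      simp [Matrix.updateRow_ne, hj, this]

theorem HomDeg.diagSum {A B : SqMat R} {α β : Fin A.1 → Γ} {γ δ : Fin B.1 → Γ}
    (hA : HomDeg 𝒜 α β A.2) (hB : HomDeg 𝒜 γ δ B.2) :
    HomDeg 𝒜 (Sum.elim α γ ∘ finSumFinEquiv.symm) (Sum.elim β δ ∘ finSumFinEquiv.symm)
      (diagSum A B).2 :=
  (hA.fromBlocks .zero .zero hB).submatrix finSumFinEquiv.symm finSumFinEquiv.symm

theorem homMatrices.diagSum {A B : SqMat R} (hA : A ∈ homMatrices 𝒜) (hB : B ∈ homMatrices 𝒜) :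
    diagSum A B ∈ homMatrices 𝒜 := by
  obtain ⟨hn, α, β, hA⟩ := hA
  obtain ⟨-, γ, δ, hB⟩ := hB
  refine ⟨?_, _, _, HomDeg.diagSum hA hB⟩
  change 1 ≤ A.1 + B.1
  omega

theorem IsNabla.fromBlocks {m n : ℕ} {A B C : Matrix (Fin n) (Fin n) R} (h : IsNabla 𝒜 A B C)
    {D : Matrix (Fin m) (Fin m) R} {γ δ : Fin m → Γ} (hD : HomDeg 𝒜 γ δ D)
    (e : Fin (n + m) ≃ Fin n ⊕ Fin m) :
    IsNabla 𝒜 ((Matrix.fromBlocks A 0 0 D).submatrix e e)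
      ((Matrix.fromBlocks B 0 0 D).submatrix e e) ((Matrix.fromBlocks C 0 0 D).submatrix e e) := by
  obtain ⟨⟨α, β, hA, hB⟩, h⟩ := h
  refine ⟨⟨Sum.elim α γ ∘ e, Sum.elim β δ ∘ e, (HomDeg.fromBlocks hA .zero .zero hD).submatrix e e,
    (HomDeg.fromBlocks hB .zero .zero hD).submatrix e e⟩, ?_⟩
  rcases h with ⟨i, h1, rfl⟩ | ⟨i, h1, rfl⟩
  · refine Or.inl ⟨e.symm (Sum.inl i), ?_, ?_⟩
    · intro k j hj
      obtain ⟨k, rfl⟩ := e.symm.surjective k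
      obtain ⟨j, rfl⟩ := e.symm.surjective j
      rcases k with k | k <;> rcases j with j | j <;> simp
      exact h1 k j fun h => hj (by rw [h])
    · ext k j
      obtain ⟨k, rfl⟩ := e.symm.surjective k
      obtain ⟨j, rfl⟩ := e.symm.surjective j
      by_cases hj : j = Sum.inl i
      · subst hj
        rw [Matrix.updateCol_self]
        rcases k with k | k <;> simp
      · rw [Matrix.updateCol_ne (fun h => hj (e.symm.injective h))]
        rcases k with k | k <;> rcases j with j | j <;> simp
        rw [Matrix.updateCol_ne (fun h => hj (by rw [h]))]
  · refine Or.inr ⟨e.symm (Sum.inl i), ?_, ?_⟩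
    · intro j k hj
      obtain ⟨k, rfl⟩ := e.symm.surjective k
      obtain ⟨j, rfl⟩ := e.symm.surjective j
      rcases j with j | j <;> rcases k with k | k <;> simp
      exact h1 j k fun h => hj (by rw [h])
    · ext j k
      obtain ⟨k, rfl⟩ := e.symm.surjective k
      obtain ⟨j, rfl⟩ := e.symm.surjective j
      by_cases hj : j = Sum.inl i
      · subst hj
        rw [Matrix.updateRow_self]
        rcases k with k | k <;> simp
      · rw [Matrix.updateRow_ne (fun h => hj (e.symm.injective h))]
        rcases j with j | j <;> rcases k with k | k <;> simp
        rw [Matrix.updateRow_ne (fun h => hj (by rw [h]))]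

theorem IsNabla.diagSum {n : ℕ} {A B C : Matrix (Fin n) (Fin n) R} (h : IsNabla 𝒜 A B C)
    {D : SqMat R} {γ δ : Fin D.1 → Γ} (hD : HomDeg 𝒜 γ δ D.2) :
    IsNabla 𝒜 (diagSum ⟨n, A⟩ D).2 (diagSum ⟨n, B⟩ D).2 (diagSum ⟨n, C⟩ D).2 :=
  h.fromBlocks hD finSumFinEquiv.symm

theorem NotGrFull.submatrix {n : ℕ} {A : Matrix (Fin n) (Fin n) R} (h : NotGrFull 𝒜 A)
    (e e' : Fin n → Fin n) : NotGrFull 𝒜 (A.submatrix e e') := by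
  obtain ⟨r, α, β, ε, P, Q, hr, hP, hQ, rfl⟩ := h
  exact notGrFull_of_submatrix hP hQ (by simpa using hr) e e'

/-- If A = PQ then A ⊕ B = (P ⊕ B)(Q ⊕ 1), and the inner size is still too small. -/
theorem NotGrFull.diagSum (h𝒜 : IsGradedMul 𝒜) {A B : SqMat R} (h : NotGrFull 𝒜 A.2)
    {γ δ : Fin B.1 → Γ} (hB : HomDeg 𝒜 γ δ B.2) : NotGrFull 𝒜 (diagSum A B).2 := by
  obtain ⟨r, α, β, ε, P, Q, hr, hP, hQ, h⟩ := h
  have := notGrFull_of_submatrix (n := A.1 + B.1)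
    (HomDeg.fromBlocks (𝒜 := 𝒜) (α := α) (β := ε) (γ := γ) (δ := δ) hP .zero .zero hB)
    (HomDeg.fromBlocks (𝒜 := 𝒜) (α := ε) (β := β) (γ := δ) (δ := δ) hQ .zero .zero (.one h𝒜))
    (by simpa using hr) finSumFinEquiv.symm finSumFinEquiv.symm
  rw [Matrix.fromBlocks_multiply, ← h] at this
  simp only [Matrix.zero_mul, Matrix.mul_zero, add_zero, zero_add, Matrix.mul_one] at this
  exact this

theorem IsDetSum.mem_homMatrices {𝒲 : Set (SqMat R)} (h𝒲 : 𝒲 ⊆ homMatrices 𝒜) {M : SqMat R}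
    (h : IsDetSum 𝒜 𝒲 M) : M ∈ homMatrices 𝒜 := by
  induction h with
  | of hM => exact h𝒲 hM
  | @nabla n A B C hA hB hC ihA ihB =>
    obtain ⟨⟨α, β, hA, hB⟩, h⟩ := id hC
    exact ⟨ihA.1, α, β, hC.homDeg hA hB⟩

/-- Diagonal sums with a fixed matrix and permutations of rows and columns commute with ∇ and
preserve 𝒩, so both closure properties follow by induction on the determinantal sum. -/
theorem isPreideal_isDetSum (h𝒜 : IsGradedMul 𝒜) :
    IsPreideal 𝒜 {M | IsDetSum 𝒜 (nonGrFull 𝒜) M} where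
  subset_homMatrices M hM := IsDetSum.mem_homMatrices (fun _ h => h.1) hM
  nonGrFull_subset M hM := .of hM
  nabla_mem hA hB hC := .nabla hA hB hC
  diagSum_mem {A B} hA hB := by
    obtain ⟨hn, γ, δ, hB'⟩ := id hB
    induction hA with
    | of hM => exact .of ⟨homMatrices.diagSum hM.1 hB, hM.2.diagSum h𝒜 hB'⟩
    | nabla _ _ hC ihA ihB => exact .nabla ihA ihB (hC.diagSum hB')
  perm_mem {n A} σ τ hA := by
    have key : ∀ M : SqMat R, IsDetSum 𝒜 (nonGrFull 𝒜) M → ∀ σ τ : Equiv.Perm (Fin M.1),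
        IsDetSum 𝒜 (nonGrFull 𝒜) ⟨M.1, M.2.submatrix σ τ⟩ := by
      intro M hM
      induction hM with
      | of hM =>
        intro σ τ
        obtain ⟨⟨h1, α, β, h2⟩, h3⟩ := hM
        exact .of ⟨⟨h1, α ∘ σ, β ∘ τ, fun i j => h2 _ _⟩, h3.submatrix _ _⟩
      | nabla _ _ hC ihA ihB => exact fun σ τ => .nabla (ihA σ τ) (ihB σ τ) (hC.submatrix σ τ)
    rw [permMatrix_mul_mul_permMatrix]
    exact key _ hA σ τ.symm

/-- This makes 𝒟(𝒩) redundant in the definition of 𝒜(𝒩). -/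
theorem permDiagSums_nonGrFull_subset (h𝒜 : IsGradedMul 𝒜) :
    permDiagSums 𝒜 (nonGrFull 𝒜) ⊆ nonGrFull 𝒜 := by
  rintro _ ⟨hM, X, hX, A, hA, σ, τ, rfl⟩
  refine ⟨hM, ?_⟩
  have : ∃ γ δ : Fin A.1 → Γ, HomDeg 𝒜 γ δ A.2 := by
    rcases hA with ⟨-, γ, δ, h⟩ | h
    · exact ⟨γ, δ, h⟩
    -- The empty matrix has no entries to constrain, so any degrees serve.
    · exact ⟨fun _ => 1, fun _ => 1, fun i => (Fin.cast h i).elim0⟩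
  obtain ⟨γ, δ, h⟩ := this
  change NotGrFull 𝒜 (σ.permMatrix R * (diagSum X A).2 * τ.permMatrix R)
  rw [permMatrix_mul_mul_permMatrix]
  exact (hX.2.diagSum h𝒜 h).submatrix _ _

theorem preidealGen_nonGrFull (h𝒜 : IsGradedMul 𝒜) :
    preidealGen 𝒜 (nonGrFull 𝒜) = {M | IsDetSum 𝒜 (nonGrFull 𝒜) M} := by
  ext M
  simp only [preidealGen, Set.union_eq_left.2 (permDiagSums_nonGrFull_subset h𝒜),
    Set.mem_ofPred_eq, and_iff_right_iff_imp]
  exact IsDetSum.mem_homMatrices fun _ h => h.1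

end DetSums

/-! ### Dividing a preideal by identity summands. -/

section Quotient

variable {Γ : Type v} [Group Γ] {R : Type u} [Ring R] {𝒜 : Γ → AddSubgroup R}
  {I : Set (SqMat R)}

theorem mem_fromBlocks_diagSum_iff {μ ν : Type*} {A B : SqMat R} {D : Matrix μ ν R} :
    Mem I (Matrix.fromBlocks (diagSum A B).2 0 0 D) ↔
      Mem I (Matrix.fromBlocks (Matrix.fromBlocks A.2 0 0 B.2) 0 0 D) := by
  have key : ∀ {ι κ : Type} (e : ι ≃ κ) (X : Matrix ι ι R),
      Mem I (Matrix.fromBlocks (X.submatrix e.symm e.symm) 0 0 D) ↔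
        Mem I (Matrix.fromBlocks X 0 0 D) := by
    intro ι κ e X
    rw [← mem_submatrix_iff (Equiv.sumCongr e (Equiv.refl μ)) (Equiv.sumCongr e (Equiv.refl ν))]
    convert Iff.rfl using 2
    ext (i | i) (j | j) <;> simp
  exact key finSumFinEquiv (Matrix.fromBlocks A.2 0 0 B.2)

theorem mem_blockDiagonal_diagSum_iff {o : Type*} [DecidableEq o] {A B : SqMat R} :
    Mem I (Matrix.blockDiagonal fun _ : o => (diagSum A B).2) ↔
      Mem I (Matrix.blockDiagonal fun _ : o => Matrix.fromBlocks A.2 0 0 B.2) := by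
  have key : ∀ {ι κ : Type} (e : ι ≃ κ) (X : Matrix ι ι R),
      Mem I (Matrix.blockDiagonal fun _ : o => X.submatrix e.symm e.symm) ↔
        Mem I (Matrix.blockDiagonal fun _ : o => X) := by
    intro ι κ e X
    rw [← mem_submatrix_iff (Equiv.prodCongr e (Equiv.refl o)) (Equiv.prodCongr e (Equiv.refl o))]
    convert Iff.rfl using 2
    ext ⟨i, t⟩ ⟨j, s⟩
    simp [Matrix.blockDiagonal_apply]
  exact key finSumFinEquiv (Matrix.fromBlocks A.2 0 0 B.2)

/-- Identity summands can be enlarged, so two elements of the quotient acquire a common padding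
before a determinantal sum is formed. -/
theorem IsPreideal.diagSum_one_mono (hI : IsPreideal 𝒜 I) (h𝒜 : IsGradedMul 𝒜) {M : SqMat R}
    (hM : M ∈ homMatrices 𝒜) {n k : ℕ} (hnk : n ≤ k) (h : diagSum M ⟨n, 1⟩ ∈ I) :
    diagSum M ⟨k, 1⟩ ∈ I := by
  obtain ⟨-, α, β, hdeg⟩ := hM
  rw [hI.mem_diagSum_iff] at h ⊢
  refine hI.mem_of_submatrix h𝒜 (HomDeg.fromBlocks hdeg .zero .zero (.one (α := fun _ => 1) h𝒜))
    (a := Sum.map id (Fin.castLE hnk)) (b := Sum.map id (Fin.castLE hnk))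
    (Function.injective_id.sumMap (Fin.castLE_injective hnk))
    (Function.injective_id.sumMap (Fin.castLE_injective hnk)) ?_ rfl ?_
  · convert h using 1
    ext (i | i) (j | j) <;> simp [Matrix.one_apply]
  · rintro (i | i) (j | j) hj
    · exact absurd ⟨Sum.inl j, rfl⟩ hj
    · rfl
    · rfl
    · refine Matrix.one_apply_ne ?_
      rintro rfl
      exact hj ⟨Sum.inr i, rfl⟩

/-- Dividing by the identities forces cancellation: a summand (1) is absorbed into the identity
padding. -/
theorem IsPreideal.isGrMatrixIdeal_quotientBy (hI : IsPreideal 𝒜 I) (h𝒜 : IsGradedMul 𝒜) :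
    IsGrMatrixIdeal 𝒜 (quotientBy 𝒜 I (identityMatrices R)) where
  subset_homMatrices M hM := hM.1
  nonGrFull_subset M hM := by
    refine ⟨hM.1, ⟨1, 1⟩, ⟨1, le_rfl, rfl⟩, hI.diagSum_mem (hI.nonGrFull_subset hM) ?_⟩
    exact ⟨le_rfl, fun _ => 1, fun _ => 1, HomDeg.one h𝒜⟩
  nabla_mem {n A B C} hA hB hC := by
    obtain ⟨hA, _, ⟨k, hk, rfl⟩, hkA⟩ := hA
    obtain ⟨hB, _, ⟨l, hl, rfl⟩, hlB⟩ := hB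
    refine ⟨?_, ⟨k + l, 1⟩, ⟨k + l, by omega, rfl⟩, ?_⟩
    · exact IsDetSum.mem_homMatrices (𝒲 := homMatrices 𝒜) subset_rfl (.nabla (.of hA) (.of hB) hC)
    · exact hI.nabla_mem (hI.diagSum_one_mono h𝒜 hA (by omega) hkA)
        (hI.diagSum_one_mono h𝒜 hB (by omega) hlB)
        (hC.diagSum (D := ⟨k + l, 1⟩) (HomDeg.one (α := fun _ => 1) h𝒜))
  diagSum_mem {A B} hA hB := by
    obtain ⟨hA, _, ⟨k, hk, rfl⟩, hkA⟩ := hA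
    refine ⟨homMatrices.diagSum hA hB, ⟨k, 1⟩, ⟨k, hk, rfl⟩, ?_⟩
    obtain ⟨-, α, β, hA⟩ := hA
    obtain ⟨-, γ, δ, hB⟩ := hB
    rw [hI.mem_diagSum_iff] at hkA
    rw [hI.mem_diagSum_iff, mem_fromBlocks_diagSum_iff]
    have hinj : (Sum.map Sum.inl id : Fin A.1 ⊕ Fin k → (Fin A.1 ⊕ Fin B.1) ⊕ Fin k).Injective :=
      Sum.inl_injective.sumMap Function.injective_id
    refine hI.mem_of_submatrix h𝒜
      ((HomDeg.fromBlocks hA .zero .zero hB).fromBlocks .zero .zero (.one (α := fun _ => 1) h𝒜))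
      hinj hinj ?_ rfl ?_
    · convert hkA using 1
      ext (i | i) (j | j) <;> simp
    · rintro (i | i) ((j | j) | j) hj
      · exact absurd ⟨Sum.inl j, rfl⟩ hj
      · rfl
      · rfl
      · rfl
      · rfl
      · exact absurd ⟨Sum.inr j, rfl⟩ hj
  perm_mem {n A} σ τ hA := by
    obtain ⟨⟨hn, α, β, hA⟩, _, ⟨k, hk, rfl⟩, hkA⟩ := hA
    rw [permMatrix_mul_mul_permMatrix]
    refine ⟨⟨hn, α ∘ σ, β ∘ τ.symm, HomDeg.submatrix hA _ _⟩, ⟨k, 1⟩, ⟨k, hk, rfl⟩, ?_⟩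
    rw [hI.mem_diagSum_iff] at hkA ⊢
    convert hkA.submatrix (Equiv.sumCongr σ (Equiv.refl _)) (Equiv.sumCongr τ.symm (Equiv.refl _))
      using 1
    ext (i | i) (j | j) <;> simp
  of_diagSum_one {A} hA hA1 := by
    obtain ⟨-, _, ⟨k, hk, rfl⟩, hkA⟩ := hA1
    refine ⟨hA, ⟨1 + k, 1⟩, ⟨1 + k, by omega, rfl⟩, ?_⟩
    rw [hI.mem_diagSum_iff, mem_fromBlocks_diagSum_iff] at hkA
    rw [hI.mem_diagSum_iff]
    let e : Fin A.1 ⊕ Fin (1 + k) ≃ (Fin A.1 ⊕ Fin 1) ⊕ Fin k :=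
      (Equiv.sumCongr (Equiv.refl _) finSumFinEquiv.symm).trans (Equiv.sumAssoc _ _ _).symm
    convert hkA.submatrix e e using 1
    ext i j
    obtain ⟨i, rfl⟩ := e.symm.surjective i
    obtain ⟨j, rfl⟩ := e.symm.surjective j
    rcases i with (i | i) | i <;> rcases j with (j | j) | j <;> simp [e, Matrix.one_apply]
    all_goals simp [Fin.ext_iff]
    all_goals omega

end Quotient

/-! ### The radical, and properness of the nilradical. -/

section Radical

variable {Γ : Type v} [Group Γ] {R : Type u} [Ring R] {𝒜 : Γ → AddSubgroup R}
  {I : Set (SqMat R)}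

/-- The block diagonal form lets the copies be selected by index maps; `diagPow M r` has r + 1
copies, hence `Fin (r + 1)`. -/
theorem exists_diagPow_eq_submatrix (M : SqMat R) (r : ℕ) :
    ∃ e : Fin (diagPow M r).1 ≃ Fin M.1 × Fin (r + 1),
      (diagPow M r).2 = (Matrix.blockDiagonal fun _ : Fin (r + 1) => M.2).submatrix e e := by
  induction r with
  | zero =>
    refine ⟨⟨fun i => (i, 0), Prod.fst, fun _ => rfl,
      fun x => Prod.ext rfl (Fin.ext (by simp))⟩, ?_⟩
    ext i j
    exact (Matrix.blockDiagonal_apply_eq (fun _ : Fin (0 + 1) => M.2) i j 0).symm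
  | succ r ih =>
    obtain ⟨e, he⟩ := ih
    have key : ∀ {ι κ : Type} (e : ι ≃ κ × Fin (r + 1)) (B : Matrix κ κ R),
        ∃ f : ι ⊕ κ ≃ κ × Fin (r + 1 + 1),
          Matrix.fromBlocks ((Matrix.blockDiagonal fun _ => B).submatrix e e) 0 0 B =
            (Matrix.blockDiagonal fun _ => B).submatrix f f := by
      intro ι κ e B
      let f : ι ⊕ κ ≃ κ × Fin (r + 1 + 1) :=
        (Equiv.sumCongr e (Equiv.prodUnique _ (Fin 1)).symm).trans <|
          (Equiv.prodSumDistrib _ _ _).symm.trans <| Equiv.prodCongr (Equiv.refl _) finSumFinEquiv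
      have hf1 : ∀ i, f (Sum.inl i) = ((e i).1, Fin.castAdd 1 (e i).2) := fun i => rfl
      have hf2 : ∀ i, f (Sum.inr i) = (i, Fin.natAdd (r + 1) 0) := fun i => rfl
      have hne : ∀ (x : Fin (r + 1)), Fin.castAdd 1 x ≠ Fin.natAdd (r + 1) 0 := fun x h => by
        have := congrArg Fin.val h
        simp at this
        omega
      refine ⟨f, ?_⟩
      ext (i | i) (j | j) <;>
        simp only [hf1, hf2, Matrix.blockDiagonal_apply, Matrix.fromBlocks_apply₁₁,
          Matrix.fromBlocks_apply₁₂, Matrix.fromBlocks_apply₂₁, Matrix.fromBlocks_apply₂₂,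
          Matrix.submatrix_apply, Matrix.zero_apply, if_neg (hne _), if_neg (hne _).symm, if_true,
          (Fin.castAdd_injective _ 1).eq_iff]
    obtain ⟨f, hf⟩ := key e M.2
    refine ⟨finSumFinEquiv.symm.trans f, ?_⟩
    change (Matrix.fromBlocks (diagPow M r).2 0 0 M.2).submatrix finSumFinEquiv.symm
      finSumFinEquiv.symm = _
    rw [he, hf]
    rfl

theorem IsPreideal.diagPow_mem_iff (hI : IsPreideal 𝒜 I) {M : SqMat R} {r : ℕ} :
    diagPow M r ∈ I ↔ Mem I (Matrix.blockDiagonal fun _ : Fin (r + 1) => M.2) := by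
  obtain ⟨e, he⟩ := exists_diagPow_eq_submatrix M r
  rw [← mem_submatrix_iff e e, ← he, hI.mem_iff]

theorem HomDeg.blockDiagonal {ι κ o : Type*} [DecidableEq o] {α : ι → Γ} {β : κ → Γ}
    {A : o → Matrix ι κ R} (hA : ∀ t, HomDeg 𝒜 α β (A t)) :
    HomDeg 𝒜 (α ∘ Prod.fst) (β ∘ Prod.fst) (Matrix.blockDiagonal A) := fun i j => by
  rw [Matrix.blockDiagonal_apply]
  split_ifs
  · exact hA _ _ _
  · exact zero_mem _

/-- Membership is inherited from any subfamily of the diagonal blocks, the remaining square blocks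
being extra diagonal summands. -/
theorem IsPreideal.mem_blockDiagonal_of_injective {ι κ o o' : Type*} [DecidableEq o]
    [DecidableEq o'] [Fintype ι] [Fintype κ] [Fintype o] [Fintype o'] (hI : IsPreideal 𝒜 I)
    (h𝒜 : IsGradedMul 𝒜) {α : ι → Γ} {β : κ → Γ} {A : o → Matrix ι κ R}
    (hA : ∀ t, HomDeg 𝒜 α β (A t)) {f : o' → o} (hf : f.Injective)
    (hcard : Fintype.card ι = Fintype.card κ)
    (h : Mem I (Matrix.blockDiagonal (A ∘ f))) : Mem I (Matrix.blockDiagonal A) := by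
  refine hI.mem_of_submatrix h𝒜 (HomDeg.blockDiagonal hA) (a := Prod.map id f)
    (b := Prod.map id f) (Function.injective_id.prodMap hf) (Function.injective_id.prodMap hf)
    ?_ (by simp [hcard]) ?_
  · convert h using 1
    ext ⟨i, t⟩ ⟨j, s⟩
    simp [Matrix.blockDiagonal_apply, hf.eq_iff]
  · rintro ⟨i, t⟩ ⟨j, s⟩ hj
    refine Matrix.blockDiagonal_apply_ne _ _ _ ?_
    rintro rfl
    exact hj ⟨(j, t), rfl⟩

/-- If every block diagonal matrix with all blocks equal to `A` or `B` lies in the ideal, then so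
does the one with all blocks equal to `A ∇ B`. -/
theorem IsPreideal.mem_blockDiagonal_nabla {o : Type*} [DecidableEq o] [Fintype o]
    (hI : IsPreideal 𝒜 I) {n : ℕ} {A B C : Matrix (Fin n) (Fin n) R}
    (hC : IsNabla 𝒜 A B C)
    (h : ∀ c : o → Bool, Mem I (Matrix.blockDiagonal fun t => if c t then A else B)) :
    Mem I (Matrix.blockDiagonal fun _ : o => C) := by
  obtain ⟨⟨α, β, hA, hB⟩, hC'⟩ := id hC
  have hCdeg : HomDeg 𝒜 α β C := hC.homDeg hA hB
  -- The value `none` stands for a block still equal to C, `some true` for A and `some false` for B.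
  -- The induction is on a set of positions containing all unresolved blocks; a ∇ in one block is a
  -- ∇ of the whole matrix.
  let m : Option Bool → Matrix (Fin n) (Fin n) R := fun c => c.elim C fun b => if b then A else B
  have hm : ∀ c, HomDeg 𝒜 α β (m c) := by
    rintro (_ | _ | _)
    exacts [hCdeg, hB, hA]
  have key : ∀ s : Finset o, ∀ c : o → Option Bool, (∀ t ∉ s, c t ≠ none) →
      Mem I (Matrix.blockDiagonal fun t => m (c t)) := by
    intro s
    induction s using Finset.induction_on with
    | empty =>
      intro c hc
      convert h (fun t => (c t).getD true) using 3 with t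
      obtain ⟨b, hb⟩ := Option.ne_none_iff_exists'.1 (hc t (by simp))
      simp [hb, m]
    | insert t s _ ih =>
      intro c hc
      by_cases hct : c t = none
      swap
      · refine ih c fun t' ht' => ?_
        rcases eq_or_ne t' t with rfl | hne
        · exact hct
        · exact hc t' (by simp [hne, ht'])
      have hup : ∀ b : Bool,
          Mem I (Matrix.blockDiagonal fun t' => m (Function.update c t (some b) t')) := by
        refine fun b => ih _ fun t' ht' => ?_
        rcases eq_or_ne t' t with rfl | hne
        · simp
        · rw [Function.update_of_ne hne]
          exact hc t' (by simp [hne, ht'])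
      have hdeg := fun b : Bool => HomDeg.blockDiagonal (𝒜 := 𝒜) (α := α) (β := β)
        (A := fun t' => m (Function.update c t (some b) t')) fun _ => hm _
      rcases hC' with ⟨i, h1, h2⟩ | ⟨i, h1, h2⟩
      · refine hI.mem_add_col (hdeg true) (hdeg false) (i, t) ?_ ?_ ?_ (hup true) (hup false)
        · rintro ⟨k, t'⟩ ⟨l, s'⟩ hne
          simp only [Matrix.blockDiagonal_apply]
          split_ifs with hts
          · subst hts
            rcases eq_or_ne t' t with rfl | htt
            · simpa [m] using h1 k l fun h => hne (by rw [h])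
            · simp [Function.update_of_ne htt]
          · rfl
        · rintro ⟨k, t'⟩ ⟨l, s'⟩ hne
          simp only [Matrix.blockDiagonal_apply]
          split_ifs with hts
          · subst hts
            rcases eq_or_ne t' t with rfl | htt
            · have : l ≠ i := fun h => hne (by rw [h])
              simp [m, hct, h2, Matrix.updateCol_ne this]
            · simp [Function.update_of_ne htt]
          · rfl
        · rintro ⟨k, t'⟩
          simp only [Matrix.blockDiagonal_apply]
          split_ifs with hts
          · subst hts
            simp [m, hct, h2]
          · simp
      · refine hI.mem_add_row (hdeg true) (hdeg false) (i, t) ?_ ?_ ?_ (hup true) (hup false)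
        · rintro ⟨k, t'⟩ hne
          ext ⟨l, s'⟩
          simp only [Matrix.blockDiagonal_apply]
          split_ifs with hts
          · rcases eq_or_ne t' t with rfl | htt
            · simpa [m] using h1 k l fun h => hne (by rw [h])
            · simp [Function.update_of_ne htt]
          · rfl
        · rintro ⟨k, t'⟩ hne
          ext ⟨l, s'⟩
          simp only [Matrix.blockDiagonal_apply]
          split_ifs with hts
          · rcases eq_or_ne t' t with rfl | htt
            · have : k ≠ i := fun h => hne (by rw [h])
              simp [m, hct, h2, Matrix.updateRow_ne this]
            · simp [Function.update_of_ne htt]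
          · rfl
        · ext ⟨l, s'⟩
          simp only [Matrix.blockDiagonal_apply, Pi.add_apply]
          split_ifs with hts
          · simp [m, hct, h2]
          · simp
  exact key Finset.univ (fun _ => none) (by simp)

theorem IsGrMatrixIdeal.isGrMatrixIdeal_grRadical (hI : IsGrMatrixIdeal 𝒜 I)
    (h𝒜 : IsGradedMul 𝒜) : IsGrMatrixIdeal 𝒜 (grRadical 𝒜 I) where
  subset_homMatrices M hM := hM.1
  nonGrFull_subset M hM := ⟨hM.1, 0, hI.nonGrFull_subset hM⟩
  nabla_mem {n A B C} hA hB hC := by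
    have hI' := hI.isPreideal
    obtain ⟨hA, r, hr⟩ := hA
    obtain ⟨hB, s, hs⟩ := hB
    rw [hI'.diagPow_mem_iff] at hr hs
    refine ⟨IsDetSum.mem_homMatrices (𝒲 := homMatrices 𝒜) subset_rfl
      (.nabla (.of hA) (.of hB) hC), r + s, ?_⟩
    rw [hI'.diagPow_mem_iff]
    refine hI'.mem_blockDiagonal_nabla hC fun c => ?_
    obtain ⟨⟨α, β, hA, hB⟩, -⟩ := hC
    have hdeg : ∀ t, HomDeg 𝒜 α β (if c t then A else B) := by
      intro t
      split_ifs
      exacts [hA, hB]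
    -- Pigeonhole: among r + s + 1 blocks, each A or B, there are at least r + 1 copies of A or at
    -- least s + 1 copies of B.
    have hcount : (r + 1 ≤ Fintype.card {t // c t = true}) ∨
        (s + 1 ≤ Fintype.card {t // ¬ c t = true}) := by
      have := Fintype.card_subtype_compl (fun t => c t = true)
      have h2 := Fintype.card_subtype_le (fun t => c t = true)
      rw [Fintype.card_fin] at this h2
      omega
    rcases hcount with h | h
    · obtain ⟨f⟩ := Function.Embedding.nonempty_of_card_le
        (α := Fin (r + 1)) (β := {t // c t = true}) (by simpa using h)
      refine hI'.mem_blockDiagonal_of_injective h𝒜 hdeg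
        (Subtype.val_injective.comp f.injective) rfl ?_
      convert hr using 3 with t
      simp [(f t).2]
    · obtain ⟨f⟩ := Function.Embedding.nonempty_of_card_le
        (α := Fin (s + 1)) (β := {t // ¬ c t = true}) (by simpa using h)
      refine hI'.mem_blockDiagonal_of_injective h𝒜 hdeg
        (Subtype.val_injective.comp f.injective) rfl ?_
      convert hs using 3 with t
      have := (f t).2
      simp_all
  diagSum_mem {A B} hA hB := by
    have hI' := hI.isPreideal
    obtain ⟨hA, r, hr⟩ := hA
    refine ⟨homMatrices.diagSum hA hB, r, ?_⟩
    rw [hI'.diagPow_mem_iff] at hr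
    rw [hI'.diagPow_mem_iff, mem_blockDiagonal_diagSum_iff]
    obtain ⟨-, α, β, hA⟩ := hA
    obtain ⟨-, γ, δ, hB⟩ := hB
    have hinj : (Prod.map Sum.inl id :
        Fin A.1 × Fin (r + 1) → (Fin A.1 ⊕ Fin B.1) × Fin (r + 1)).Injective :=
      Sum.inl_injective.prodMap Function.injective_id
    refine hI'.mem_of_submatrix h𝒜
      (HomDeg.blockDiagonal fun _ => HomDeg.fromBlocks hA .zero .zero hB) hinj hinj ?_ rfl ?_
    · convert hr using 1
      ext ⟨i, t⟩ ⟨j, s⟩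
      simp [Matrix.blockDiagonal_apply]
    · rintro ⟨i, t⟩ ⟨j | j, s⟩ hj
      · exact absurd ⟨(j, s), rfl⟩ hj
      · simp [Matrix.blockDiagonal_apply]
  perm_mem {n A} σ τ hA := by
    have hI' := hI.isPreideal
    obtain ⟨⟨hn, α, β, hA⟩, r, hr⟩ := hA
    rw [permMatrix_mul_mul_permMatrix]
    refine ⟨⟨hn, α ∘ σ, β ∘ τ.symm, HomDeg.submatrix hA _ _⟩, r, ?_⟩
    rw [hI'.diagPow_mem_iff] at hr ⊢
    convert hr.submatrix (Equiv.prodCongr σ (Equiv.refl _)) (Equiv.prodCongr τ.symm (Equiv.refl _))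
      using 1
    ext ⟨i, t⟩ ⟨j, s⟩
    simp [Matrix.blockDiagonal_apply]
  of_diagSum_one {A} hA hA1 := by
    have hI' := hI.isPreideal
    obtain ⟨-, r, hr⟩ := hA1
    refine ⟨hA, r, ?_⟩
    rw [hI'.diagPow_mem_iff, mem_blockDiagonal_diagSum_iff] at hr
    rw [hI'.diagPow_mem_iff]
    obtain ⟨hn, α, β, hA⟩ := hA
    have : Nonempty (Fin A.1 × Fin (r + 1)) := ⟨(⟨0, hn⟩, 0)⟩
    refine hI.mem_of_fromBlocks_one (ρ := Fin 1 × Fin (r + 1)) h𝒜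
      (HomDeg.blockDiagonal fun _ => hA) rfl ?_
    let e : (Fin A.1 × Fin (r + 1)) ⊕ (Fin 1 × Fin (r + 1)) ≃ (Fin A.1 ⊕ Fin 1) × Fin (r + 1) :=
      (Equiv.sumProdDistrib _ _ _).symm
    convert hr.submatrix e e using 1
    ext (⟨i, t⟩ | ⟨i, t⟩) (⟨j, s⟩ | ⟨j, s⟩) <;>
      simp [e, Matrix.blockDiagonal_apply, Matrix.one_apply, Prod.ext_iff, eq_iff_true_of_subsingleton]

theorem isGrMatrixIdeal_grMatrixNilradical (h𝒜 : IsGradedMul 𝒜) :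
    IsGrMatrixIdeal 𝒜 (grMatrixNilradical 𝒜) := by
  rw [grMatrixNilradical, preidealGen_nonGrFull h𝒜]
  exact ((isPreideal_isDetSum h𝒜).isGrMatrixIdeal_quotientBy h𝒜).isGrMatrixIdeal_grRadical h𝒜

theorem isProperGrMatrixIdeal_grMatrixNilradical (h𝒜 : IsGradedMul 𝒜)
    (h : ∀ M ∈ identityMatrices R, ¬ IsDetSum 𝒜 (nonGrFull 𝒜) M) :
    IsProperGrMatrixIdeal 𝒜 (grMatrixNilradical 𝒜) where
  toIsGrMatrixIdeal := isGrMatrixIdeal_grMatrixNilradical h𝒜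
  ne_homMatrices heq := by
    have h1 : (⟨1, 1⟩ : SqMat R) ∈ grMatrixNilradical 𝒜 := by
      rw [heq]
      exact ⟨le_rfl, fun _ => 1, fun _ => 1, HomDeg.one h𝒜⟩
    rw [grMatrixNilradical, preidealGen_nonGrFull h𝒜] at h1
    have hJ := isPreideal_isDetSum h𝒜
    obtain ⟨-, r, -, _, ⟨k, hk, rfl⟩, hr⟩ := h1
    rw [hJ.mem_diagSum_iff] at hr
    obtain ⟨e, he⟩ := exists_diagPow_eq_submatrix (⟨1, 1⟩ : SqMat R) r
    rw [he] at hr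
    have hone : Matrix.fromBlocks ((Matrix.blockDiagonal fun _ : Fin (r + 1) =>
        (1 : Matrix (Fin 1) (Fin 1) R)).submatrix e e) 0 0 (1 : Matrix (Fin k) (Fin k) R) = 1 := by
      have : (fun _ : Fin (r + 1) => (1 : Matrix (Fin 1) (Fin 1) R)) = 1 := rfl
      rw [this, Matrix.blockDiagonal_one, Matrix.submatrix_one_equiv, Matrix.fromBlocks_one]
    rw [hone] at hr
    obtain ⟨n, f, f', hn⟩ := hr
    -- Independent numberings of rows and columns turn the identity into a permutation matrix;
    -- permuting the columns back recovers the identity.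
    have := hJ.mem_of_equiv (mem_of_mem hn) (Equiv.refl _) (f'.trans f.symm).symm
    refine h _ ⟨n, hn.mem_homMatrices (fun _ h => h.1) |>.1, rfl⟩ ?_
    have hone' : (Matrix.submatrix (1 : Matrix (Fin (diagPow (⟨1, 1⟩ : SqMat R) r).1 ⊕ Fin k) _ R)
        f f').submatrix (Equiv.refl _) (f'.trans f.symm).symm = 1 := by
      ext i j
      simp [Matrix.one_apply]
    rw [hone'] at this
    exact this

end Radical

end GrDiv

namespace GrDiv

/-! ### Gr-prime matrix ideals. -/

section Prime

variable {Γ : Type v} [Group Γ] {R : Type u} [Ring R] {𝒜 : Γ → AddSubgroup R}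
  {I P : Set (SqMat R)}

/-- Gr-prime matrix ideals: proper gr-matrix ideals such that `A ⊕ B ∈ P` only if `A ∈ P` or
`B ∈ P`. -/
structure IsGrPrime (𝒜 : Γ → AddSubgroup R) (P : Set (SqMat R)) : Prop
    extends IsProperGrMatrixIdeal 𝒜 P where
  mem_or_mem : ∀ {A B : SqMat R}, A ∈ homMatrices 𝒜 → B ∈ homMatrices 𝒜 → diagSum A B ∈ P →
    A ∈ P ∨ B ∈ P

/-- If an identity matrix lies in I, then so does A ⊕ 1 for every A, and the identity cancels. -/
theorem IsGrMatrixIdeal.eq_homMatrices {ι : Type*} [Fintype ι] [DecidableEq ι]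
    (hI : IsGrMatrixIdeal 𝒜 I) (h𝒜 : IsGradedMul 𝒜) (h : Mem I (1 : Matrix ι ι R)) :
    I = homMatrices 𝒜 := by
  refine hI.subset_homMatrices.antisymm fun A hA => ?_
  obtain ⟨hn, α, β, hdeg⟩ := hA
  have hI' := hI.isPreideal
  have : Nonempty (Fin A.1) := ⟨⟨0, hn⟩⟩
  refine hI'.mem_iff.1 (hI.mem_of_fromBlocks_one (ρ := ι) h𝒜 (α := α) (β := β) hdeg rfl ?_)
  have := (hI'.mem_fromBlocks_diag (γ := α) (δ := β) h hdeg rfl).submatrix (Equiv.sumComm _ _)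
    (Equiv.sumComm _ _)
  simpa only [Equiv.sumComm_apply, Matrix.fromBlocks_submatrix_sum_swap_sum_swap] using this

/-- This colon ideal is what maximality is tested against when a maximal ideal is shown to be prime.
-/
theorem IsGrMatrixIdeal.isGrMatrixIdeal_diagSum (hI : IsGrMatrixIdeal 𝒜 I) (h𝒜 : IsGradedMul 𝒜)
    {D : SqMat R} (hD : D ∈ homMatrices 𝒜) :
    IsGrMatrixIdeal 𝒜 {A | A ∈ homMatrices 𝒜 ∧ diagSum A D ∈ I} where
  subset_homMatrices A hA := hA.1
  nonGrFull_subset A hA := ⟨hA.1, hI.diagSum_mem (hI.nonGrFull_subset hA) hD⟩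
  nabla_mem {n A B C} hA hB hC := by
    obtain ⟨-, γ, δ, hdeg⟩ := hD
    exact ⟨IsDetSum.mem_homMatrices (𝒲 := homMatrices 𝒜) subset_rfl
      (.nabla (.of hA.1) (.of hB.1) hC), hI.nabla_mem hA.2 hB.2 (hC.diagSum hdeg)⟩
  diagSum_mem {A B} hA hB := by
    have hI' := hI.isPreideal
    refine ⟨homMatrices.diagSum hA.1 hB, ?_⟩
    have h := hA.2
    rw [hI'.mem_diagSum_iff] at h
    rw [hI'.mem_diagSum_iff, mem_fromBlocks_diagSum_iff]
    obtain ⟨-, γ, δ, hB⟩ := hB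
    have := hI'.mem_fromBlocks_diag (γ := γ) (δ := δ) h hB rfl
    let e : (Fin A.1 ⊕ Fin B.1) ⊕ Fin D.1 ≃ (Fin A.1 ⊕ Fin D.1) ⊕ Fin B.1 :=
      (Equiv.sumAssoc _ _ _).trans <| (Equiv.sumCongr (Equiv.refl _) (Equiv.sumComm _ _)).trans
        (Equiv.sumAssoc _ _ _).symm
    convert this.submatrix e e using 1
    ext ((i | i) | i) ((j | j) | j) <;> simp [e]
  perm_mem {n A} σ τ hA := by
    have hI' := hI.isPreideal
    obtain ⟨⟨hn, α, β, hA⟩, h⟩ := hA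
    rw [permMatrix_mul_mul_permMatrix]
    refine ⟨⟨hn, α ∘ σ, β ∘ τ.symm, HomDeg.submatrix hA _ _⟩, ?_⟩
    rw [hI'.mem_diagSum_iff] at h ⊢
    convert h.submatrix (Equiv.sumCongr σ (Equiv.refl _)) (Equiv.sumCongr τ.symm (Equiv.refl _))
      using 1
    ext (i | i) (j | j) <;> simp
  of_diagSum_one {A} hA h := by
    have hI' := hI.isPreideal
    refine ⟨hA, ?_⟩
    have h := h.2
    rw [hI'.mem_diagSum_iff, mem_fromBlocks_diagSum_iff] at h
    rw [hI'.mem_diagSum_iff]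
    obtain ⟨hn, α, β, hA⟩ := hA
    obtain ⟨-, γ, δ, hD⟩ := hD
    have : Nonempty (Fin A.1 ⊕ Fin D.1) := ⟨Sum.inl ⟨0, hn⟩⟩
    refine hI.mem_of_fromBlocks_one (ρ := Fin 1) h𝒜
      (HomDeg.fromBlocks (α := α) (β := β) (γ := γ) (δ := δ) hA .zero .zero hD) rfl ?_
    let e : (Fin A.1 ⊕ Fin D.1) ⊕ Fin 1 ≃ (Fin A.1 ⊕ Fin 1) ⊕ Fin D.1 :=
      (Equiv.sumAssoc _ _ _).trans <| (Equiv.sumCongr (Equiv.refl _) (Equiv.sumComm _ _)).trans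
        (Equiv.sumAssoc _ _ _).symm
    convert h.submatrix e e using 1
    ext ((i | i) | i) ((j | j) | j) <;> simp [e]

theorem one_mem_homMatrices (h𝒜 : IsGradedMul 𝒜) : (⟨1, 1⟩ : SqMat R) ∈ homMatrices 𝒜 :=
  ⟨le_rfl, fun _ => 1, fun _ => 1, HomDeg.one h𝒜⟩

theorem IsProperGrMatrixIdeal.one_notMem (hI : IsProperGrMatrixIdeal 𝒜 I)
    (h𝒜 : IsGradedMul 𝒜) : (⟨1, 1⟩ : SqMat R) ∉ I := fun h =>
  hI.ne_homMatrices (hI.eq_homMatrices h𝒜 (mem_of_mem h))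

theorem IsGrMatrixIdeal.isProper_of_one_notMem (hI : IsGrMatrixIdeal 𝒜 I)
    (h𝒜 : IsGradedMul 𝒜) (h : (⟨1, 1⟩ : SqMat R) ∉ I) : IsProperGrMatrixIdeal 𝒜 I :=
  { hI with ne_homMatrices := fun heq => h (heq ▸ one_mem_homMatrices h𝒜) }

theorem isProperGrMatrixIdeal_sUnion (h𝒜 : IsGradedMul 𝒜) {c : Set (Set (SqMat R))}
    (hc : ∀ I ∈ c, IsProperGrMatrixIdeal 𝒜 I) (hchain : IsChain (· ⊆ ·) c) (hne : c.Nonempty) :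
    IsProperGrMatrixIdeal 𝒜 (⋃₀ c) := by
  obtain ⟨J, hJ⟩ := hne
  refine IsGrMatrixIdeal.isProper_of_one_notMem ⟨?_, ?_, ?_, ?_, ?_, ?_⟩ h𝒜 ?_
  · exact Set.sUnion_subset fun I hI => (hc I hI).subset_homMatrices
  · exact (hc J hJ).nonGrFull_subset.trans (Set.subset_sUnion_of_mem hJ)
  · rintro n A B C ⟨I, hI, hA⟩ ⟨I', hI', hB⟩ hC
    rcases hchain.total hI hI' with h | h
    · exact ⟨I', hI', (hc I' hI').nabla_mem (h hA) hB hC⟩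
    · exact ⟨I, hI, (hc I hI).nabla_mem hA (h hB) hC⟩
  · rintro A B ⟨I, hI, hA⟩ hB
    exact ⟨I, hI, (hc I hI).diagSum_mem hA hB⟩
  · rintro n A σ τ ⟨I, hI, hA⟩
    exact ⟨I, hI, (hc I hI).perm_mem σ τ hA⟩
  · rintro A hA ⟨I, hI, hA'⟩
    exact ⟨I, hI, (hc I hI).of_diagSum_one hA hA'⟩
  · rintro ⟨I, hI, h1⟩
    exact (hc I hI).one_notMem h𝒜 h1

/-- A ring with a proper gr-matrix ideal has a gr-prime matrix ideal. -/
theorem IsProperGrMatrixIdeal.exists_isGrPrime (hI : IsProperGrMatrixIdeal 𝒜 I)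
    (h𝒜 : IsGradedMul 𝒜) : ∃ P, IsGrPrime 𝒜 P := by
  obtain ⟨P, -, hP⟩ := zorn_subset_nonempty {J | IsProperGrMatrixIdeal 𝒜 J}
    (fun c hc hchain hne => ⟨⋃₀ c, isProperGrMatrixIdeal_sUnion h𝒜 hc hchain hne,
      fun s hs => Set.subset_sUnion_of_mem hs⟩) I hI
  have hprop : IsProperGrMatrixIdeal 𝒜 P := hP.prop
  refine ⟨P, hprop, ?_⟩
  intro A B hA hB hAB
  by_contra! hcon
  -- The ideal of all X with X ⊕ B ∈ P contains P. If it is improper it contains (1), which gives B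
  -- ∈ P; otherwise it is P by maximality, which gives A ∈ P.
  have hQ := hprop.isGrMatrixIdeal_diagSum h𝒜 hB
  have hPQ : P ⊆ {A | A ∈ homMatrices 𝒜 ∧ diagSum A B ∈ P} := fun X hX =>
    ⟨hprop.subset_homMatrices hX, hprop.diagSum_mem hX hB⟩
  by_cases h1 : (⟨1, 1⟩ : SqMat R) ∈ {A | A ∈ homMatrices 𝒜 ∧ diagSum A B ∈ P}
  · refine hcon.2 (hprop.of_diagSum_one hB ?_)
    have hI' := hprop.isPreideal
    have h := h1.2
    rw [hI'.mem_diagSum_iff] at h ⊢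
    have := h.submatrix (Equiv.sumComm _ _) (Equiv.sumComm _ _)
    simpa only [Equiv.sumComm_apply, Matrix.fromBlocks_submatrix_sum_swap_sum_swap] using this
  · exact hcon.1 (hP.le_of_ge (hQ.isProper_of_one_notMem h𝒜 h1) hPQ ⟨hA, hAB⟩)

namespace IsGrPrime

variable {ι κ μ ν : Type*} [Fintype ι] [Fintype κ] [Fintype μ] [Fintype ν]
  {α : ι → Γ} {β : κ → Γ} {γ : μ → Γ} {δ : ν → Γ}

theorem not_mem_one [DecidableEq ι] (hP : IsGrPrime 𝒜 P) (h𝒜 : IsGradedMul 𝒜) :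
    ¬ Mem P (1 : Matrix ι ι R) := fun h =>
  hP.ne_homMatrices (hP.eq_homMatrices h𝒜 h)

theorem mem_or_mem_of_diag (hP : IsGrPrime 𝒜 P) {A : Matrix ι κ R} {B : Matrix μ ν R}
    (hA : HomDeg 𝒜 α β A) (hB : HomDeg 𝒜 γ δ B) (hcard : Fintype.card ι = Fintype.card κ)
    (h : Mem P (Matrix.fromBlocks A 0 0 B)) : Mem P A ∨ Mem P B := by
  have hI' := hP.isPreideal
  have hcard' : Fintype.card μ = Fintype.card ν := by
    have := h.card_eq
    simp only [Fintype.card_sum] at this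
    omega
  rcases isEmpty_or_nonempty ι with hι | hι
  · have hκ : IsEmpty κ := by
      rw [← Fintype.card_eq_zero_iff, ← hcard, Fintype.card_eq_zero_iff]; exact hι
    right
    convert h.submatrix (Equiv.emptySum ι μ).symm (Equiv.emptySum κ ν).symm using 1
    ext i j
    simp
  rcases isEmpty_or_nonempty μ with hμ | hμ
  · have hν : IsEmpty ν := by
      rw [← Fintype.card_eq_zero_iff, ← hcard', Fintype.card_eq_zero_iff]; exact hμ
    left
    convert h.submatrix (Equiv.sumEmpty ι μ).symm (Equiv.sumEmpty κ ν).symm using 1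
    ext i j
    simp
  let e := (Fintype.equivFin ι).symm
  let e' := (Fintype.equivFinOfCardEq hcard.symm).symm
  let f := (Fintype.equivFin μ).symm
  let f' := (Fintype.equivFinOfCardEq hcard'.symm).symm
  have := hP.mem_or_mem (A := ⟨_, A.submatrix e e'⟩) (B := ⟨_, B.submatrix f f'⟩)
    ⟨Fintype.card_pos, _, _, hA.submatrix e e'⟩ ⟨Fintype.card_pos, _, _, hB.submatrix f f'⟩ ?_
  · exact this.imp (fun h => ⟨_, e, e', h⟩) (fun h => ⟨_, f, f', h⟩)
  · rw [hI'.mem_diagSum_iff]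
    convert h.submatrix (Equiv.sumCongr e f) (Equiv.sumCongr e' f') using 1
    ext (i | i) (j | j) <;> simp

/-- The off-diagonal block can be replaced by zero before primeness is applied. -/
theorem mem_or_mem_of_lower (hP : IsGrPrime 𝒜 P) (h𝒜 : IsGradedMul 𝒜) {A : Matrix ι κ R}
    {C : Matrix μ κ R} {D : Matrix μ ν R} (hA : HomDeg 𝒜 α β A) (hC : HomDeg 𝒜 γ β C)
    (hD : HomDeg 𝒜 γ δ D) (hcard : Fintype.card ι = Fintype.card κ)
    (h : Mem P (Matrix.fromBlocks A 0 C D)) : Mem P A ∨ Mem P D :=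
  hP.mem_or_mem_of_diag hA hD hcard (hP.isPreideal.mem_fromBlocks_lower h𝒜 hA hC .zero hD hcard h)

theorem mem_or_mem_of_upper (hP : IsGrPrime 𝒜 P) (h𝒜 : IsGradedMul 𝒜) {A : Matrix ι κ R}
    {B : Matrix ι ν R} {D : Matrix μ ν R} (hA : HomDeg 𝒜 α β A) (hB : HomDeg 𝒜 α δ B)
    (hD : HomDeg 𝒜 γ δ D) (hcard : Fintype.card μ = Fintype.card ν)
    (h : Mem P (Matrix.fromBlocks A B 0 D)) : Mem P A ∨ Mem P D := by
  have := h.submatrix (Equiv.sumComm _ _) (Equiv.sumComm _ _)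
  simp only [Equiv.sumComm_apply, Matrix.fromBlocks_submatrix_sum_swap_sum_swap] at this
  exact (hP.mem_or_mem_of_lower h𝒜 hD hB hA hcard this).symm

/-- Suppose that `A ∉ P` and that `[[A, x], [f, 0]] ∈ P`. If the rows of `x g - A F` lie in the
left submodule of all rows `r` with `[[C, y], [r, 0]] ∈ P`, then so does `f F`. -/
theorem mem_bordered_mul {J n : Type*} [Fintype J] [Fintype n] (hP : IsGrPrime 𝒜 P)
    (h𝒜 : IsGradedMul 𝒜) {C : Matrix J J R} {y : Matrix J Unit R} {A : Matrix n n R}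
    {x : Matrix n Unit R} {f : Matrix Unit n R} {F : Matrix n J R} {g : Matrix Unit J R}
    {αJ βJ : J → Γ} {α β : n → Γ} {ε φ η : Unit → Γ} (hC : HomDeg 𝒜 αJ βJ C)
    (hy : HomDeg 𝒜 αJ η y) (hA : HomDeg 𝒜 α β A) (hx : HomDeg 𝒜 α ε x) (hf : HomDeg 𝒜 φ β f)
    (hF : HomDeg 𝒜 β βJ F) (hg : HomDeg 𝒜 ε βJ g) (hAP : ¬ Mem P A)
    (hAxf : Mem P (Matrix.fromBlocks A x f 0))
    (h : ∀ i, Mem P (Matrix.fromBlocks C y ((x * g - A * F).submatrix (fun _ : Unit => i) id) 0)) :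
    Mem P (Matrix.fromBlocks C y (f * F) 0) := by
  classical
  have hI := hP.isPreideal
  -- When C ∉ P, the bordered matrix [[C, y], [r, 0]] should lie in P exactly when r C⁻¹ y = 0. The
  -- hypotheses then say f A⁻¹ x = 0 and A F C⁻¹ y = x g C⁻¹ y, whence f F C⁻¹ y = f A⁻¹ x g C⁻¹ y =
  -- 0. The matrices carry this out without inverses: D lies in P because it contains [[A, x], [f,
  -- 0]], and V = D E.
  let D : Matrix ((J ⊕ Unit) ⊕ n) ((J ⊕ Unit) ⊕ n) R :=
    Matrix.fromBlocks (Matrix.fromBlocks 1 0 0 0) (Matrix.fromRows 0 f) (Matrix.fromCols 0 x) A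
  let E : Matrix ((J ⊕ Unit) ⊕ n) ((J ⊕ Unit) ⊕ n) R :=
    Matrix.fromBlocks (Matrix.fromBlocks C y (-g) 0) 0 (Matrix.fromCols F 0) 1
  let V : Matrix ((J ⊕ Unit) ⊕ n) ((J ⊕ Unit) ⊕ n) R :=
    Matrix.fromBlocks (Matrix.fromBlocks C y (f * F) 0) (Matrix.fromRows 0 f)
      (Matrix.fromCols (A * F - x * g) 0) A
  let X : Matrix ((J ⊕ Unit) ⊕ n) ((J ⊕ Unit) ⊕ n) R :=
    Matrix.fromBlocks 0 0 (Matrix.fromCols (x * g - A * F) 0) 0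
  have h0f : HomDeg 𝒜 (Sum.elim αJ φ) β (Matrix.fromRows 0 f : Matrix (J ⊕ Unit) n R) := by
    rintro (i | i) j
    exacts [zero_mem _, hf i j]
  have hcols : ∀ {G : Matrix n J R}, HomDeg 𝒜 α βJ G →
      HomDeg 𝒜 α (Sum.elim βJ η) (Matrix.fromCols G 0 : Matrix n (J ⊕ Unit) R) := by
    rintro G hG i (j | j)
    exacts [hG i j, zero_mem _]
  have hD : HomDeg 𝒜 (Sum.elim (Sum.elim αJ φ) α) (Sum.elim (Sum.elim αJ ε) β) D := by
    refine HomDeg.fromBlocks ((HomDeg.one h𝒜).fromBlocks .zero .zero .zero) h0f ?_ hA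
    rintro i (j | j)
    exacts [zero_mem _, hx i j]
  have hE : HomDeg 𝒜 (Sum.elim (Sum.elim αJ ε) β) (Sum.elim (Sum.elim βJ η) β) E := by
    refine HomDeg.fromBlocks (hC.fromBlocks hy hg.neg .zero) .zero ?_ (.one h𝒜)
    rintro i (j | j)
    exacts [hF i j, zero_mem _]
  have hV : HomDeg 𝒜 (Sum.elim (Sum.elim αJ φ) α) (Sum.elim (Sum.elim βJ η) β) V :=
    HomDeg.fromBlocks (hC.fromBlocks hy (hf.mul h𝒜 hF) .zero) h0f
      (hcols ((hA.mul h𝒜 hF).sub (hx.mul h𝒜 hg))) hA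
  have hX : HomDeg 𝒜 (Sum.elim (Sum.elim αJ φ) α) (Sum.elim (Sum.elim βJ η) β) X :=
    HomDeg.fromBlocks .zero .zero (hcols ((hx.mul h𝒜 hg).sub (hA.mul h𝒜 hF))) .zero
  have hDE : D * E = V := by
    simp only [D, E, V, Matrix.fromBlocks_multiply]
    congr 1
    · ext (i | i) (j | j) <;> simp [Matrix.fromRows_mul, Matrix.mul_fromCols]
    · simp
    · ext i (j | j) <;> simp [Matrix.mul_apply, Matrix.sub_apply]
      abel
    · simp
  have mD : Mem P D := by
    refine hI.mem_of_submatrix h𝒜 hD (ι₁ := n ⊕ Unit) (κ₁ := n ⊕ Unit)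
      (a := Sum.elim Sum.inr fun _ => Sum.inl (Sum.inr ()))
      (b := Sum.elim Sum.inr fun _ => Sum.inl (Sum.inr ())) ?_ ?_ ?_ rfl ?_
    · rintro (a | a) (b | b) hab <;> simp_all
    · rintro (a | a) (b | b) hab <;> simp_all
    · convert hAxf using 1
      ext (i | i) (j | j) <;> rfl
    · rintro (i | i) ((j | j) | j) hj
      · rfl
      · exact absurd ⟨Sum.inr (), rfl⟩ hj
      · exact absurd ⟨Sum.inl j, rfl⟩ hj
      · rfl
      · exact absurd ⟨Sum.inr (), rfl⟩ hj
      · exact absurd ⟨Sum.inl j, rfl⟩ hj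
  have mV : Mem P V := hDE ▸ hP.mem_mul_right h𝒜 hD hE rfl mD
  -- Adding X clears the lower left block of V. Each intermediate matrix has a row (x g - A F)_i
  -- below [C, y], which is in P by `h`. The result is block upper triangular with A ∉ P as its
  -- second diagonal block, so primeness isolates the first.
  have mXV : Mem P (X + V) := by
    refine hI.mem_add_rows hX hV (Finset.univ.image Sum.inr) ?_ ?_ mV
    · rintro ((k | k) | k) hk
      · ext ((l | l) | l) <;> rfl
      · ext ((l | l) | l) <;> rfl
      · simp at hk
    · rintro i hi Z hZ hZ1 hZ2
      obtain ⟨i, -, rfl⟩ := Finset.mem_image.1 hi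
      refine hI.mem_of_submatrix h𝒜 hZ (ι₁ := J ⊕ Unit) (κ₁ := J ⊕ Unit)
        (a := Sum.elim (fun j => Sum.inl (Sum.inl j)) fun _ => Sum.inr i)
        (b := Sum.inl) ?_ Sum.inl_injective ?_ rfl ?_
      · rintro (a | a) (b | b) hab <;> simp_all
      · convert h i using 1
        ext (k | k) (j | j)
        · exact congrFun (hZ1 (Sum.inl (Sum.inl k)) (by simp)) _
        · exact congrFun (hZ1 (Sum.inl (Sum.inl k)) (by simp)) _
        · exact congrFun hZ2 _
        · exact congrFun hZ2 _
      · rintro (k | k) (j | j) hj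
        · simp at hj
        · exact congrFun (hZ1 (Sum.inl (Sum.inl k)) (by simp)) _
        · simp at hj
        · exact congrFun hZ2 _
  have hXV : X + V = Matrix.fromBlocks (Matrix.fromBlocks C y (f * F) 0) (Matrix.fromRows 0 f) 0 A := by
    simp only [X, V, Matrix.fromBlocks_add, zero_add]
    congr 1
    ext i (j | j) <;> simp
  rw [hXV] at mXV
  exact (hP.mem_or_mem_of_upper h𝒜 (hC.fromBlocks hy (hf.mul h𝒜 hF) .zero) h0f hA rfl
    mXV).resolve_right hAP

end IsGrPrime

/-- If `c y = 0`, then `[[C, y], [c C, 0]]` lies in every preideal. -/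
theorem IsPreideal.mem_bordered {J : Type*} [Fintype J] (hI : IsPreideal 𝒜 I)
    (h𝒜 : IsGradedMul 𝒜) {C : Matrix J J R} {y : Matrix J Unit R} {c : Matrix Unit J R}
    {α β : J → Γ} {φ η : Unit → Γ} (hC : HomDeg 𝒜 α β C) (hy : HomDeg 𝒜 α η y)
    (hc : HomDeg 𝒜 φ α c) (hcy : c * y = 0) : Mem I (Matrix.fromBlocks C y (c * C) 0) := by
  refine hI.mem_of_row_eq_sum h𝒜 (hC.fromBlocks hy (hc.mul h𝒜 hC) .zero) rfl (Sum.inr ())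
    (Sum.elim (fun k => c () k) fun _ => 0) ?_ rfl ?_
  · rintro (k | k)
    exacts [hc () k, zero_mem _]
  · rintro (l | l)
    · simp [Matrix.mul_apply]
    · have := congrFun (congrFun hcy ()) l
      rw [Matrix.mul_apply] at this
      simp [this]

end Prime

end GrDiv

namespace GrDiv

/-! ### Projections onto homogeneous components. -/

section Projections

variable {Γ : Type v} [Group Γ] {R : Type u} [Ring R] {𝒜 : Γ → AddSubgroup R}

/-- A family of additive projections onto the homogeneous components. -/
structure IsProj (𝒜 : Γ → AddSubgroup R) (pr : Γ → R →+ R) : Prop where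
  mem : ∀ γ r, pr γ r ∈ 𝒜 γ
  of_mem : ∀ {γ r}, r ∈ 𝒜 γ → pr γ r = r
  of_mem_ne : ∀ {γ δ r}, r ∈ 𝒜 δ → δ ≠ γ → pr γ r = 0
  iSup_eq_top : ⨆ γ, 𝒜 γ = ⊤

/-- The directness of R = ⨁ R_γ is used below only through these projections. -/
theorem IsGradedRing.exists_isProj (h : IsGradedRing 𝒜) : ∃ pr : Γ → R →+ R, IsProj 𝒜 pr := by
  classical
  have hint : DirectSum.IsInternal 𝒜 := by convert h.isInternal
  let e := AddEquiv.ofBijective (DirectSum.coeAddMonoidHom 𝒜) hint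
  have he : ∀ {γ : Γ} {r : R} (hr : r ∈ 𝒜 γ),
      e.symm r = DirectSum.of (fun γ => 𝒜 γ) γ ⟨r, hr⟩ := fun {γ r} hr => by
    rw [AddEquiv.symm_apply_eq]
    exact (DirectSum.coeAddMonoidHom_of 𝒜 γ ⟨r, hr⟩).symm
  refine ⟨fun γ => (𝒜 γ).subtype.comp ((DFinsupp.evalAddMonoidHom γ).comp
    (e.symm : R →+ DirectSum Γ fun γ => 𝒜 γ)), fun γ r => ?_, fun {γ r} hr => ?_,
    fun {γ δ r} hr hne => ?_, eq_top_iff.2 fun r _ => ?_⟩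
  · exact (e.symm r γ).2
  · change ((e.symm r γ : 𝒜 γ) : R) = r
    rw [he hr, DirectSum.of_eq_same]
  · change ((e.symm r γ : 𝒜 γ) : R) = 0
    rw [he hr, DirectSum.of_eq_of_ne _ _ _ hne.symm]
    rfl
  · obtain ⟨x, rfl⟩ := hint.2 r
    induction x using DirectSum.induction_on with
    | zero => rw [map_zero]; exact zero_mem _
    | of γ x =>
      rw [DirectSum.coeAddMonoidHom_of]
      exact AddSubgroup.mem_iSup_of_mem γ x.2
    | add x y hx hy => rw [map_add]; exact add_mem (hx trivial) (hy trivial)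

/-- Induction on homogeneous elements. -/
theorem induction_homogeneous {p : R → Prop} (htop : ⨆ γ, 𝒜 γ = ⊤)
    (hom : ∀ γ, ∀ r ∈ 𝒜 γ, p r) (zero : p 0) (add : ∀ r s, p r → p s → p (r + s)) (r : R) :
    p r := by
  have : r ∈ ⨆ γ, 𝒜 γ := htop ▸ AddSubgroup.mem_top r
  induction this using AddSubgroup.iSup_induction' with
  | hp γ r hr => exact hom γ r hr
  | h1 => exact zero
  | hadd r s _ _ hr hs => exact add r s hr hs

theorem IsProj.mul_left {pr : Γ → R →+ R} (hpr : IsProj 𝒜 pr) (h𝒜 : IsGradedMul 𝒜) {γ δ : Γ}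
    {r : R} (hr : r ∈ 𝒜 γ) (x : R) : pr (γ * δ) (r * x) = r * pr δ x := by
  induction x using induction_homogeneous hpr.iSup_eq_top with
  | hom ε x hx =>
    rcases eq_or_ne ε δ with rfl | hne
    · rw [hpr.of_mem hx, hpr.of_mem (h𝒜.mul_mem hr hx)]
    · rw [hpr.of_mem_ne hx hne, mul_zero, hpr.of_mem_ne (h𝒜.mul_mem hr hx)]
      simpa using hne
  | zero => simp
  | add x y hx hy => rw [mul_add, map_add, hx, hy, map_add, mul_add]

end Projections

/-! ### Linear systems over R and the forms vanishing on their solutions. -/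

section Localization

variable {Γ : Type v} [Group Γ] {R : Type u} [Ring R] {𝒜 : Γ → AddSubgroup R}
  {P : Set (SqMat R)}

/-- A homogeneous system of linear equations `A v = x`, with a coefficient matrix `A ∉ P`. -/
structure LinSystem (𝒜 : Γ → AddSubgroup R) (P : Set (SqMat R)) where
  ι : Type
  [fintype : Fintype ι]
  [decEq : DecidableEq ι]
  mat : Matrix ι ι R
  col : ι → R
  rdeg : ι → Γ
  cdeg : ι → Γ
  homDeg : HomDeg 𝒜 rdeg cdeg mat
  col_mem : ∀ i, col i ∈ 𝒜 (rdeg i)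
  notMem : ¬ Mem P mat

attribute [instance] LinSystem.fintype LinSystem.decEq

variable (𝒜 P) in
/-- The unknowns of all linear systems. -/
abbrev Unknown : Type _ := Σ p : LinSystem 𝒜 P, p.ι

/-- The degree of an unknown. -/
def Unknown.deg (s : Unknown 𝒜 P) : Γ := s.1.cdeg s.2

/-- The unknowns of the linear systems in `T`. -/
abbrev UnknownIn (T : Finset (LinSystem 𝒜 P)) : Type _ :=
  {s : Unknown 𝒜 P // s ∈ T.sigma fun _ => Finset.univ}

open scoped Classical in
variable (𝒜 P) in
/-- The coefficient matrix of all linear systems. -/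
noncomputable def bigMat : Matrix (Unknown 𝒜 P) (Unknown 𝒜 P) R :=
  Matrix.blockDiagonal' fun p : LinSystem 𝒜 P => p.mat

theorem bigMat_apply_eq (p : LinSystem 𝒜 P) (i j : p.ι) :
    bigMat 𝒜 P ⟨p, i⟩ ⟨p, j⟩ = p.mat i j :=
  by classical exact Matrix.blockDiagonal'_apply_eq (fun p : LinSystem 𝒜 P => p.mat) p i j

theorem bigMat_apply_ne (s t : Unknown 𝒜 P) (h : s.1 ≠ t.1) : bigMat 𝒜 P s t = 0 :=
  by classical exact Matrix.blockDiagonal'_apply_ne (fun p : LinSystem 𝒜 P => p.mat) s.2 t.2 h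

theorem homDeg_bigMat :
    HomDeg 𝒜 (fun s : Unknown 𝒜 P => s.1.rdeg s.2) Unknown.deg (bigMat 𝒜 P) := by
  rintro ⟨p, i⟩ ⟨q, j⟩
  rcases eq_or_ne p q with rfl | h
  · rw [bigMat_apply_eq]
    exact p.homDeg i j
  · rw [bigMat_apply_ne _ _ h]
    exact zero_mem _

/-- The coefficient matrix of the linear systems in `T`. -/
noncomputable def matIn (T : Finset (LinSystem 𝒜 P)) : Matrix (UnknownIn T) (UnknownIn T) R :=
  (bigMat 𝒜 P).submatrix Subtype.val Subtype.val

/-- The right-hand side of the linear systems in `T`. -/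
def colIn (T : Finset (LinSystem 𝒜 P)) : Matrix (UnknownIn T) Unit R :=
  Matrix.of fun s _ => s.1.1.col s.1.2

/-- The restriction of a row to the unknowns of the linear systems in `T`. -/
def rowIn (T : Finset (LinSystem 𝒜 P)) (h : Unknown 𝒜 P → R) : Matrix Unit (UnknownIn T) R :=
  Matrix.of fun _ s => h s.1

theorem homDeg_matIn (T : Finset (LinSystem 𝒜 P)) :
    HomDeg 𝒜 (fun s : UnknownIn T => s.1.1.rdeg s.1.2) (fun s => s.1.deg) (matIn T) :=
  homDeg_bigMat.submatrix _ _

theorem homDeg_colIn (T : Finset (LinSystem 𝒜 P)) :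
    HomDeg 𝒜 (fun s : UnknownIn T => s.1.1.rdeg s.1.2) (fun _ => 1) (colIn T) := fun s _ => by
  simpa [colIn] using s.1.1.col_mem s.1.2

/-- The linear form `h` in the unknowns vanishes on the solution of the linear systems in `T`. -/
def NullIn (T : Finset (LinSystem 𝒜 P)) (h : Unknown 𝒜 P → R) : Prop :=
  Mem P (Matrix.fromBlocks (matIn T) (colIn T) (rowIn T h) 0)

/-- The systems in T are pooled into one block diagonal system; primeness keeps its coefficient
matrix outside P. -/
theorem not_mem_matIn (hP : IsGrPrime 𝒜 P)
    (T : Finset (LinSystem 𝒜 P)) : ¬ Mem P (matIn T) := by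
  classical
  induction T using Finset.induction_on with
  | empty =>
    -- For empty T the matrix has size 0, whereas members of P have size at least 1.
    rintro ⟨n, e, e', h⟩
    have hn : 1 ≤ n := (hP.subset_homMatrices h).1
    exact absurd (Finset.mem_sigma.1 (e ⟨0, hn⟩).2).1 (Finset.notMem_empty _)
  | insert p T hp ih =>
    intro h
    let f : p.ι ⊕ UnknownIn T → UnknownIn (insert p T) :=
      Sum.elim (fun i => ⟨⟨p, i⟩, by simp⟩)
        (fun s => ⟨s.1, by have := s.2; rw [Finset.mem_sigma] at this ⊢; simp [this.1]⟩)
    have hne : ∀ s : UnknownIn T, s.1.1 ≠ p := fun s h => by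
      have := (Finset.mem_sigma.1 s.2).1
      rw [h] at this
      exact hp this
    have hf : f.Bijective := by
      constructor
      · rintro (i | s) (j | t) hst
        · have := congrArg Subtype.val hst
          simp only [f, Sum.elim_inl, Sigma.mk.injEq, heq_eq_eq, true_and] at this
          rw [this]
        · exact absurd (congrArg (fun x => x.1.1) hst).symm (hne t)
        · exact absurd (congrArg (fun x => x.1.1) hst) (hne s)
        · have := congrArg Subtype.val hst
          exact congrArg Sum.inr (Subtype.ext this)
      · rintro ⟨⟨q, i⟩, hq⟩
        rcases Finset.mem_insert.1 (Finset.mem_sigma.1 hq).1 with h | h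
        · obtain rfl : q = p := h
          exact ⟨Sum.inl i, rfl⟩
        · exact ⟨Sum.inr ⟨⟨q, i⟩, by simpa using h⟩, rfl⟩
    let e := Equiv.ofBijective f hf
    have h' := h.submatrix e e
    have hmat : (matIn (insert p T)).submatrix e e = Matrix.fromBlocks p.mat 0 0 (matIn T) := by
      ext (i | s) (j | t)
      · exact bigMat_apply_eq p i j
      · exact bigMat_apply_ne _ _ (hne t).symm
      · exact bigMat_apply_ne _ _ (hne s)
      · rfl
    rw [hmat] at h'
    rcases hP.mem_or_mem_of_diag p.homDeg (homDeg_matIn T) rfl h' with h | h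
    exacts [p.notMem h, ih h]

theorem nullIn_zero (hP : IsGrPrime 𝒜 P) (h𝒜 : IsGradedMul 𝒜) (T : Finset (LinSystem 𝒜 P)) :
    NullIn T (0 : Unknown 𝒜 P → R) := by
  have := hP.isPreideal.mem_bordered h𝒜 (φ := fun _ => 1) (homDeg_matIn T) (homDeg_colIn T) .zero
    (Matrix.zero_mul _)
  rwa [Matrix.zero_mul] at this

theorem homDeg_rowIn (T : Finset (LinSystem 𝒜 P)) {δ : Γ} {h : Unknown 𝒜 P → R}
    (hh : ∀ s, h s ∈ 𝒜 (δ * s.deg⁻¹)) :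
    HomDeg 𝒜 (fun _ => δ) (fun s : UnknownIn T => s.1.deg) (rowIn T h) :=
  fun _ s => hh s.1

theorem NullIn.add (hP : IsGrPrime 𝒜 P) {T : Finset (LinSystem 𝒜 P)}
    {δ : Γ} {h h' : Unknown 𝒜 P → R} (hh : ∀ s, h s ∈ 𝒜 (δ * s.deg⁻¹))
    (hh' : ∀ s, h' s ∈ 𝒜 (δ * s.deg⁻¹)) (hn : NullIn T h) (hn' : NullIn T h') :
    NullIn T (h + h') := by
  refine hP.isPreideal.mem_add_row
    ((homDeg_matIn T).fromBlocks (homDeg_colIn T) (homDeg_rowIn T hh) .zero)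
    ((homDeg_matIn T).fromBlocks (homDeg_colIn T) (homDeg_rowIn T hh') .zero) (Sum.inr ())
    ?_ ?_ ?_ hn hn'
  · rintro (k | k) hk
    · ext (j | j) <;> rfl
    · exact absurd rfl hk
  · rintro (k | k) hk
    · ext (j | j) <;> rfl
    · exact absurd rfl hk
  · ext (j | j)
    · rfl
    · simp

/-- The bordered matrix is multiplied on the left by the homogeneous matrix 1 ⊕ (r), which P
absorbs. -/
theorem NullIn.smul (hP : IsGrPrime 𝒜 P) (h𝒜 : IsGradedMul 𝒜) {T : Finset (LinSystem 𝒜 P)}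
    {γ δ : Γ} {h : Unknown 𝒜 P → R} {r : R} (hr : r ∈ 𝒜 γ) (hh : ∀ s, h s ∈ 𝒜 (δ * s.deg⁻¹))
    (hn : NullIn T h) : NullIn T (r • h) := by
  classical
  have := hP.mem_mul_left h𝒜
    ((homDeg_matIn T).fromBlocks (homDeg_colIn T) (homDeg_rowIn T hh) .zero)
    (HomDeg.fromBlocks (HomDeg.one h𝒜) .zero .zero
      (D := Matrix.of fun _ _ : Unit => r) (γ := fun _ => γ * δ) (δ := fun _ => δ)
      (by intro i j; simpa using hr)) rfl hn
  rw [Matrix.fromBlocks_multiply] at this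
  have hrow : Matrix.of (fun _ _ : Unit => r) * rowIn T h = rowIn T (r • h) := by
    ext i j
    simp [rowIn, Matrix.mul_apply]
  simp only [Matrix.one_mul, Matrix.zero_mul, Matrix.mul_zero, add_zero, zero_add, hrow] at this
  exact this

variable {pr : Γ → R →+ R}

/-- The component of degree `δ` of a linear form in the unknowns. -/
def compForm (pr : Γ → R →+ R) (δ : Γ) : (Unknown 𝒜 P →₀ R) →+ (Unknown 𝒜 P → R) where
  toFun h s := pr (δ * s.deg⁻¹) (h s)
  map_zero' := by ext; simp
  map_add' _ _ := by ext; simp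

theorem compForm_apply (δ : Γ) (h : Unknown 𝒜 P →₀ R) (s : Unknown 𝒜 P) :
    compForm pr δ h s = pr (δ * s.deg⁻¹) (h s) := rfl

theorem compForm_mem (hpr : IsProj 𝒜 pr) (δ : Γ) (h : Unknown 𝒜 P →₀ R) (s : Unknown 𝒜 P) :
    compForm pr δ h s ∈ 𝒜 (δ * s.deg⁻¹) :=
  hpr.mem _ _

theorem compForm_smul (hpr : IsProj 𝒜 pr) (h𝒜 : IsGradedMul 𝒜) {γ : Γ} {r : R} (hr : r ∈ 𝒜 γ)
    (δ : Γ) (h : Unknown 𝒜 P →₀ R) : compForm pr (γ * δ) (r • h) = r • compForm pr δ h := by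
  ext s
  simp only [compForm_apply, Finsupp.smul_apply, smul_eq_mul, Pi.smul_apply, mul_assoc]
  exact hpr.mul_left h𝒜 hr _

theorem compForm_of_mem (hpr : IsProj 𝒜 pr) {δ : Γ} {h : Unknown 𝒜 P →₀ R}
    (hh : ∀ s, h s ∈ 𝒜 (δ * s.deg⁻¹)) : compForm pr δ h = h := by
  ext s
  exact hpr.of_mem (hh s)

theorem compForm_of_mem_ne (hpr : IsProj 𝒜 pr) {δ δ' : Γ} {h : Unknown 𝒜 P →₀ R}
    (hh : ∀ s, h s ∈ 𝒜 (δ * s.deg⁻¹)) (hne : δ ≠ δ') : compForm pr δ' h = 0 := by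
  ext s
  exact hpr.of_mem_ne (hh s) (by simpa using hne)

/-- The linear forms all of whose components vanish on the solutions of all sufficiently large
finite sets of linear systems. -/
def nullForms (hP : IsGrPrime 𝒜 P) (h𝒜 : IsGradedMul 𝒜) (hpr : IsProj 𝒜 pr) :
    Submodule R (Unknown 𝒜 P →₀ R) where
  -- `rowIn T` truncates a form to the unknowns of T, which loses nothing only when T contains all
  -- the systems involved; hence the condition for all large T. Imposing it degree by degree keeps
  -- the bordered matrices homogeneous and makes the submodule graded.
  carrier := {h | ∀ δ, ∀ᶠ T in Filter.atTop, NullIn T (compForm pr δ h)}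
  zero_mem' δ := by
    rw [map_zero]
    exact Filter.Eventually.of_forall fun T => nullIn_zero hP h𝒜 T
  add_mem' {h h'} hh hh' δ := by
    rw [map_add]
    filter_upwards [hh δ, hh' δ] with T hT hT'
    exact hT.add hP (compForm_mem hpr δ h) (compForm_mem hpr δ h') hT'
  smul_mem' r := by
    induction r using induction_homogeneous hpr.iSup_eq_top with
    | hom γ r hr =>
      intro h hh δ
      filter_upwards [hh (γ⁻¹ * δ)] with T hT
      have := compForm_smul hpr h𝒜 hr (γ⁻¹ * δ) h
      rw [mul_inv_cancel_left] at this
      rw [this]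
      exact hT.smul hP h𝒜 hr (compForm_mem hpr _ h)
    | zero =>
      intro h _ δ
      rw [zero_smul, map_zero]
      exact Filter.Eventually.of_forall fun T => nullIn_zero hP h𝒜 T
    | add r s hr hs =>
      intro h hh δ
      rw [add_smul, map_add]
      filter_upwards [hr hh δ, hs hh δ] with T hT hT'
      exact hT.add hP (compForm_mem hpr δ _) (compForm_mem hpr δ _) hT'

theorem mem_nullForms_of_homogeneous (hP : IsGrPrime 𝒜 P) (h𝒜 : IsGradedMul 𝒜)
    (hpr : IsProj 𝒜 pr) {δ : Γ} {h : Unknown 𝒜 P →₀ R} (hh : ∀ s, h s ∈ 𝒜 (δ * s.deg⁻¹))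
    (hn : ∀ᶠ T in Filter.atTop, NullIn T h) : h ∈ nullForms hP h𝒜 hpr := by
  intro δ'
  rcases eq_or_ne δ δ' with rfl | hne
  · rwa [compForm_of_mem hpr hh]
  · rw [compForm_of_mem_ne hpr hh hne]
    exact Filter.Eventually.of_forall fun T => nullIn_zero hP h𝒜 T

/-- The module of linear forms in the unknowns, modulo the forms that vanish on the solutions: as
an `R`-module, it is the graded epic `R`-division ring that corresponds to `P`. -/
abbrev FormModule (hP : IsGrPrime 𝒜 P) (h𝒜 : IsGradedMul 𝒜) (hpr : IsProj 𝒜 pr) : Type _ :=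
  (Unknown 𝒜 P →₀ R) ⧸ nullForms hP h𝒜 hpr

end Localization

end GrDiv

namespace GrDiv

/-! ### Matrices outside P act bijectively on the form module. -/

section FormModule

variable {Γ : Type v} [Group Γ] {R : Type u} [Ring R] {𝒜 : Γ → AddSubgroup R}
  {P : Set (SqMat R)} {pr : Γ → R →+ R}

theorem compForm_smul_of_mem (hpr : IsProj 𝒜 pr) (h𝒜 : IsGradedMul 𝒜) {a b : Γ} {r : R}
    (hr : r ∈ 𝒜 (a * b⁻¹)) (δ : Γ) (h : Unknown 𝒜 P →₀ R) :
    compForm pr (a * δ) (r • h) = r • compForm pr (b * δ) h := by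
  have := compForm_smul hpr h𝒜 hr (b * δ) h
  rwa [← mul_assoc, inv_mul_cancel_right] at this

variable (hP : IsGrPrime 𝒜 P) (h𝒜 : IsGradedMul 𝒜) (hpr : IsProj 𝒜 pr)

/-- The element Σ f_j w_j plays the role of f A⁻¹ x m, and [[A, x], [f, 0]] ∈ P encodes f A⁻¹ x = 0.
Lifting w and m to forms reduces the claim, in each degree, to `mem_bordered_mul` with the pooled
system in the role of (C, y). -/
theorem sum_smul_eq_zero_of_mem {n : Type*} [Fintype n] {A : Matrix n n R} {x f : n → R}
    {α β : n → Γ} {ε φ : Γ} (hA : HomDeg 𝒜 α β A) (hx : ∀ i, x i ∈ 𝒜 (α i * ε⁻¹))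
    (hf : ∀ j, f j ∈ 𝒜 (φ * (β j)⁻¹)) (hAP : ¬ Mem P A)
    (hAxf : Mem P (Matrix.fromBlocks A (Matrix.of fun i (_ : Unit) => x i)
      (Matrix.of fun (_ : Unit) j => f j) 0))
    {w : n → FormModule hP h𝒜 hpr} {m : FormModule hP h𝒜 hpr}
    (hw : ∀ i, ∑ j, A i j • w j = x i • m) : ∑ j, f j • w j = 0 := by
  choose h hh using fun j => Submodule.Quotient.mk_surjective (nullForms hP h𝒜 hpr) (w j)
  obtain ⟨g, rfl⟩ := Submodule.Quotient.mk_surjective (nullForms hP h𝒜 hpr) m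
  have hnull : ∀ i, x i • g - ∑ j, A i j • h j ∈ nullForms hP h𝒜 hpr := by
    intro i
    rw [← Submodule.Quotient.mk_eq_zero, Submodule.Quotient.mk_sub, ← Submodule.mkQ_apply _ (∑ _, _),
      map_sum]
    simp only [Submodule.mkQ_apply, Submodule.Quotient.mk_smul, hh, hw, sub_self]
  have hgoal : ∑ j, f j • w j = Submodule.Quotient.mk (∑ j, f j • h j) := by
    rw [← Submodule.mkQ_apply _ (∑ _, _), map_sum]
    simp only [Submodule.mkQ_apply, Submodule.Quotient.mk_smul, hh]
  rw [hgoal, Submodule.Quotient.mk_eq_zero]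
  intro δ'
  obtain ⟨δ, rfl⟩ : ∃ δ, δ' = φ * δ := ⟨φ⁻¹ * δ', by simp⟩
  -- There are only finitely many relations, so one large T witnesses all of them.
  filter_upwards [Filter.eventually_all.2 fun i => hnull i (α i * δ)] with T hT
  have key := hP.mem_bordered_mul h𝒜 (homDeg_matIn T) (homDeg_colIn T) (hA.shift δ)
    (ε := fun _ => ε * δ) (φ := fun _ => φ * δ)
    (x := Matrix.of fun i _ => x i) (f := Matrix.of fun _ j => f j)
    (F := Matrix.of fun j (s : UnknownIn T) => compForm pr (β j * δ) (h j) s.1)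
    (g := rowIn T (compForm pr (ε * δ) g)) ?_ ?_ ?_ ?_ hAP hAxf ?_
  · convert key using 2
    unfold NullIn
    congr! 2
    ext i s
    simp only [rowIn, Matrix.of_apply, map_sum, Finset.sum_apply, Matrix.mul_apply]
    exact Finset.sum_congr rfl fun j _ =>
      congrFun (compForm_smul_of_mem hpr h𝒜 (hf j) δ (h j)) s.1
  · intro i j
    simpa [mul_assoc] using hx i
  · intro i j
    simpa [mul_assoc] using hf j
  · exact fun j s => compForm_mem hpr _ _ _
  · exact fun j s => compForm_mem hpr _ _ _
  · intro i
    convert hT i using 2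
    unfold NullIn
    congr! 2
    ext k s
    simp only [rowIn, Matrix.of_apply, map_sub, map_sum, Finset.sum_apply, Matrix.mul_apply,
      Matrix.submatrix_apply, Matrix.sub_apply, Pi.sub_apply, id, Finset.univ_unique,
      Finset.sum_singleton]
    congr 1
    · exact (congrFun (compForm_smul_of_mem hpr h𝒜 (hx i) δ g) s.1).symm
    · exact Finset.sum_congr rfl fun j _ =>
        (congrFun (compForm_smul_of_mem hpr h𝒜 (hA i j) δ (h j)) s.1).symm

/-- Matrices outside `P` act injectively. -/
theorem eq_zero_of_sum_smul_eq_zero {n : Type*} [Fintype n] {A : Matrix n n R}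
    {α β : n → Γ} (hA : HomDeg 𝒜 α β A) (hAP : ¬ Mem P A)
    {w : n → FormModule hP h𝒜 hpr} (hw : ∀ i, ∑ j, A i j • w j = 0) : w = 0 := by
  classical
  ext j
  have hf : ∀ k, Pi.single (M := fun _ => R) j 1 k ∈ 𝒜 (β j * (β k)⁻¹) := by
    intro k
    rcases eq_or_ne k j with rfl | hk
    · simpa using h𝒜.one_mem
    · simp [hk]
  -- With x = 0 and f = e_j the bordered matrix has a zero last column, so it is in P, and the
  -- conclusion reads w_j = 0.
  have := sum_smul_eq_zero_of_mem hP h𝒜 hpr (x := 0) (f := Pi.single j 1) (ε := 1) (φ := β j)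
    (m := 0) hA (fun _ => zero_mem _) hf hAP ?_ (by simpa using hw)
  · simpa [Pi.single_apply] using this
  · refine hP.isPreideal.mem_of_col_eq_sum h𝒜 (α := Sum.elim α fun _ => β j)
      (β := Sum.elim β fun _ => 1) ?_ rfl (Sum.inr ()) 0 (fun _ => zero_mem _) rfl ?_
    · exact hA.fromBlocks (fun _ _ => zero_mem _) (fun _ k => hf k) .zero
    · rintro (i | i) <;> simp

/-- The class of an unknown. -/
noncomputable def formClass (s : Unknown 𝒜 P) : FormModule hP h𝒜 hpr :=
  Submodule.Quotient.mk (Finsupp.single s 1)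

/-- The linear system `1 v = 1`. -/
def unitSystem : LinSystem 𝒜 P where
  ι := Unit
  mat := 1
  col _ := 1
  rdeg _ := 1
  cdeg _ := 1
  homDeg := .one h𝒜
  col_mem _ := h𝒜.one_mem
  notMem := hP.not_mem_one h𝒜

/-- The unknown of the linear system `1 v = 1`. -/
def unitUnknown : Unknown 𝒜 P := ⟨unitSystem hP h𝒜, ()⟩

theorem bigMat_unitUnknown (s : Unknown 𝒜 P) :
    bigMat 𝒜 P (unitUnknown hP h𝒜) s = Finsupp.single (unitUnknown hP h𝒜) (1 : R) s := by
  classical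
  obtain ⟨q, j⟩ := s
  by_cases hq : q = unitSystem hP h𝒜
  · subst hq
    obtain rfl : j = () := rfl
    refine (bigMat_apply_eq (unitSystem hP h𝒜) () ()).trans ?_
    exact (Finsupp.single_eq_same (a := unitUnknown hP h𝒜)).symm
  · rw [bigMat_apply_ne _ _ (Ne.symm hq), Finsupp.single_apply, if_neg]
    intro h
    exact hq (congrArg Sigma.fst h).symm

theorem deg_unitUnknown : (unitUnknown hP h𝒜).deg = 1 := rfl

/-- The class of the solution of `1 v = 1`. -/
noncomputable def oneClass : FormModule hP h𝒜 hpr :=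
  formClass hP h𝒜 hpr (unitUnknown hP h𝒜)

theorem mk_single (s : Unknown 𝒜 P) (r : R) :
    (Submodule.Quotient.mk (Finsupp.single s r) : FormModule hP h𝒜 hpr) =
      r • formClass hP h𝒜 hpr s := by
  rw [formClass, ← Submodule.Quotient.mk_smul]
  simp

theorem single_apply_mem (s t : Unknown 𝒜 P) {δ : Γ} {r : R} (hr : r ∈ 𝒜 (δ * s.deg⁻¹)) :
    Finsupp.single s r t ∈ 𝒜 (δ * t.deg⁻¹) := by
  classical
  rw [Finsupp.single_apply]
  split_ifs with h
  · exact h ▸ hr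
  · exact zero_mem _

/-- The form Σ_j A_ij v_j - x_i · 1 is a combination of rows of the pooled matrix, and the same
combination of the right-hand sides is zero, so its bordered matrix is not gr-full. -/
theorem sum_mat_smul_formClass (p : LinSystem 𝒜 P) (i : p.ι) :
    ∑ j, p.mat i j • formClass hP h𝒜 hpr ⟨p, j⟩ = p.col i • oneClass hP h𝒜 hpr := by
  classical
  let u := unitUnknown hP h𝒜
  rw [← sub_eq_zero, oneClass, ← mk_single]
  simp only [← mk_single]
  simp only [← Submodule.mkQ_apply, ← map_sum, ← map_sub]
  rw [Submodule.mkQ_apply, Submodule.Quotient.mk_eq_zero]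
  refine mem_nullForms_of_homogeneous hP h𝒜 hpr (δ := p.rdeg i) ?_ ?_
  · intro s
    rw [Finsupp.sub_apply, Finsupp.finsetSum_apply]
    refine sub_mem (sum_mem fun j _ => single_apply_mem _ _ ?_) (single_apply_mem _ _ ?_)
    · exact p.homDeg i j
    · simpa [deg_unitUnknown] using p.col_mem i
  filter_upwards [Filter.eventually_ge_atTop {p, u.1}] with T hT
  have hp : p ∈ T := hT (by simp)
  have hp₀ : u.1 ∈ T := hT (by simp)
  let a : UnknownIn T := ⟨⟨p, i⟩, by simpa using hp⟩
  let b : UnknownIn T := ⟨u, by rw [Finset.mem_sigma]; exact ⟨hp₀, Finset.mem_univ _⟩⟩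
  -- The coefficients are 1 at row i of the system p and -x_i at the row of 1 v = 1; on the
  -- right-hand sides this gives x_i - x_i · 1 = 0.
  have key := hP.isPreideal.mem_bordered h𝒜 (φ := fun _ => p.rdeg i)
    (c := Matrix.of fun _ s => Pi.single (M := fun _ => R) a 1 s -
      Pi.single (M := fun _ => R) b (p.col i) s)
    (homDeg_matIn T) (homDeg_colIn T) ?_ ?_
  · unfold NullIn
    convert key using 2
    ext k ⟨⟨q, j⟩, hq⟩
    simp only [rowIn, Matrix.of_apply, Matrix.mul_apply, sub_mul, Finset.sum_sub_distrib,
      Pi.single_apply, ite_mul, one_mul, zero_mul, Finset.sum_ite_eq', Finset.mem_univ, if_true,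
      Finsupp.sub_apply, Finsupp.finsetSum_apply, matIn, Matrix.submatrix_apply]
    congr 1
    · by_cases hqp : q = p
      · subst hqp
        rw [bigMat_apply_eq, Finset.sum_eq_single j]
        · simp
        · intro l _ hl
          rw [Finsupp.single_apply, if_neg]
          simpa using hl
        · simp
      · rw [bigMat_apply_ne _ _ (Ne.symm hqp)]
        refine Finset.sum_eq_zero fun l _ => ?_
        rw [Finsupp.single_apply, if_neg]
        intro h
        exact hqp (congrArg Sigma.fst h).symm
    · rw [show b.1 = unitUnknown hP h𝒜 from rfl, bigMat_unitUnknown]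
      classical simp [Finsupp.single_apply]
  · intro k s
    refine sub_mem ?_ ?_
    · rw [Pi.single_apply]
      split_ifs with h
      · subst h; simpa [a] using h𝒜.one_mem
      · exact zero_mem _
    · rw [Pi.single_apply]
      split_ifs with h
      · subst h
        simpa [b, u, unitUnknown, unitSystem] using p.col_mem i
      · exact zero_mem _
  · ext k l
    simp [Matrix.mul_apply, sub_mul, Finset.sum_sub_distrib, Pi.single_apply, colIn, a, b, u,
      unitUnknown, unitSystem]

/-- Otherwise the pooled matrix bordered by the row of the unit unknown would be in P. Subtracting
the row of 1 v = 1 turns the border into (0, -1), so primeness would put the pooled matrix or (-1)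
into P. -/
theorem oneClass_ne_zero : oneClass hP h𝒜 hpr ≠ 0 := by
  classical
  intro h
  rw [oneClass, formClass, Submodule.Quotient.mk_eq_zero] at h
  let u := unitUnknown hP h𝒜
  have hdeg : ∀ t, Finsupp.single u (1 : R) t ∈ 𝒜 (1 * t.deg⁻¹) :=
    fun t => single_apply_mem _ _ (by simpa [u, deg_unitUnknown] using h𝒜.one_mem)
  have h1 := h 1
  rw [compForm_of_mem hpr hdeg] at h1
  obtain ⟨T, hT, hpT⟩ := (h1.and (Filter.eventually_ge_atTop {u.1})).exists
  have hp₀ : u.1 ∈ T := hpT (by simp)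
  let b : UnknownIn T := ⟨u, by rw [Finset.mem_sigma]; exact ⟨hp₀, Finset.mem_univ _⟩⟩
  unfold NullIn at hT
  rw [← Matrix.fromRows_fromCols_eq_fromBlocks] at hT
  have hmb : ∀ s : UnknownIn T, matIn T b s = Finsupp.single u (1 : R) s.1 :=
    fun s => bigMat_unitUnknown hP h𝒜 s.1
  have := hP.isPreideal.mem_fromRows_add h𝒜 (α := fun s : UnknownIn T => s.1.1.rdeg s.1.2)
    (β := Sum.elim (fun s => s.1.deg) fun _ => 1) (γ := fun _ => 1)
    (C := Matrix.of fun _ s => - Pi.single (M := fun _ => R) b 1 s) ?_ ?_ ?_ hT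
  · have hrows : (Matrix.fromCols (rowIn T (Finsupp.single u (1 : R))) 0 +
        (Matrix.of fun _ s => - Pi.single (M := fun _ => R) b 1 s) *
          Matrix.fromCols (matIn T) (colIn T) : Matrix Unit (UnknownIn T ⊕ Unit) R) =
        Matrix.fromCols 0 (-1) := by
      ext i (s | s)
      · simp [Matrix.mul_apply, Pi.single_apply, hmb, rowIn]
      · simp [Matrix.mul_apply, Pi.single_apply, colIn, b, u, unitUnknown, unitSystem]
    rw [hrows, Matrix.fromRows_fromCols_eq_fromBlocks] at this
    rcases hP.mem_or_mem_of_upper (γ := fun _ => 1) h𝒜 (homDeg_matIn T) (homDeg_colIn T)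
      (HomDeg.one h𝒜).neg rfl this with h | h
    · exact not_mem_matIn hP T h
    · have := hP.mem_mul_left h𝒜 (γ := fun _ => 1) (HomDeg.one (α := fun _ => 1) h𝒜).neg
        (HomDeg.one h𝒜).neg rfl h
      rw [neg_mul_neg, Matrix.one_mul] at this
      exact hP.not_mem_one h𝒜 this
  · rintro i (j | j)
    exacts [homDeg_matIn T i j, homDeg_colIn T i j]
  · rintro i (j | j)
    exacts [hdeg j.1, zero_mem _]
  · intro i s
    rw [Matrix.of_apply, Pi.single_apply]
    split_ifs with h
    · subst h
      simpa [b, u, unitUnknown, unitSystem] using h𝒜.one_mem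
    · simp

theorem exists_sum_smul_eq_single {n : Type} [Fintype n] [DecidableEq n] {B : Matrix n n R}
    {α β : n → Γ} (hB : HomDeg 𝒜 α β B) (hBP : ¬ Mem P B) (i : n) (s : Unknown 𝒜 P) {γ : Γ}
    {r : R} (hr : r ∈ 𝒜 γ) :
    ∃ z : n → FormModule hP h𝒜 hpr, ∀ k, ∑ l, B k l • z l =
      Pi.single (M := fun _ => FormModule hP h𝒜 hpr) i (r • formClass hP h𝒜 hpr s) k := by
  obtain ⟨p, j⟩ := s
  -- Solving B z = e_i r v_j together with the system p is again a system of the allowed kind, with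
  -- matrix [[B, -r e_ij], [0, A_p]]. The shift by δ gives its (i, j) corner entry degree γ, that of
  -- r.
  let δ : Γ := (α i)⁻¹ * γ * p.cdeg j
  have hE : HomDeg 𝒜 (fun k => α k * δ) p.cdeg (-Matrix.single i j r) := by
    refine HomDeg.neg fun k l => ?_
    rw [Matrix.single_apply]
    split_ifs with h
    · obtain ⟨rfl, rfl⟩ := h
      simpa [δ, mul_assoc] using hr
    · exact zero_mem _
  let q : LinSystem 𝒜 P :=
    { ι := n ⊕ p.ι
      mat := Matrix.fromBlocks B (-Matrix.single i j r) 0 p.mat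
      col := Sum.elim 0 p.col
      rdeg := Sum.elim (fun k => α k * δ) p.rdeg
      cdeg := Sum.elim (fun k => β k * δ) p.cdeg
      homDeg := (hB.shift δ).fromBlocks hE .zero p.homDeg
      col_mem := by
        rintro (k | k)
        exacts [zero_mem _, p.col_mem k]
      notMem := fun h => (hP.mem_or_mem_of_upper h𝒜 (hB.shift δ) hE p.homDeg rfl h).elim hBP
        p.notMem }
  have hq := sum_mat_smul_formClass hP h𝒜 hpr q
  have hp := sum_mat_smul_formClass hP h𝒜 hpr p
  -- The second half of the new unknowns solves p again, so by injectivity it coincides with the old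
  -- unknowns.
  have heq : (fun k => formClass hP h𝒜 hpr ⟨q, Sum.inr k⟩ - formClass hP h𝒜 hpr ⟨p, k⟩) = 0 := by
    refine eq_zero_of_sum_smul_eq_zero hP h𝒜 hpr p.homDeg p.notMem fun k => ?_
    have h1 := hq (Sum.inr k)
    rw [Fintype.sum_sum_type] at h1
    simp only [q, Matrix.fromBlocks_apply₂₁, Matrix.fromBlocks_apply₂₂, Matrix.zero_apply,
      zero_smul, Finset.sum_const_zero, zero_add, Sum.elim_inr] at h1
    simp only [smul_sub, Finset.sum_sub_distrib]
    rw [hp k, sub_eq_zero]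
    exact h1
  refine ⟨fun k => formClass hP h𝒜 hpr ⟨q, Sum.inl k⟩, fun k => ?_⟩
  have h1 := hq (Sum.inl k)
  rw [Fintype.sum_sum_type] at h1
  simp only [q, Matrix.fromBlocks_apply₁₁, Matrix.fromBlocks_apply₁₂, Sum.elim_inl,
    Pi.zero_apply, zero_smul, Matrix.neg_apply, neg_smul, Finset.sum_neg_distrib] at h1
  rw [add_neg_eq_zero] at h1
  refine h1.trans ?_
  have h2 : formClass hP h𝒜 hpr ⟨q, Sum.inr j⟩ = formClass hP h𝒜 hpr ⟨p, j⟩ :=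
    sub_eq_zero.1 (congrFun heq j)
  rw [← h2, Finset.sum_eq_single j]
  · rcases eq_or_ne k i with rfl | hk
    · simp [q]
    · simp [hk, Matrix.single_apply_of_row_ne hk.symm]
  · intro l _ hl
    rw [Matrix.single_apply_of_col_ne _ _ hl.symm, zero_smul]
  · simp

/-- Matrices outside `P` act surjectively. -/
theorem exists_sum_smul_eq {n : Type} [Fintype n] {B : Matrix n n R}
    {α β : n → Γ} (hB : HomDeg 𝒜 α β B) (hBP : ¬ Mem P B) (m : n → FormModule hP h𝒜 hpr) :
    ∃ z : n → FormModule hP h𝒜 hpr, ∀ k, ∑ l, B k l • z l = m k := by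
  classical
  -- R need not be commutative, so the solvable right-hand sides are only taken as an additive
  -- subgroup. This suffices: the columns are additively generated by the e_i r v_s with r
  -- homogeneous.
  let H : AddSubgroup (n → FormModule hP h𝒜 hpr) :=
    { carrier := {m | ∃ z : n → FormModule hP h𝒜 hpr, ∀ k, ∑ l, B k l • z l = m k}
      zero_mem' := ⟨0, by simp⟩
      add_mem' := by
        rintro m m' ⟨z, hz⟩ ⟨z', hz'⟩
        exact ⟨z + z', fun k => by simp [smul_add, Finset.sum_add_distrib, hz, hz']⟩
      neg_mem' := by
        rintro m ⟨z, hz⟩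
        exact ⟨-z, fun k => by simp [hz]⟩ }
  change m ∈ H
  rw [← Finset.univ_sum_single m]
  refine sum_mem fun i _ => ?_
  obtain ⟨h, hh⟩ := Submodule.Quotient.mk_surjective (nullForms hP h𝒜 hpr) (m i)
  rw [← hh]
  clear hh
  induction h using Finsupp.induction_linear with
  | zero => simp
  | add h h' ih ih' =>
    rw [Submodule.Quotient.mk_add, Pi.single_add]
    exact add_mem ih ih'
  | single s r =>
    rw [mk_single]
    induction r using induction_homogeneous hpr.iSup_eq_top with
    | hom γ r hr => exact exists_sum_smul_eq_single hP h𝒜 hpr hB hBP i s hr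
    | zero => simp
    | add r r' hr hr' =>
      rw [add_smul, Pi.single_add]
      exact add_mem hr hr'

end FormModule

end GrDiv

namespace GrDiv

/-! ### Fractions f A⁻¹ x and their arithmetic. -/

section Fractions

variable {Γ : Type v} [Group Γ] {R : Type u} [Ring R] {𝒜 : Γ → AddSubgroup R}
  {P : Set (SqMat R)} {S : Type*} [Ring S] {φ : R →+* S}

/-- The matrices outside `P` become invertible under `φ`, and a solution `w` of `A w = x` satisfies
`f w = 0` as soon as the bordered matrix `[[A, x], [f, 0]]` lies in `P`. -/
structure IsInverting (𝒜 : Γ → AddSubgroup R) (P : Set (SqMat R)) (φ : R →+* S) : Prop where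
  isUnit_map : ∀ {n : Type} [Fintype n] [DecidableEq n] {A : Matrix n n R} {α β : n → Γ},
    HomDeg 𝒜 α β A → ¬ Mem P A → IsUnit (A.map φ)
  eq_zero : ∀ {n : Type} [Fintype n] {A : Matrix n n R} {x f : n → R} {α β : n → Γ} {γ : Γ}
    {w : n → S}, HomDeg 𝒜 α β A → (∀ i, x i ∈ 𝒜 (α i)) → (∀ j, f j ∈ 𝒜 (γ * (β j)⁻¹)) →
    ¬ Mem P A → Mem P (Matrix.fromBlocks A (Matrix.of fun i (_ : Unit) => x i)
      (Matrix.of fun (_ : Unit) j => f j) 0) →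
    (∀ i, ∑ j, φ (A i j) * w j = φ (x i)) → ∑ j, φ (f j) * w j = 0

/-- The elements `f A⁻¹ x` of degree `γ`, with homogeneous `f`, `A ∉ P` and `x` over `R`. -/
def IsFrac (𝒜 : Γ → AddSubgroup R) (P : Set (SqMat R)) (φ : R →+* S) (γ : Γ) (u : S) : Prop :=
  ∃ (n : Type) (_ : Fintype n) (_ : DecidableEq n) (A : Matrix n n R) (x f : n → R)
    (α β : n → Γ) (w : n → S), HomDeg 𝒜 α β A ∧ (∀ i, x i ∈ 𝒜 (α i)) ∧
    (∀ j, f j ∈ 𝒜 (γ * (β j)⁻¹)) ∧ ¬ Mem P A ∧ (∀ i, ∑ j, φ (A i j) * w j = φ (x i)) ∧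
    ∑ j, φ (f j) * w j = u

theorem isFrac_map (hP : IsGrPrime 𝒜 P) (h𝒜 : IsGradedMul 𝒜) {γ : Γ} {r : R} (hr : r ∈ 𝒜 γ) :
    IsFrac 𝒜 P φ γ (φ r) :=
  ⟨Unit, inferInstance, inferInstance, 1, fun _ => 1, fun _ => r, fun _ => 1, fun _ => 1,
    fun _ => 1, .one h𝒜, fun _ => h𝒜.one_mem, fun _ => by simpa using hr, hP.not_mem_one h𝒜,
    by simp, by simp⟩

theorem IsFrac.neg {γ : Γ} {u : S} (hu : IsFrac 𝒜 P φ γ u) : IsFrac 𝒜 P φ γ (-u) := by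
  obtain ⟨n, _, _, A, x, f, α, β, w, hA, hx, hf, hAP, hw, rfl⟩ := hu
  exact ⟨n, inferInstance, inferInstance, A, x, -f, α, β, w, hA, hx, fun j => neg_mem (hf j), hAP, hw, by simp⟩

/-- The two systems are placed side by side: u + v = (f, f') (A ⊕ A')⁻¹ (x; x'). -/
theorem IsFrac.add (hP : IsGrPrime 𝒜 P) {γ : Γ} {u v : S} (hu : IsFrac 𝒜 P φ γ u)
    (hv : IsFrac 𝒜 P φ γ v) : IsFrac 𝒜 P φ γ (u + v) := by
  obtain ⟨n, _, _, A, x, f, α, β, w, hA, hx, hf, hAP, hw, rfl⟩ := hu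
  obtain ⟨n', _, _, A', x', f', α', β', w', hA', hx', hf', hAP', hw', rfl⟩ := hv
  refine ⟨n ⊕ n', inferInstance, inferInstance, Matrix.fromBlocks A 0 0 A', Sum.elim x x',
    Sum.elim f f', Sum.elim α α', Sum.elim β β', Sum.elim w w',
    hA.fromBlocks .zero .zero hA', ?_, ?_, ?_, ?_, ?_⟩
  · rintro (i | i)
    exacts [hx i, hx' i]
  · rintro (i | i)
    exacts [hf i, hf' i]
  · exact fun h => (hP.mem_or_mem_of_diag hA hA' rfl h).elim hAP hAP'
  · rintro (i | i)
    · simpa using hw i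
    · simpa using hw' i
  · simp

/-- The product is (f, 0) [[A, -x f'], [0, A']]⁻¹ (0; x'). Shifting the degrees of A by δ makes the
block x f' homogeneous. -/
theorem IsFrac.mul (hP : IsGrPrime 𝒜 P) (h𝒜 : IsGradedMul 𝒜) {γ δ : Γ} {u v : S}
    (hu : IsFrac 𝒜 P φ γ u) (hv : IsFrac 𝒜 P φ δ v) : IsFrac 𝒜 P φ (γ * δ) (u * v) := by
  obtain ⟨n, _, _, A, x, f, α, β, w, hA, hx, hf, hAP, hw, rfl⟩ := hu
  obtain ⟨n', _, _, A', x', f', α', β', w', hA', hx', hf', hAP', hw', rfl⟩ := hv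
  have hB : HomDeg 𝒜 (fun i => α i * δ) β' (-Matrix.of fun i j => x i * f' j) := by
    refine HomDeg.neg fun i j => ?_
    have := h𝒜.mul_mem (hx i) (hf' j)
    rwa [← mul_assoc] at this
  refine ⟨n ⊕ n', inferInstance, inferInstance,
    Matrix.fromBlocks A (-Matrix.of fun i j => x i * f' j) 0 A', Sum.elim 0 x',
    Sum.elim f 0, Sum.elim (fun i => α i * δ) α', Sum.elim (fun i => β i * δ) β',
    Sum.elim (fun j => w j * ∑ j, φ (f' j) * w' j) w',
    (hA.shift δ).fromBlocks hB .zero hA', ?_, ?_, ?_, ?_, ?_⟩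
  · rintro (i | i)
    exacts [zero_mem _, hx' i]
  · rintro (j | j)
    · simpa [mul_assoc] using hf j
    · exact zero_mem _
  · exact fun h => (hP.mem_or_mem_of_upper h𝒜 (hA.shift δ) hB hA' rfl h).elim hAP hAP'
  · rintro (i | i)
    · simp only [Fintype.sum_sum_type, Matrix.fromBlocks_apply₁₁, Matrix.fromBlocks_apply₁₂,
        Sum.elim_inl, Sum.elim_inr, Matrix.neg_apply, Matrix.of_apply, map_neg, map_mul, neg_mul,
        Finset.sum_neg_distrib, Pi.zero_apply, map_zero]
      have h1 : ∑ j, φ (A i j) * (w j * ∑ j, φ (f' j) * w' j) =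
          φ (x i) * ∑ j, φ (f' j) * w' j := by
        rw [← hw, Finset.sum_mul]
        exact Finset.sum_congr rfl fun j _ => (mul_assoc _ _ _).symm
      rw [h1, Finset.mul_sum, ← sub_eq_add_neg, sub_eq_zero]
      exact Finset.sum_congr rfl fun j _ => (mul_assoc _ _ _).symm
    · simpa using hw' i
  · simp [← mul_assoc, ← Finset.sum_mul]

theorem HomDeg.bordered {n : Type*} {A : Matrix n n R} {x f : n → R} {α β : n → Γ} {γ : Γ}
    (hA : HomDeg 𝒜 α β A) (hx : ∀ i, x i ∈ 𝒜 (α i)) (hf : ∀ j, f j ∈ 𝒜 (γ * (β j)⁻¹)) :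
    HomDeg 𝒜 (Sum.elim α fun _ => γ) (Sum.elim β fun _ => 1)
      (Matrix.fromBlocks A (Matrix.of fun i (_ : Unit) => x i)
        (Matrix.of fun (_ : Unit) j => f j) 0) :=
  hA.fromBlocks (fun i _ => by simpa using hx i) (fun _ j => hf j) .zero

/-- The bordered matrix [[A, x], [f, 0]] is outside P, for otherwise u = 0. It sends (w v; -v) to
(0; 1), so the row (0, -1) extracts v as a fraction. -/
theorem IsFrac.inv (hφ : IsInverting 𝒜 P φ) (h𝒜 : IsGradedMul 𝒜) [Nontrivial S] {γ : Γ}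
    {u v : S} (hu : IsFrac 𝒜 P φ γ u) (huv : u * v = 1) : IsFrac 𝒜 P φ γ⁻¹ v := by
  obtain ⟨n, _, _, A, x, f, α, β, w, hA, hx, hf, hAP, hw, rfl⟩ := hu
  refine ⟨n ⊕ Unit, inferInstance, inferInstance,
    Matrix.fromBlocks A (Matrix.of fun i (_ : Unit) => x i) (Matrix.of fun (_ : Unit) j => f j) 0,
    Sum.elim 0 1, Sum.elim 0 (-1), _, _, Sum.elim (fun j => w j * v) fun _ => -v,
    (hA.bordered hx hf).shift γ⁻¹, ?_, ?_, ?_, ?_, ?_⟩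
  · rintro (i | i)
    · exact zero_mem _
    · simpa using h𝒜.one_mem
  · rintro (i | i)
    · exact zero_mem _
    · simpa using h𝒜.one_mem
  · intro h
    rw [hφ.eq_zero hA hx hf hAP h hw, zero_mul] at huv
    exact zero_ne_one huv
  · rintro (i | i)
    · simp [← mul_assoc, ← Finset.sum_mul, hw]
    · simpa [← mul_assoc, ← Finset.sum_mul] using huv
  · simp

/-- If u ≠ 0, the bordered matrix [[A, x], [f, 0]] is outside P and so has an inverse C over S. As
-u is the Schur complement of A, the inverse of u is -q, with q the last diagonal entry of C. -/
theorem IsFrac.isUnit (hφ : IsInverting 𝒜 P φ) {γ : Γ} {u : S} (hu : IsFrac 𝒜 P φ γ u)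
    (hu0 : u ≠ 0) : IsUnit u := by
  obtain ⟨n, _, _, A, x, f, α, β, w, hA, hx, hf, hAP, hw, rfl⟩ := hu
  have hBP := fun h => hu0 (hφ.eq_zero hA hx hf hAP h hw)
  obtain ⟨⟨B, C, hBC, hCB⟩, hB⟩ := hφ.isUnit_map (hA.bordered hx hf) hBP
  obtain ⟨⟨A₀, A₁, hA01, hA10⟩, hA₀⟩ := hφ.isUnit_map hA hAP
  simp only at hB hA₀
  subst hB hA₀
  set u := ∑ j, φ (f j) * w j with hu
  let p : n → S := fun j => C (Sum.inl j) (Sum.inr ())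
  let q : S := C (Sum.inr ()) (Sum.inr ())
  have h1 : ∀ i, ∑ j, φ (A i j) * p j = - (φ (x i) * q) := fun i => by
    have := congrFun (congrFun hBC (Sum.inl i)) (Sum.inr ())
    rw [Matrix.mul_apply, Fintype.sum_sum_type] at this
    simp only [Matrix.map_apply, Matrix.fromBlocks_apply₁₁, Matrix.fromBlocks_apply₁₂,
      Matrix.of_apply, Finset.univ_unique, Finset.sum_singleton] at this
    exact eq_neg_of_add_eq_zero_left (this.trans (Matrix.one_apply_ne (by simp)))
  have h2 : ∑ j, φ (f j) * p j = 1 := by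
    have := congrFun (congrFun hBC (Sum.inr ())) (Sum.inr ())
    rw [Matrix.mul_apply, Fintype.sum_sum_type] at this
    simpa using this
  have hp : ∀ j, p j = - (w j * q) := by
    have h3 : (A.map φ).mulVec (fun j => p j + w j * q) = 0 := by
      ext i
      simp only [Matrix.mulVec, dotProduct, Matrix.map_apply, mul_add, Finset.sum_add_distrib,
        ← mul_assoc, ← Finset.sum_mul, hw, h1]
      simp
    intro j
    have h4 := congrArg A₁.mulVec h3
    rw [Matrix.mulVec_mulVec, hA10, Matrix.one_mulVec, Matrix.mulVec_zero] at h4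
    exact eq_neg_of_add_eq_zero_left (congrFun h4 j)
  have hr : u * -q = 1 := by
    rw [← h2, hu, Finset.sum_mul]
    exact Finset.sum_congr rfl fun j _ => by rw [hp, mul_neg, mul_neg, mul_assoc]
  have hl : -q * u = 1 := by
    have h3 : (Matrix.map (Matrix.fromBlocks A (Matrix.of fun i (_ : Unit) => x i)
        (Matrix.of fun (_ : Unit) j => f j) 0) φ).mulVec (Sum.elim w fun _ => -1) =
        fun k => Matrix.map (1 : Matrix (n ⊕ Unit) (n ⊕ Unit) R) φ k (Sum.inr ()) * u := by
      ext (i | i)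
      · simp [Matrix.mulVec, dotProduct, hw]
      · simp [Matrix.mulVec, dotProduct, hu]
    have h4 := congrFun (congrArg C.mulVec h3) (Sum.inr ())
    rw [Matrix.mulVec_mulVec, hCB, Matrix.one_mulVec] at h4
    simp only [Sum.elim_inr, Matrix.mulVec, dotProduct, Fintype.sum_sum_type, Matrix.map_apply] at h4
    simp only [Finset.univ_unique, Finset.sum_singleton, Matrix.one_apply_eq, map_one, one_mul] at h4
    rw [Finset.sum_eq_zero (fun j _ => by simp), zero_add] at h4
    rw [neg_mul]
    exact (neg_eq_iff_eq_neg.2 h4.symm)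
  exact ⟨⟨u, -q, hr, hl⟩, rfl⟩

theorem DivClosureMem.isFrac (hP : IsGrPrime 𝒜 P) (hφ : IsInverting 𝒜 P φ) (h𝒜 : IsGradedMul 𝒜)
    [Nontrivial S] {γ : Γ} {u : S} (hu : DivClosureMem 𝒜 φ γ u) : IsFrac 𝒜 P φ γ u := by
  induction hu with
  | map hr => exact isFrac_map hP h𝒜 hr
  | add _ _ h h' => exact h.add hP h'
  | neg _ h => exact h.neg
  | mul _ _ h h' => exact h.mul hP h𝒜 h'
  | inv _ hxy _ h => exact h.inv hφ h𝒜 hxy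

end Fractions

/-! ### The endomorphism ring of the form module. -/

section EndRing

/-- A matrix over `R` acting bijectively on the columns over an `R`-module `M` becomes invertible
over the ring of endomorphisms of `M` commuting with the action of `R`. -/
theorem isUnit_map_toModuleEnd {R Z : Type*} [Ring R] [Semiring Z] {M : Type*} [AddCommGroup M]
    [Module R M] [Module Z M] [SMulCommClass R Z M] {n : Type*} [Fintype n] [DecidableEq n]
    {A : Matrix n n R}
    (hinj : ∀ w : n → M, (∀ i, ∑ j, A i j • w j = 0) → w = 0)
    (hsurj : ∀ m : n → M, ∃ w : n → M, ∀ i, ∑ j, A i j • w j = m i) :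
    IsUnit (A.map (Module.toModuleEnd Z (S := R) M)) := by
  let L : Module.End Z (n → M) :=
    { toFun := fun w i => ∑ j, A i j • w j
      map_add' := fun v w => by ext i; simp [smul_add, Finset.sum_add_distrib]
      map_smul' := fun c w => by ext i; simp [Finset.smul_sum, smul_comm _ c] }
  have hL : IsUnit L := by
    rw [Module.End.isUnit_iff]
    refine ⟨(injective_iff_map_eq_zero L).2 fun w hw => hinj w fun i => congrFun hw i, fun m => ?_⟩
    obtain ⟨w, hw⟩ := hsurj m
    exact ⟨w, funext hw⟩
  have hA : endVecRingEquivMatrixEnd n Z M L = A.map (Module.toModuleEnd Z (S := R) M) := by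
    ext i j m
    change ∑ k, A i k • (Pi.single j m : n → M) k = A i j • m
    rw [Finset.sum_eq_single j]
    · rw [Pi.single_eq_same]
    · intro k _ hk
      rw [Pi.single_eq_of_ne hk, smul_zero]
    · exact fun h => absurd (Finset.mem_univ j) h
  rw [← hA]
  exact hL.map _

variable {Γ : Type v} [Group Γ] {R : Type u} [Ring R] {𝒜 : Γ → AddSubgroup R}
  {P : Set (SqMat R)} {pr : Γ → R →+ R} (hP : IsGrPrime 𝒜 P) (h𝒜 : IsGradedMul 𝒜)
  (hpr : IsProj 𝒜 pr)

theorem IsInverting.of_module {Z M : Type*} [Semiring Z] [AddCommGroup M] [Module R M] [Module Z M]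
    [SMulCommClass R Z M]
    (hinj : ∀ {n : Type} [Fintype n] {A : Matrix n n R} {α β : n → Γ}, HomDeg 𝒜 α β A →
      ¬ Mem P A → ∀ w : n → M, (∀ i, ∑ j, A i j • w j = 0) → w = 0)
    (hsurj : ∀ {n : Type} [Fintype n] {A : Matrix n n R} {α β : n → Γ}, HomDeg 𝒜 α β A →
      ¬ Mem P A → ∀ m : n → M, ∃ w : n → M, ∀ i, ∑ j, A i j • w j = m i)
    (hzero : ∀ {n : Type} [Fintype n] {A : Matrix n n R} {x f : n → R} {α β : n → Γ} {γ : Γ},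
      HomDeg 𝒜 α β A → (∀ i, x i ∈ 𝒜 (α i)) → (∀ j, f j ∈ 𝒜 (γ * (β j)⁻¹)) → ¬ Mem P A →
      Mem P (Matrix.fromBlocks A (Matrix.of fun i (_ : Unit) => x i)
        (Matrix.of fun (_ : Unit) j => f j) 0) →
      ∀ (w : n → M) (m : M), (∀ i, ∑ j, A i j • w j = x i • m) → ∑ j, f j • w j = 0) :
    IsInverting 𝒜 P (Module.toModuleEnd Z (S := R) M) where
  isUnit_map {n _ _ A α β} hA hAP := isUnit_map_toModuleEnd (hinj hA hAP) (hsurj hA hAP)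
  eq_zero {n _ A x f α β γ w} hA hx hf hAP hAxf hw := by
    ext m
    simpa using hzero hA hx hf hAP hAxf (fun j => w j m) m fun i => by
      simpa using congrArg (fun g => g m) (hw i)

theorem isInverting_toModuleEnd :
    IsInverting 𝒜 P (Module.toModuleEnd ℤ (S := R) (FormModule hP h𝒜 hpr)) :=
  .of_module (fun hA hAP _ => eq_zero_of_sum_smul_eq_zero hP h𝒜 hpr hA hAP)
    (fun hA hAP => exists_sum_smul_eq hP h𝒜 hpr hA hAP)
    fun hA hx hf hAP hAxf _ _ =>
      sum_smul_eq_zero_of_mem hP h𝒜 hpr (ε := 1) hA (fun i => by simpa using hx i) hf hAP hAxf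

instance : Nontrivial (Module.End ℤ (FormModule hP h𝒜 hpr)) :=
  ⟨⟨0, 1, fun h => oneClass_ne_zero hP h𝒜 hpr
    (congrArg (fun g => g (oneClass hP h𝒜 hpr)) h).symm⟩⟩

/-- A fraction of degree `γ` sends the class of `1` to the class of a form of degree `γ`. -/
theorem IsFrac.exists_apply_oneClass {γ : Γ} {g : Module.End ℤ (FormModule hP h𝒜 hpr)}
    (hg : IsFrac 𝒜 P (Module.toModuleEnd ℤ (S := R) (FormModule hP h𝒜 hpr)) γ g) :
    ∃ h : Unknown 𝒜 P →₀ R, (∀ s, h s ∈ 𝒜 (γ * s.deg⁻¹)) ∧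
      g (oneClass hP h𝒜 hpr) = Submodule.Quotient.mk h := by
  obtain ⟨n, _, _, A, x, f, α, β, w, hA, hx, hf, hAP, hw, rfl⟩ := hg
  let p : LinSystem 𝒜 P := ⟨n, A, x, α, β, hA, hx, hAP⟩
  refine ⟨∑ j, Finsupp.single ⟨p, j⟩ (f j), fun s => ?_, ?_⟩
  · rw [Finsupp.finsetSum_apply]
    exact sum_mem fun j _ => single_apply_mem _ _ (hf j)
  -- The system A v = x of the fraction is one of the systems defining the module. By injectivity,
  -- w_j applied to the class of 1 is the class of its j-th unknown.
  · have h0 : (fun j => w j (oneClass hP h𝒜 hpr) - formClass hP h𝒜 hpr ⟨p, j⟩) = 0 := by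
      refine eq_zero_of_sum_smul_eq_zero hP h𝒜 hpr hA hAP fun i => ?_
      simp only [smul_sub, Finset.sum_sub_distrib]
      rw [sub_eq_zero]
      refine Eq.trans ?_ (sum_mat_smul_formClass hP h𝒜 hpr p i).symm
      simpa using congrArg (fun g => g (oneClass hP h𝒜 hpr)) (hw i)
    rw [← Submodule.mkQ_apply, map_sum]
    simp only [Submodule.mkQ_apply, mk_single, LinearMap.sum_apply]
    exact Finset.sum_congr rfl fun j _ => congrArg (f j • ·) (sub_eq_zero.1 (congrFun h0 j))

/-- The components of fractions are independent. -/
theorem eq_zero_of_sum_isFrac (s : Finset Γ) (g : Γ → Module.End ℤ (FormModule hP h𝒜 hpr))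
    (hg : ∀ γ, IsFrac 𝒜 P (Module.toModuleEnd ℤ (S := R) (FormModule hP h𝒜 hpr)) γ (g γ))
    (hsum : ∑ γ ∈ s, g γ = 0) : ∀ γ ∈ s, g γ = 0 := by
  classical
  choose h hdeg hh using fun γ => (hg γ).exists_apply_oneClass hP h𝒜 hpr
  have hnull : ∑ γ ∈ s, h γ ∈ nullForms hP h𝒜 hpr := by
    rw [← Submodule.Quotient.mk_eq_zero, ← Submodule.mkQ_apply, map_sum]
    simp only [Submodule.mkQ_apply, ← hh, ← LinearMap.sum_apply, hsum, LinearMap.zero_apply]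
  intro γ hγ
  by_contra hne
  have hcomp : compForm pr γ (∑ γ ∈ s, h γ) = h γ := by
    rw [map_sum, Finset.sum_eq_single γ]
    · exact compForm_of_mem hpr (hdeg γ)
    · exact fun δ _ hδ => compForm_of_mem_ne hpr (hdeg δ) hδ
    · exact fun hγ' => absurd hγ hγ'
  -- The relations are graded, so each component of the null form is null and g γ kills the class of
  -- 1. That class is nonzero, whereas a nonzero fraction acts injectively.
  have h0 : h γ ∈ nullForms hP h𝒜 hpr := by
    refine mem_nullForms_of_homogeneous hP h𝒜 hpr (hdeg γ) ?_
    have := hnull γ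
    rwa [hcomp] at this
  have h1 : g γ (oneClass hP h𝒜 hpr) = 0 := by
    rw [hh, Submodule.Quotient.mk_eq_zero]
    exact h0
  have hunit := (hg γ).isUnit (isInverting_toModuleEnd hP h𝒜 hpr) hne
  rw [Module.End.isUnit_iff] at hunit
  exact oneClass_ne_zero hP h𝒜 hpr (hunit.1 (h1.trans (map_zero _).symm))

end EndRing

end GrDiv

namespace GrDiv

/-! ### The division closure as a graded epic division ring. -/

section Epic

variable {Γ : Type v} [Group Γ] {R : Type u} [Ring R] {𝒜 : Γ → AddSubgroup R}
  {S : Type w} [Ring S] {f : R →+* S}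

/-- Terms for the elements of a division closure. -/
inductive DivTerm (R : Type u) : Type u
  | of (r : R) : DivTerm R
  | add (s t : DivTerm R) : DivTerm R
  | neg (t : DivTerm R) : DivTerm R
  | mul (s t : DivTerm R) : DivTerm R
  | inv (t : DivTerm R) : DivTerm R

/-- The value of a term. -/
noncomputable def DivTerm.eval (f : R →+* S) : DivTerm R → S
  | of r => f r
  | add s t => s.eval f + t.eval f
  | neg t => - t.eval f
  | mul s t => s.eval f * t.eval f
  | inv t => Ring.inverse (t.eval f)

theorem DivClosureMem.exists_eval_eq {γ : Γ} {x : S} (hx : DivClosureMem 𝒜 f γ x) :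
    ∃ t : DivTerm R, t.eval f = x := by
  induction hx with
  | map hr => exact ⟨.of _, rfl⟩
  | add _ _ h h' =>
    obtain ⟨s, rfl⟩ := h
    obtain ⟨t, rfl⟩ := h'
    exact ⟨s.add t, rfl⟩
  | neg _ h =>
    obtain ⟨s, rfl⟩ := h
    exact ⟨s.neg, rfl⟩
  | mul _ _ h h' =>
    obtain ⟨s, rfl⟩ := h
    obtain ⟨t, rfl⟩ := h'
    exact ⟨s.mul t, rfl⟩
  | inv _ hxy hyx h =>
    obtain ⟨s, rfl⟩ := h
    refine ⟨s.inv, ?_⟩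
    exact Ring.inverse_unit ⟨s.eval f, _, hxy, hyx⟩

theorem exists_eval_eq_of_mem_divClosure {x : S} (hx : x ∈ divClosure 𝒜 f) :
    ∃ t : DivTerm R, t.eval f = x := by
  induction hx using AddSubgroup.closure_induction with
  | mem x hx => exact hx.choose_spec.exists_eval_eq
  | zero => exact ⟨.of 0, map_zero f⟩
  | add x y _ _ h h' =>
    obtain ⟨s, rfl⟩ := h
    obtain ⟨t, rfl⟩ := h'
    exact ⟨s.add t, rfl⟩
  | neg x _ h =>
    obtain ⟨s, rfl⟩ := h
    exact ⟨s.neg, rfl⟩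

/-- Every element is the value of a term over R. This allows K to live in the universe of R although
the form module may live in a larger one. -/
theorem small_divClosure : Small.{u} (divClosure 𝒜 f) :=
  have : Small.{u} (Set.range (DivTerm.eval f)) := small_range _
  small_subset (t := (divClosure 𝒜 f : Set S)) (s := Set.range (DivTerm.eval f))
    fun _ hx => exists_eval_eq_of_mem_divClosure hx

theorem DivClosureMem.mem_divClosure {γ : Γ} {x : S} (hx : DivClosureMem 𝒜 f γ x) :
    x ∈ divClosure 𝒜 f :=
  AddSubgroup.subset_closure ⟨γ, hx⟩

theorem mul_mem_divClosure {x y : S} (hx : x ∈ divClosure 𝒜 f) (hy : y ∈ divClosure 𝒜 f) :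
    x * y ∈ divClosure 𝒜 f := by
  induction hx using AddSubgroup.closure_induction with
  | mem x hx =>
    induction hy using AddSubgroup.closure_induction with
    | mem y hy => exact (hx.choose_spec.mul hy.choose_spec).mem_divClosure
    | zero => rw [mul_zero]; exact zero_mem _
    | add a b _ _ h h' => rw [mul_add]; exact add_mem h h'
    | neg a _ h => rw [mul_neg]; exact neg_mem h
  | zero => rw [zero_mul]; exact zero_mem _
  | add a b _ _ h h' => rw [add_mul]; exact add_mem h h'
  | neg a _ h => rw [neg_mul]; exact neg_mem h

/-- The division closure as a subring. -/
def divClosureSubring (h𝒜 : IsGradedMul 𝒜) (f : R →+* S) : Subring S :=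
  { divClosure 𝒜 f with
    mul_mem' := mul_mem_divClosure
    one_mem' := (map_one f) ▸ (DivClosureMem.map (f := f) h𝒜.one_mem).mem_divClosure }

theorem map_mem_divClosure {pr : Γ → R →+ R} (hpr : IsProj 𝒜 pr) (r : R) :
    f r ∈ divClosure 𝒜 f := by
  induction r using induction_homogeneous hpr.iSup_eq_top with
  | zero => rw [map_zero]; exact zero_mem _
  | add x y h h' => rw [map_add]; exact add_mem h h'
  | hom γ x hx => exact (DivClosureMem.map hx).mem_divClosure

/-- If the components of a division closure are independent, and if their nonzero elements are
invertible, then the division closure is a graded epic division ring. -/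
theorem isGradedEpicDivisionRing_of_ringHom {K : Type*} [Ring K] [Nontrivial K]
    (h𝒜 : IsGradedMul 𝒜) (i : K →+* S) (hi : Function.Injective i) (φ : R →+* K)
    (hφ : ∀ r, i (φ r) = f r) (hrange : ∀ x, (∃ k, i k = x) ↔ x ∈ divClosure 𝒜 f)
    (hindep : ∀ (s : Finset Γ) (g : Γ → S), (∀ γ, DivClosureMem 𝒜 f γ (g γ)) →
      ∑ γ ∈ s, g γ = 0 → ∀ γ ∈ s, g γ = 0)
    (hunit : ∀ {γ : Γ} {x : S}, DivClosureMem 𝒜 f γ x → x ≠ 0 → IsUnit x) :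
    ∃ ℬ : Γ → AddSubgroup K, IsGradedEpicDivisionRing 𝒜 ℬ φ := by
  -- K is an abstract copy of the division closure, so the closure must be regenerated inside K;
  -- inverses formed in S come back to K because the range of `i` is the whole closure.
  have hlift : ∀ {γ : Γ} {x : S}, DivClosureMem 𝒜 f γ x →
      ∃ k, i k = x ∧ DivClosureMem 𝒜 φ γ k := by
    intro γ x hx
    induction hx with
    | map hr => exact ⟨_, hφ _, .map hr⟩
    | add _ _ h h' =>
      obtain ⟨k, rfl, hk⟩ := h
      obtain ⟨l, rfl, hl⟩ := h'
      exact ⟨k + l, map_add _ _ _, hk.add hl⟩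
    | neg _ h =>
      obtain ⟨k, rfl, hk⟩ := h
      exact ⟨-k, map_neg _ _, hk.neg⟩
    | mul _ _ h h' =>
      obtain ⟨k, rfl, hk⟩ := h
      obtain ⟨l, rfl, hl⟩ := h'
      exact ⟨k * l, map_mul _ _ _, hk.mul hl⟩
    | inv hx hxy hyx h =>
      obtain ⟨k, rfl, hk⟩ := h
      obtain ⟨l, rfl⟩ := (hrange _).2 (hx.inv hxy hyx).mem_divClosure
      exact ⟨l, rfl, hk.inv (hi (by simpa using hxy)) (hi (by simpa using hyx))⟩
  let ℬ : Γ → AddSubgroup K := fun γ =>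
    { carrier := {k | DivClosureMem 𝒜 f γ (i k)}
      zero_mem' := by
        simpa using DivClosureMem.map (𝒜 := 𝒜) (f := f) (zero_mem (𝒜 γ))
      add_mem' := fun {a b} ha hb => by simpa using DivClosureMem.add ha hb
      neg_mem' := fun {a} ha => by simpa using DivClosureMem.neg ha }
  have hmem : ∀ {γ : Γ} {k : K}, k ∈ ℬ γ ↔ DivClosureMem 𝒜 f γ (i k) := Iff.rfl
  refine ⟨ℬ, ⟨⟨?_, ?_, ?_⟩, inferInstance, ?_⟩, ?_, ?_⟩
  · simpa [hmem] using DivClosureMem.map (f := f) h𝒜.one_mem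
  · intro γ δ x y hx hy
    simpa [hmem] using DivClosureMem.mul hx hy
  · classical
    constructor
    · refine (injective_iff_map_eq_zero _).2 fun x hx => ?_
      have hsum : ∑ γ ∈ DFinsupp.support x, i (x γ) = 0 := by
        rw [← map_sum, ← map_zero i, ← hx]
        congr 1
        conv_rhs => rw [← DirectSum.sum_support_of x]
        simp
      ext γ
      by_cases hγ : γ ∈ DFinsupp.support x
      · have := hindep _ _ (fun γ => (x γ).2) hsum γ hγ
        exact hi (by simpa using this)
      · simpa using hγ
    · intro k
      have hk : i k ∈ divClosure 𝒜 f := (hrange _).1 ⟨k, rfl⟩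
      obtain ⟨x, hx⟩ : i k ∈ (i.toAddMonoidHom.comp (DirectSum.coeAddMonoidHom ℬ)).range := by
        refine (AddSubgroup.closure_le _).2 ?_ hk
        rintro y ⟨γ, hy⟩
        obtain ⟨l, rfl, -⟩ := hlift hy
        exact ⟨DirectSum.of (fun γ => ℬ γ) γ ⟨l, hy⟩, by simp⟩
      exact ⟨x, hi hx⟩
  · intro γ x hx hx0
    have hix : i x ≠ 0 := fun h => hx0 (hi (by simpa using h))
    obtain ⟨y, hy⟩ := hunit hx hix
    have hxy : i x * ↑y⁻¹ = 1 := hy ▸ y.mul_inv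
    have hyx : ↑y⁻¹ * i x = 1 := hy ▸ y.inv_mul
    obtain ⟨l, hl⟩ := (hrange _).2 (DivClosureMem.inv hx hxy hyx).mem_divClosure
    rw [← hl] at hxy hyx
    exact ⟨⟨x, l, hi (by simpa using hxy), hi (by simpa using hyx)⟩, rfl⟩
  · intro γ r hr
    exact hmem.2 (hφ r ▸ DivClosureMem.map hr)
  · rw [eq_top_iff]
    intro k _
    have hk : i k ∈ divClosure 𝒜 f := (hrange _).1 ⟨k, rfl⟩
    obtain ⟨l, hl, hlk⟩ : i k ∈ (divClosure 𝒜 φ).map i.toAddMonoidHom := by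
      refine (AddSubgroup.closure_le _).2 ?_ hk
      rintro y ⟨γ, hy⟩
      obtain ⟨l, rfl, hl⟩ := hlift hy
      exact ⟨l, hl.mem_divClosure, rfl⟩
    rwa [← hi hlk]

theorem exists_isGradedEpicDivisionRing [Nontrivial S] (h𝒜 : IsGradedMul 𝒜)
    {pr : Γ → R →+ R} (hpr : IsProj 𝒜 pr)
    (hindep : ∀ (s : Finset Γ) (g : Γ → S), (∀ γ, DivClosureMem 𝒜 f γ (g γ)) →
      ∑ γ ∈ s, g γ = 0 → ∀ γ ∈ s, g γ = 0)
    (hunit : ∀ {γ : Γ} {x : S}, DivClosureMem 𝒜 f γ x → x ≠ 0 → IsUnit x) :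
    ∃ (K : Type u) (_ : Ring K) (ℬ : Γ → AddSubgroup K) (φ : R →+* K),
      IsGradedEpicDivisionRing 𝒜 ℬ φ := by
  let D := divClosureSubring h𝒜 f
  have : Small.{u} D := small_divClosure (𝒜 := 𝒜) (f := f)
  have : Nontrivial (Shrink.{u} D) := (equivShrink D).symm.nontrivial
  let e : Shrink.{u} D ≃+* D := Shrink.ringEquiv D
  let φ : R →+* D := f.codRestrict D fun r => map_mem_divClosure hpr r
  have hrange : ∀ x, (∃ k, (D.subtype.comp (e : Shrink.{u} D →+* D)) k = x) ↔
      x ∈ divClosure 𝒜 f := by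
    refine fun x => ⟨?_, fun hx => ⟨e.symm ⟨x, hx⟩, by simp⟩⟩
    rintro ⟨k, rfl⟩
    exact (e k).2
  obtain ⟨ℬ, hℬ⟩ := isGradedEpicDivisionRing_of_ringHom (𝒜 := 𝒜) (f := f) h𝒜
    (D.subtype.comp (e : Shrink.{u} D →+* D)) (Subtype.val_injective.comp e.injective)
    ((e.symm : D →+* Shrink.{u} D).comp φ) (fun r => by simp [φ]; rfl) hrange hindep hunit
  exact ⟨_, _, ℬ, _, hℬ⟩

theorem IsProperGrMatrixIdeal.exists_isGradedEpicDivisionRing {I : Set (SqMat R)}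
    (hI : IsProperGrMatrixIdeal 𝒜 I) (h : IsGradedRing 𝒜) :
    ∃ (K : Type u) (_ : Ring K) (ℬ : Γ → AddSubgroup K) (φ : R →+* K),
      IsGradedEpicDivisionRing 𝒜 ℬ φ := by
  have h𝒜 := h.isGradedMul
  obtain ⟨P, hP⟩ := hI.exists_isGrPrime h𝒜
  obtain ⟨pr, hpr⟩ := h.exists_isProj
  have hφ := isInverting_toModuleEnd hP h𝒜 hpr
  exact GrDiv.exists_isGradedEpicDivisionRing h𝒜 hpr
    (fun s g hg hsum => eq_zero_of_sum_isFrac hP h𝒜 hpr s g (fun γ => (hg γ).isFrac hP hφ h𝒜) hsum)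
    fun hx hx0 => (hx.isFrac hP hφ h𝒜).isUnit hφ hx0

end Epic

end GrDiv

namespace GrDiv

/-! ### Linear algebra over almost graded division rings. -/

section AlmostGraded

variable {Γ : Type v} [Group Γ] {E : Type u} [Ring E] {ℬ : Γ → AddSubgroup E}

/-- The degree γ⁻¹ component of u⁻¹ is already a right inverse of u, by comparing components of u
u⁻¹ = 1; so it equals u⁻¹. -/
theorem IsGradedDivisionRing.isAlmostGradedDivisionRing (h : IsGradedDivisionRing ℬ) :
    IsAlmostGradedDivisionRing ℬ := by
  obtain ⟨pr, hpr⟩ := h.toIsGradedRing.exists_isProj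
  refine ⟨⟨h.one_mem, h.mul_mem, hpr.iSup_eq_top⟩, h.nontrivial, fun {γ x} hx hx0 => ?_⟩
  obtain ⟨u, rfl⟩ := h.isUnit hx hx0
  have h1 : (u : E) * pr γ⁻¹ ↑u⁻¹ = 1 := by
    rw [← hpr.mul_left h.toIsGradedRing.isGradedMul hx, mul_inv_cancel, u.mul_inv,
      hpr.of_mem h.one_mem]
  have h2 : pr γ⁻¹ ↑u⁻¹ = (↑u⁻¹ : E) := (u.mul_right_inj.1 (h1.trans u.mul_inv.symm))
  exact ⟨_, hpr.mem _ _, h1, by rw [h2, u.inv_mul]⟩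

theorem IsAlmostGradedDivisionRing.map {F : Type*} [Ring F] (h : IsAlmostGradedDivisionRing ℬ)
    (e : E ≃+* F) : IsAlmostGradedDivisionRing fun γ => (ℬ γ).map (e : E →+ F) := by
  have := h.nontrivial
  refine ⟨⟨⟨1, h.one_mem, map_one e⟩, ?_, ?_⟩, e.toEquiv.symm.nontrivial, ?_⟩
  · rintro γ δ _ _ ⟨x, hx, rfl⟩ ⟨y, hy, rfl⟩
    exact ⟨x * y, h.mul_mem hx hy, map_mul e x y⟩
  · rw [← AddSubgroup.map_iSup, h.iSup_eq_top]
    exact AddSubgroup.map_top_of_surjective _ e.surjective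
  · rintro γ _ ⟨x, hx, rfl⟩ hx0
    obtain ⟨y, hy, hxy, hyx⟩ := h.exists_inv hx fun h0 => hx0 (by simp [h0])
    exact ⟨e y, ⟨y, hy, rfl⟩, by simp [← map_mul, hxy], by simp [← map_mul, hyx]⟩

/-- Passing to the opposite ring reverses products of degrees; inverting the degrees restores their
order. -/
theorem IsAlmostGradedDivisionRing.op (h : IsAlmostGradedDivisionRing ℬ) :
    IsAlmostGradedDivisionRing fun γ =>
      (ℬ γ⁻¹).map ((MulOpposite.opAddEquiv : E ≃+ Eᵐᵒᵖ) : E →+ Eᵐᵒᵖ) := by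
  have := h.nontrivial
  refine ⟨⟨⟨1, by simpa using h.one_mem, rfl⟩, ?_, ?_⟩, inferInstance, ?_⟩
  · rintro γ δ _ _ ⟨x, hx, rfl⟩ ⟨y, hy, rfl⟩
    refine ⟨y * x, ?_, rfl⟩
    simpa using h.mul_mem hy hx
  · rw [← AddSubgroup.map_iSup, show ⨆ γ, ℬ γ⁻¹ = ⨆ γ, ℬ γ from (Equiv.inv Γ).iSup_comp (g := ℬ), h.iSup_eq_top]
    exact AddSubgroup.map_top_of_surjective _ MulOpposite.opAddEquiv.surjective
  · rintro γ _ ⟨x, hx, rfl⟩ hx0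
    obtain ⟨y, hy, hxy, hyx⟩ := h.exists_inv hx fun h0 => hx0 (by simp [h0])
    exact ⟨MulOpposite.op y, ⟨y, hy, rfl⟩, congrArg MulOpposite.op hyx,
      congrArg MulOpposite.op hxy⟩

/-- A homogeneous matrix with more columns than rows kills a nonzero homogeneous column. -/
theorem IsAlmostGradedDivisionRing.exists_mulVec_eq_zero (h : IsAlmostGradedDivisionRing ℬ)
    {m : ℕ} {κ : Type*} [Fintype κ] {A : Matrix (Fin m) κ E} {α : Fin m → Γ} {β : κ → Γ}
    (hA : HomDeg ℬ α β A) (hm : m < Fintype.card κ) :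
    ∃ (δ : Γ) (v : κ → E), v ≠ 0 ∧ (∀ j, v j ∈ ℬ (β j * δ⁻¹)) ∧ A.mulVec v = 0 := by
  classical
  have := h.nontrivial
  induction m generalizing κ with
  | zero =>
    obtain ⟨j⟩ : Nonempty κ := Fintype.card_pos_iff.1 hm
    refine ⟨β j, Pi.single j 1, by simp, fun k => ?_, Subsingleton.elim _ _⟩
    rcases eq_or_ne k j with rfl | hk
    · simpa using h.one_mem
    · rw [Pi.single_eq_of_ne hk]
      exact zero_mem _
  | succ m ih =>
    by_cases h0 : ∀ j, A 0 j = 0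
    · obtain ⟨δ, v, hv, hdeg, hAv⟩ := ih (A := A.submatrix Fin.succ id) (α := fun i => α i.succ)
        (β := β) (fun i j => hA i.succ j) (by omega)
      refine ⟨δ, v, hv, hdeg, funext fun i => ?_⟩
      refine Fin.cases ?_ (fun i => congrFun hAv i) i
      simp [Matrix.mulVec, dotProduct, h0]
    -- Gaussian elimination with pivot (0, j₀): the other rows are reduced to a matrix without the
    -- column j₀, whose kernel vector extends uniquely by the value c that row 0 forces at j₀.
    · push Not at h0
      obtain ⟨j₀, hj₀⟩ := h0
      obtain ⟨y, hy, hxy, -⟩ := h.exists_inv (hA 0 j₀) hj₀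
      have hy' : ∀ j, y * A 0 j ∈ ℬ (β j₀ * (β j)⁻¹) := fun j => by
        simpa [mul_assoc] using h.mul_mem hy (hA 0 j)
      obtain ⟨δ, v, hv, hdeg, hAv⟩ := ih (κ := {j // j ≠ j₀})
        (A := Matrix.of fun i j => A i.succ j - A i.succ j₀ * (y * A 0 j)) (α := fun i => α i.succ)
        (β := fun j => β j) (fun i j => sub_mem (hA i.succ j) (by
          simpa [mul_assoc] using h.mul_mem (hA i.succ j₀) (hy' j)))
        (by rw [Fintype.card_subtype_compl, Fintype.card_subtype_eq]; omega)
      let c : E := -∑ j : {j // j ≠ j₀}, y * A 0 j * v j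
      let w : κ → E := fun j => if hj : j = j₀ then c else v ⟨j, hj⟩
      have hw₀ : w j₀ = c := dif_pos rfl
      have hw : ∀ j : {j // j ≠ j₀}, w j = v j := fun j => dif_neg j.2
      have hAw : ∀ i, A.mulVec w i = A i j₀ * c + ∑ j : {j // j ≠ j₀}, A i j * v j := fun i => by
        simp only [Matrix.mulVec, dotProduct]
        rw [Fintype.sum_eq_add_sum_subtype_ne _ j₀, hw₀]
        simp only [hw]
      refine ⟨δ, w, ?_, ?_, ?_⟩
      · intro hw0
        refine hv (funext fun j => ?_)
        rw [← hw, hw0]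
        rfl
      · intro j
        by_cases hj : j = j₀
        · subst hj
          rw [hw₀]
          refine neg_mem (sum_mem fun k _ => ?_)
          simpa [mul_assoc] using h.mul_mem (hy' k) (hdeg k)
        · rw [hw ⟨j, hj⟩]
          exact hdeg ⟨j, hj⟩
      · funext i
        rw [hAw, Pi.zero_apply]
        induction i using Fin.cases with
        | zero =>
          rw [mul_neg, Finset.mul_sum, neg_add_eq_zero]
          exact Finset.sum_congr rfl fun j _ => by rw [← mul_assoc, ← mul_assoc, hxy, one_mul]
        | succ i =>
          refine Eq.trans ?_ (congrFun hAv i)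
          simp only [Matrix.mulVec, dotProduct, Matrix.of_apply, sub_mul, Finset.sum_sub_distrib]
          rw [mul_neg, Finset.mul_sum, sub_eq_neg_add]
          simp only [mul_assoc]

/-- Appending e_k as a column to A gives more columns than rows, hence a kernel vector. Its last
coordinate is nonzero since A has no homogeneous kernel; dividing by it solves A x = e_k. -/
theorem IsAlmostGradedDivisionRing.exists_rightInverse (h : IsAlmostGradedDivisionRing ℬ)
    {n : ℕ} {A : Matrix (Fin n) (Fin n) E} {α β : Fin n → Γ} (hA : HomDeg ℬ α β A)
    (hker : ∀ (δ : Γ) (v : Fin n → E), (∀ j, v j ∈ ℬ (β j * δ⁻¹)) → A.mulVec v = 0 → v = 0) :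
    ∃ B : Matrix (Fin n) (Fin n) E, HomDeg ℬ β α B ∧ A * B = 1 := by
  have key : ∀ k, ∃ x : Fin n → E, (∀ j, x j ∈ ℬ (β j * (α k)⁻¹)) ∧
      A.mulVec x = Pi.single k 1 := by
    intro k
    have hcol : HomDeg ℬ α (Sum.elim β fun _ : Unit => α k)
        (Matrix.fromCols A (Matrix.of fun i _ => Pi.single (M := fun _ => E) k 1 i)) := by
      rintro i (j | j)
      · exact hA i j
      · rcases eq_or_ne i k with rfl | hik
        · simpa using h.one_mem
        · simp [hik]
    obtain ⟨δ, v, hv, hdeg, hv0⟩ := h.exists_mulVec_eq_zero hcol (by simp)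
    have hsum : ∀ i, A.mulVec (fun j => v (Sum.inl j)) i +
        Pi.single (M := fun _ => E) k 1 i * v (Sum.inr ()) = 0 := fun i => by
      simpa [Matrix.mulVec, dotProduct] using congrFun hv0 i
    have hc : v (Sum.inr ()) ≠ 0 := by
      intro hc
      refine hv (funext ?_)
      have := hker δ (fun j => v (Sum.inl j)) (fun j => hdeg (Sum.inl j))
        (funext fun i => by simpa [hc] using hsum i)
      rintro (j | j)
      exacts [congrFun this j, hc]
    obtain ⟨y, hy, hcy, -⟩ := h.exists_inv (hdeg (Sum.inr ())) hc
    refine ⟨fun j => -(v (Sum.inl j) * y), fun j => neg_mem ?_, funext fun i => ?_⟩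
    · simpa [mul_assoc] using h.mul_mem (hdeg (Sum.inl j)) hy
    · have := congrArg (· * y) (hsum i)
      simp only [add_mul, mul_assoc, hcy, mul_one, zero_mul] at this
      rw [← neg_eq_of_add_eq_zero_right this]
      simp [Matrix.mulVec, dotProduct, Finset.sum_mul, mul_assoc]
  choose x hx hAx using key
  refine ⟨Matrix.of fun j k => x k j, fun j k => hx k j, ?_⟩
  ext i k
  have := congrFun (hAx k) i
  rw [Matrix.one_eq_pi_single, Pi.single_comm] 
  exact this

/-- If A has no homogeneous kernel it has a homogeneous right inverse B. From A B = 1 also B has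
trivial kernel, hence a right inverse, which must be A. -/
theorem IsAlmostGradedDivisionRing.exists_mulVec_eq_zero_of_not_isUnit
    (h : IsAlmostGradedDivisionRing ℬ) {n : ℕ} {A : Matrix (Fin n) (Fin n) E} {α β : Fin n → Γ}
    (hA : HomDeg ℬ α β A) (hu : ¬ IsUnit A) :
    ∃ (δ : Γ) (v : Fin n → E), v ≠ 0 ∧ (∀ j, v j ∈ ℬ (β j * δ⁻¹)) ∧ A.mulVec v = 0 := by
  by_contra! hker
  obtain ⟨B, hB, hAB⟩ := h.exists_rightInverse hA fun δ v hv hAv =>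
    by_contra fun h0 => hker δ v h0 hv hAv
  obtain ⟨C, -, hBC⟩ := h.exists_rightInverse hB fun δ v _ hBv => by
    rw [← Matrix.one_mulVec v, ← hAB, ← Matrix.mulVec_mulVec, hBv, Matrix.mulVec_zero]
  obtain rfl : A = C := left_inv_eq_right_inv hAB hBC
  exact hu ⟨⟨A, B, hAB, hBC⟩, rfl⟩

theorem not_isUnit_of_mulVec_eq_zero {n : Type*} [Fintype n] [DecidableEq n] {A : Matrix n n E}
    {v : n → E} (hv : v ≠ 0) (hAv : A.mulVec v = 0) : ¬ IsUnit A := by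
  rintro ⟨u, rfl⟩
  refine hv ?_
  rw [← Matrix.one_mulVec v, ← u.inv_mul, ← Matrix.mulVec_mulVec, hAv, Matrix.mulVec_zero]

/-- A determinantal sum, with respect to a column, of singular homogeneous matrices is singular. -/
theorem IsAlmostGradedDivisionRing.not_isUnit_updateCol (h : IsAlmostGradedDivisionRing ℬ)
    {n : ℕ} {A B : Matrix (Fin n) (Fin n) E} {α β : Fin n → Γ} (hA : HomDeg ℬ α β A)
    (hB : HomDeg ℬ α β B) (hAu : ¬ IsUnit A) (hBu : ¬ IsUnit B) {i : Fin n}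
    (hAB : ∀ k j, j ≠ i → A k j = B k j) :
    ¬ IsUnit (A.updateCol i fun k => A k i + B k i) := by
  have := h.nontrivial
  obtain ⟨δ, v, hv, hvdeg, hAv⟩ := h.exists_mulVec_eq_zero_of_not_isUnit hA hAu
  obtain ⟨ε, w, hw, hwdeg, hBw⟩ := h.exists_mulVec_eq_zero_of_not_isUnit hB hBu
  have hsplit : ∀ (M : Matrix (Fin n) (Fin n) E) (x : Fin n → E) (k : Fin n),
      M.mulVec x k = M k i * x i + ∑ j : {j // j ≠ i}, M k j * x j := fun M x k => by
    rw [Matrix.mulVec, dotProduct, Fintype.sum_eq_add_sum_subtype_ne _ i]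
  have hC : ∀ (x : Fin n → E) (k : Fin n),
      (A.updateCol i fun k => A k i + B k i).mulVec x k =
        (A k i + B k i) * x i + ∑ j : {j // j ≠ i}, A k j * x j := fun x k => by
    rw [hsplit, Matrix.updateCol_self]
    congr 1
    exact Finset.sum_congr rfl fun j _ => by rw [Matrix.updateCol_ne j.2]
  have hB' : ∀ (x : Fin n → E) (k : Fin n),
      B.mulVec x k = B k i * x i + ∑ j : {j // j ≠ i}, A k j * x j := fun x k => by
    rw [hsplit]
    congr 1
    exact Finset.sum_congr rfl fun j _ => by rw [hAB k j j.2]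
  -- A kernel vector with zero i-th coordinate does not see column i, so it also kills the sum.
  by_cases hvi : v i = 0
  · refine not_isUnit_of_mulVec_eq_zero hv (funext fun k => ?_)
    rw [← hAv, hC, hsplit, hvi, mul_zero, mul_zero]
  by_cases hwi : w i = 0
  · refine not_isUnit_of_mulVec_eq_zero hw (funext fun k => ?_)
    rw [← hBw, hC, hB', hwi, mul_zero, mul_zero]
  obtain ⟨y, -, hy, -⟩ := h.exists_inv (hvdeg i) hvi
  obtain ⟨z, -, hz, -⟩ := h.exists_inv (hwdeg i) hwi
  -- With the i-th coordinates of v y and w z normalised to 1, the vector with i-th entry 1 and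
  -- other entries v_j y + w_j z is killed by A ∇ B. It need not be homogeneous, only nonzero.
  refine not_isUnit_of_mulVec_eq_zero
    (v := Function.update (fun j => v j * y + w j * z) i 1) ?_ (funext fun k => ?_)
  · intro h0
    simpa using congrFun h0 i
  · have h1 := congrArg (· * y) (congrFun hAv k)
    have h2 := congrArg (· * z) (congrFun hBw k)
    simp only [hsplit A v, hB', add_mul, mul_assoc, hy, hz, mul_one, Pi.zero_apply, zero_mul,
      Finset.sum_mul] at h1 h2
    rw [hC, Function.update_self, mul_one,
      Finset.sum_congr rfl fun (j : {j // j ≠ i}) _ => by rw [Function.update_of_ne j.2, mul_add],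
      Finset.sum_add_distrib, Pi.zero_apply, add_add_add_comm, h1, h2, add_zero]

/-- Transposing into the opposite ring reverses products and fixes 1. It reduces row sums to column
sums. -/
theorem isUnit_transpose_map_op_iff {n : Type*} [Fintype n] [DecidableEq n] {A : Matrix n n E} :
    IsUnit (A.transpose.map MulOpposite.op) ↔ IsUnit A := by
  have hmul : ∀ B C : Matrix n n E, (B * C).transpose.map MulOpposite.op =
      C.transpose.map MulOpposite.op * B.transpose.map MulOpposite.op := fun B C => by
    ext i j
    simp [Matrix.mul_apply]
  have hone : (1 : Matrix n n E).transpose.map MulOpposite.op = 1 := by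
    rw [Matrix.transpose_one, Matrix.map_one _ rfl rfl]
  have hinj : Function.Injective fun B : Matrix n n E => B.transpose.map MulOpposite.op :=
    fun B C hBC => by
      ext i j
      exact MulOpposite.op_injective (congrFun (congrFun hBC j) i)
  constructor
  · rintro ⟨⟨B, C, hBC, hCB⟩, rfl⟩
    have hC : (C.transpose.map MulOpposite.unop).transpose.map MulOpposite.op = C := rfl
    rw [← hC, ← hmul, ← hone] at hBC hCB
    exact ⟨⟨A, C.transpose.map MulOpposite.unop, hinj hCB, hinj hBC⟩, rfl⟩
  · rintro ⟨⟨B, C, hBC, hCB⟩, rfl⟩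
    exact ⟨⟨B.transpose.map MulOpposite.op, C.transpose.map MulOpposite.op, by rw [← hmul, hCB, hone],
      by rw [← hmul, hBC, hone]⟩, rfl⟩

/-- A determinantal sum, with respect to a row, of singular homogeneous matrices is singular. -/
theorem IsAlmostGradedDivisionRing.not_isUnit_updateRow (h : IsAlmostGradedDivisionRing ℬ)
    {n : ℕ} {A B : Matrix (Fin n) (Fin n) E} {α β : Fin n → Γ} (hA : HomDeg ℬ α β A)
    (hB : HomDeg ℬ α β B) (hAu : ¬ IsUnit A) (hBu : ¬ IsUnit B) {i : Fin n}
    (hAB : ∀ j k, j ≠ i → A j k = B j k) :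
    ¬ IsUnit (A.updateRow i fun k => A i k + B i k) := by
  have hop : ∀ {M : Matrix (Fin n) (Fin n) E}, HomDeg ℬ α β M →
      HomDeg (fun γ => (ℬ γ⁻¹).map ((MulOpposite.opAddEquiv : E ≃+ Eᵐᵒᵖ) : E →+ Eᵐᵒᵖ)) β α
        (M.transpose.map MulOpposite.op) := fun {M} hM j k =>
    ⟨M k j, by simpa using hM k j, rfl⟩
  rw [← isUnit_transpose_map_op_iff] at hAu hBu ⊢
  convert h.op.not_isUnit_updateCol (hop hA) (hop hB) hAu hBu (i := i)
    (fun k j hj => congrArg MulOpposite.op (hAB j k hj)) using 2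
  rw [← Matrix.updateCol_transpose, Matrix.map_updateCol]
  rfl

variable {R : Type w} [Ring R] {𝒜 : Γ → AddSubgroup R}

/-- Determinantal sums of matrices that are not gr-full become singular over an almost graded
division ring. -/
theorem IsDetSum.not_isUnit_map (h : IsAlmostGradedDivisionRing ℬ) {φ : R →+* E}
    (hφ : IsGradedHom 𝒜 ℬ φ) {M : SqMat R} (hM : IsDetSum 𝒜 (nonGrFull 𝒜) M) :
    ¬ IsUnit (M.2.map φ) := by
  have hdeg : ∀ {m n : ℕ} {α : Fin m → Γ} {β : Fin n → Γ} {A : Matrix (Fin m) (Fin n) R},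
      HasDegrees 𝒜 α β A → HomDeg ℬ α β (A.map φ) := fun hA i j => hφ _ _ (hA i j)
  induction hM with
  | of hM =>
    obtain ⟨-, r, α, β, ε, P, Q, hr, -, hQ, hPQ⟩ := hM
    -- The factor Q has r < n rows, so it has a nonzero kernel vector, which PQ kills too.
    obtain ⟨δ, v, hv, -, hQv⟩ := h.exists_mulVec_eq_zero (hdeg hQ) (by simpa using hr)
    refine not_isUnit_of_mulVec_eq_zero hv ?_
    rw [hPQ, Matrix.map_mul, ← Matrix.mulVec_mulVec, hQv, Matrix.mulVec_zero]
  | @nabla n A B C _ _ hC hA hB =>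
    obtain ⟨⟨α, β, hAd, hBd⟩, ⟨i, hAB, rfl⟩ | ⟨i, hAB, rfl⟩⟩ := hC
    · convert h.not_isUnit_updateCol (hdeg hAd) (hdeg hBd) hA hB (i := i)
        (fun k j hj => congrArg φ (hAB k j hj)) using 2
      rw [Matrix.map_updateCol]
      congr 1
      ext k
      simp
    · convert h.not_isUnit_updateRow (hdeg hAd) (hdeg hBd) hA hB (i := i)
        (fun j k hj => congrArg φ (hAB j k hj)) using 2
      rw [Matrix.map_updateRow]
      congr 1
      ext k
      simp

theorem not_isDetSum_of_mem_identityMatrices (h : IsAlmostGradedDivisionRing ℬ) {φ : R →+* E}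
    (hφ : IsGradedHom 𝒜 ℬ φ) {M : SqMat R} (hM : M ∈ identityMatrices R) :
    ¬ IsDetSum 𝒜 (nonGrFull 𝒜) M := by
  rintro hdet
  obtain ⟨n, -, rfl⟩ := hM
  refine hdet.not_isUnit_map h hφ ?_
  simp

end AlmostGraded

end GrDiv
-- The equivalence.
theorem mainTheorem5 {Γ : Type v} [Group Γ] {R : Type u} [Ring R]
    (𝒜 : Γ → AddSubgroup R) (h𝒜 : GrDiv.IsGradedRing 𝒜) :
    List.TFAE [
      ∃ (K : Type u) (_ : Ring K) (ℬ : Γ → AddSubgroup K) (φ : R →+* K),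
        GrDiv.IsGradedEpicDivisionRing 𝒜 ℬ φ,
      ∃ (K : Type (max u w)) (_ : Ring K) (ℬ : Γ → AddSubgroup K) (φ : R →+* K),
        GrDiv.IsAlmostGradedDivisionRing ℬ ∧ GrDiv.IsGradedHom 𝒜 ℬ φ,
      GrDiv.IsProperGrMatrixIdeal 𝒜 (GrDiv.grMatrixNilradical 𝒜),
      ∀ M ∈ GrDiv.identityMatrices R, ¬ GrDiv.IsDetSum 𝒜 (GrDiv.nonGrFull 𝒜) M] := by
  tfae_have 1 → 2
  | ⟨K, _, ℬ, φ, h⟩ =>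
    -- The lift only adjusts the universe: assertion 2 allows any universe `max u w`, while the ring
    -- built for assertion 1 lives in `u`.
    ⟨ULift.{w} K, inferInstance, _, (ULift.ringEquiv.symm : K ≃+* ULift.{w} K).toRingHom.comp φ,
      h.isGradedDivisionRing.isAlmostGradedDivisionRing.map ULift.ringEquiv.symm,
      fun γ x hx => ⟨φ x, h.isGradedHom γ x hx, rfl⟩⟩
  tfae_have 2 → 4
  | ⟨_, _, _, _, h, hφ⟩ => fun _ hM => GrDiv.not_isDetSum_of_mem_identityMatrices h hφ hM
  tfae_have 4 → 3 := GrDiv.isProperGrMatrixIdeal_grMatrixNilradical h𝒜.isGradedMul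
  tfae_have 3 → 1 := fun h => h.exists_isGradedEpicDivisionRing h𝒜
  tfae_finish
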